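/- Let $\mathbb K$ be a field of characteristic $0$. A 3-Lie algebra is a $\mathbb K$-vector space $\mathfrak g$ with an alternating trilinear map $[\cdot,\cdot,\cdot]_{\mathfrak g}$ satisfying, for all $x_1,\dots,x_5\in\mathfrak g$, $$[x_1,x_2,[x_3,x_4,x_5]]=[[x_1,x_2,x_3],x_4,x_5]+[x_3,[x_1,x_2,x_4],x_5]+[x_3,x_4,[x_1,x_2,x_5]].$$ An action of a 3-Lie algebra $(\mathfrak g,\pi)$ on a 3-Lie algebra $(\mathfrak h,\mu)$ is a linear map $\rho:\wedge^2\mathfrak g\to\mathfrak{gl}(\mathfrak h)$ such that, for all $x_i,x,y\in\mathfrak g$ and $u,v,w\in\mathfrak h$, $$\rho(x_1,x_2)\rho(x_3,x_4)=\rho(\pi(x_1,x_2,x_3),x_4)+\rho(x_3,\pi(x_1,x_2,x_4))+\rho(x_3,x_4)\rho(x_1,x_2),$$ $$\rho(x_1,\pi(x_2,x_3,x_4))=\rho(x_3,x_4)\rho(x_1,x_2)-\rho(x_2,x_4)\rho(x_1,x_3)+\rho(x_2,x_3)\rho(x_1,x_4),$$ $\mu(\rho(x,y)u,v,w)=0$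 and $\rho(x,y)\mu(u,v,w)=0$. For vector spaces $V,W$ let $C^n(V,W)=\mathrm{Hom}(\wedge^2V\otimes\cdots\otimes\wedge^2V\wedge V,W)$ with $n\ge 0$ factors $\wedge^2V$, i.e. the linear maps $f(\mathfrak X_1,\dots,\mathfrak X_n,x)$ on $(\wedge^2V)^{\otimes n}\otimes V$ that, for $n\ge1$ and $\mathfrak X_n=x_n\wedge y_n$, are alternating in $x_n,y_n,x$; let $C^*(V,W)=\bigoplus_{n\ge0}C^n(V,W)$, graded by $n$. On $C^*(V,V)$ put $[P,Q]=P\circ Q-(-1)^{pq}Q\circ P$ for $P\in C^p(V,V)$, $Q\in C^q(V,V)$, where, with $S(a,b)$ the $(a,b)$-unshuffles and $\mathfrak X_i=x_i\wedge y_i$, $$\begin{aligned}(P\circ Q)(\mathfrak X_1,\dots,\mathfrak X_{p+q},x)={}&\sum_{k=1}^{p}(-1)^{(k-1)q}\sum_{\sigma\in S(k-1,q)}(-1)^\sigma P\big(\mathfrak X_{\sigma(1)},\dots,\mathfrak X_{\sigma(k-1)},Q_{k,\sigma}(x_{k+q})\wedge y_{k+q}+x_{k+q}\wedge Q_{k,\sigma}(y_{k+q}),\mathfrak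 X_{k+q+1},\dots,\mathfrak X_{p+q},x\big)\\&+(-1)^{pq}\sum_{\sigma\in S(p,q)}(-1)^\sigma P\big(\mathfrak X_{\sigma(1)},\dots,\mathfrak X_{\sigma(p)},Q(\mathfrak X_{\sigma(p+1)},\dots,\mathfrak X_{\sigma(p+q)},x)\big),\end{aligned}$$ with $Q_{k,\sigma}(z)=Q(\mathfrak X_{\sigma(k)},\dots,\mathfrak X_{\sigma(k+q-1)},z)$. Let $\rho$ be an action of $(\mathfrak g,\pi)$ on $(\mathfrak h,\mu)$, let $L=C^*(\mathfrak g\oplus\mathfrak h,\mathfrak g\oplus\mathfrak h)$, and let $F=C^*(\mathfrak g,\mathfrak h)\subset L$, a cochain being extended by $0$ to arguments in $\mathfrak h$. Let $\mathcal P:L\to L$ be the projection onto $F$ that restricts the arguments to $\mathfrak g$ and takes the $\mathfrak h$-component of the value. Let $\Delta=\pi+\rho+\mu\in C^1(\mathfrak g\oplus\mathfrak h,\mathfrak g\oplus\mathfrak h)$, $$\Delta(x+u,y+v,z+w)=\pi(x,y,z)+\rho(x,y)w+\rho(y,z)u+\rho(z,x)v+\mu(u,v,w).$$ Then $(L,F,\mathcal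 P,\Delta)$ is a V-data: $(L,[\cdot,\cdot])$ is a graded Lie algebra, $F$ is an abelian graded Lie subalgebra, $\mathcal P^2=\mathcal P$ has image $F$, $\ker\mathcal P$ is a graded Lie subalgebra, $\Delta\in\ker\mathcal P$ has degree $1$, and $[\Delta,\Delta]=0$. Consequently, the higher derived brackets $l_k(a_1,\dots,a_k)=\mathcal P[\cdots[[\Delta,a_1],a_2],\cdots,a_k]$, $k\ge1$, make $C^*(\mathfrak g,\mathfrak h)$ an $L_\infty$-algebra: each $l_k$ is multilinear of degree $1$ and graded symmetric, $l_n(x_{\sigma(1)},\dots,x_{\sigma(n)})=\varepsilon(\sigma)l_n(x_1,\dots,x_n)$ with the Koszul sign $\varepsilon(\sigma)$, and for all $n\ge1$ and homogeneous $x_1,\dots,x_n$ $$\sum_{i=1}^{n}\sum_{\sigma\in S(i,n-i)}\varepsilon(\sigma)\,l_{n-i+1}\big(l_i(x_{\sigma(1)},\dots,x_{\sigma(i)}),x_{\sigma(i+1)},\dots,x_{\sigma(n)}\big)=0.$$ Moreover, for all $P,Q,R\in C^*(\mathfrak g,\mathfrak h)$: $l_1(P)=\mathcal P[\Delta,P]$,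 and $l_1(P)$ agrees with $[\Delta,P]$ on arguments in $\mathfrak g$; $l_3(P,Q,R)=[[[\Delta,P],Q],R]$; and $l_k=0$ for all $k\ne1,3$. -/

import Mathlib

namespace ThreeLie

section Brackets

variable {K g h V : Type*} [Field K] [AddCommGroup g] [Module K g] [AddCommGroup h] [Module K h]
  [AddCommGroup V] [Module K V]

/-- A skew-symmetric trilinear map is a 3-Lie bracket if it satisfies the Fundamental Identity. -/
def IsThreeLieBracket (π : g [⋀^Fin 3]→ₗ[K] g) : Prop :=
  ∀ x₁ x₂ x₃ x₄ x₅ : g,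
    π ![x₁, x₂, π ![x₃, x₄, x₅]] =
      π ![π ![x₁, x₂, x₃], x₄, x₅] + π ![x₃, π ![x₁, x₂, x₄], x₅] + π ![x₃, x₄, π ![x₁, x₂, x₅]]

/-- A representation of the 3-Lie algebra `(g, π)` on the vector space `V`. -/
structure IsRepresentation (π : g [⋀^Fin 3]→ₗ[K] g) (ρ : g [⋀^Fin 2]→ₗ[K] Module.End K V) :
    Prop where
  rep₁ : ∀ x₁ x₂ x₃ x₄ : g,
    ρ ![x₁, x₂] * ρ ![x₃, x₄] =
      ρ ![π ![x₁, x₂, x₃], x₄] + ρ ![x₃, π ![x₁, x₂, x₄]] + ρ ![x₃, x₄] * ρ ![x₁, x₂]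
  rep₂ : ∀ x₁ x₂ x₃ x₄ : g,
    ρ ![x₁, π ![x₂, x₃, x₄]] =
      ρ ![x₃, x₄] * ρ ![x₁, x₂] - ρ ![x₂, x₄] * ρ ![x₁, x₃] + ρ ![x₂, x₃] * ρ ![x₁, x₄]

/-- The center of the 3-Lie algebra `(h, μ)`. -/
def center (μ : h [⋀^Fin 3]→ₗ[K] h) : Set h :=
  {u | ∀ v w : h, μ ![u, v, w] = 0}

/-- An action of the 3-Lie algebra `(g, π)` on the 3-Lie algebra `(h, μ)`. -/
structure IsAction (π : g [⋀^Fin 3]→ₗ[K] g) (μ : h [⋀^Fin 3]→ₗ[K] h)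
    (ρ : g [⋀^Fin 2]→ₗ[K] Module.End K h) : Prop extends IsRepresentation π ρ where
  mem_center : ∀ (x y : g) (u : h), ρ ![x, y] u ∈ center μ
  map_bracket : ∀ (x y : g) (u v w : h), ρ ![x, y] (μ ![u, v, w]) = 0

theorem update_pair_zero {M : Type*} (a b t : M) : Function.update ![a, b] 0 t = ![t, b] := by
  ext i
  fin_cases i <;> simp

theorem update_pair_one {M : Type*} (a b t : M) : Function.update ![a, b] 1 t = ![a, t] := by
  ext i
  fin_cases i <;> simp

theorem alt₂_add_left (f : g [⋀^Fin 2]→ₗ[K] V) (a b c : g) :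
    f ![a + b, c] = f ![a, c] + f ![b, c] := by
  have := f.map_update_add ![a, c] 0 a b
  simpa only [update_pair_zero, update_pair_one] using this

theorem alt₂_add_right (f : g [⋀^Fin 2]→ₗ[K] V) (a b c : g) :
    f ![a, b + c] = f ![a, b] + f ![a, c] := by
  have := f.map_update_add ![a, b] 1 b c
  simpa only [update_pair_zero, update_pair_one] using this

theorem alt₂_smul_left (f : g [⋀^Fin 2]→ₗ[K] V) (r : K) (a b : g) :
    f ![r • a, b] = r • f ![a, b] := by
  have := f.map_update_smul ![a, b] 0 r a
  simpa only [update_pair_zero, update_pair_one] using this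

theorem alt₂_smul_right (f : g [⋀^Fin 2]→ₗ[K] V) (r : K) (a b : g) :
    f ![a, r • b] = r • f ![a, b] := by
  have := f.map_update_smul ![a, b] 1 r b
  simpa only [update_pair_zero, update_pair_one] using this

theorem alt₂_self (f : g [⋀^Fin 2]→ₗ[K] V) (a : g) : f ![a, a] = 0 :=
  f.map_eq_zero_of_eq ![a, a] (i := 0) (j := 1) (by simp) (by decide)

theorem alt₂_swap (f : g [⋀^Fin 2]→ₗ[K] V) (a b : g) : f ![a, b] = -f ![b, a] := by
  have := f.map_swap ![b, a] (i := 0) (j := 1) (by decide)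
  rw [← this]
  congr 1
  ext t
  fin_cases t <;> simp

/-- The alternating map
`(x + u, y + v, z + w) ↦ ρ(x, y) w + ρ(y, z) u + ρ(z, x) v` on `g ⊕ h` with values in `h`. -/
def actionPart (ρ : g [⋀^Fin 2]→ₗ[K] Module.End K h) : (g × h) [⋀^Fin 3]→ₗ[K] h where
  toFun a := ρ ![(a 0).1, (a 1).1] (a 2).2 + ρ ![(a 1).1, (a 2).1] (a 0).2
    + ρ ![(a 2).1, (a 0).1] (a 1).2
  map_update_add' := by
    intro inst m i x y
    obtain rfl : inst = instDecidableEqFin 3 := Subsingleton.elim _ _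
    fin_cases i <;> simp [Function.update, alt₂_add_left, alt₂_add_right] <;> abel
  map_update_smul' := by
    intro inst m i c x
    obtain rfl : inst = instDecidableEqFin 3 := Subsingleton.elim _ _
    fin_cases i <;> simp [Function.update, alt₂_smul_left, alt₂_smul_right]
  map_eq_zero_of_eq' := by
    intro a i j hij hne
    have hs := alt₂_swap ρ
    have hz := alt₂_self ρ
    fin_cases i <;> fin_cases j <;> simp at hij hne ⊢ <;> rw [hij] <;> simp [hz] <;>
      first
        | rw [hs (a 2).1 (a 1).1]; simp
        | rw [hs (a 1).1 (a 0).1]; simp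
        | rw [hs (a 2).1 (a 0).1]; simp

/-- The alternating map `π + ρ + μ` on `g ⊕ h`:
`(x + u, y + v, z + w) ↦ π(x, y, z) + ρ(x, y) w + ρ(y, z) u + ρ(z, x) v + μ(u, v, w)`. -/
def semidirect (π : g [⋀^Fin 3]→ₗ[K] g) (ρ : g [⋀^Fin 2]→ₗ[K] Module.End K h)
    (μ : h [⋀^Fin 3]→ₗ[K] h) : (g × h) [⋀^Fin 3]→ₗ[K] (g × h) :=
  (LinearMap.inl K g h).compAlternatingMap (π.compLinearMap (LinearMap.fst K g h))
    + (LinearMap.inr K g h).compAlternatingMap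
        (actionPart ρ + μ.compLinearMap (LinearMap.snd K g h))

theorem semidirect_apply (π : g [⋀^Fin 3]→ₗ[K] g) (ρ : g [⋀^Fin 2]→ₗ[K] Module.End K h)
    (μ : h [⋀^Fin 3]→ₗ[K] h) (x y z : g) (u v w : h) :
    semidirect π ρ μ ![(x, u), (y, v), (z, w)] =
      (π ![x, y, z], ρ ![x, y] w + ρ ![y, z] u + ρ ![z, x] v + μ ![u, v, w]) := by
  have e1 : (fun i => (![(x, u), (y, v), (z, w)] i).1) = ![x, y, z] := by
    ext i; fin_cases i <;> rfl
  have e2 : (fun i => (![(x, u), (y, v), (z, w)] i).2) = ![u, v, w] := by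
    ext i; fin_cases i <;> rfl
  simp [semidirect, actionPart, e1, e2]

end Brackets


section Unshuffles

/-- `σ` is an `(a, n - a)`-unshuffle: `σ(1) < ⋯ < σ(a)` and `σ(a+1) < ⋯ < σ(n)`
(positions are counted from `0` in `Fin n`). -/
def IsUnshuffle {n : ℕ} (a : ℕ) (σ : Equiv.Perm (Fin n)) : Prop :=
  (∀ i j : Fin n, i < j → (j : ℕ) < a → σ i < σ j) ∧
    (∀ i j : Fin n, i < j → a ≤ (i : ℕ) → σ i < σ j)

open scoped Classical in
/-- The finite set `S(a, n - a)` of `(a, n - a)`-unshuffles of `n` letters. -/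
noncomputable def unshuffles (n a : ℕ) : Finset (Equiv.Perm (Fin n)) :=
  Finset.univ.filter (IsUnshuffle a)

/-- The permutation of `n + 1` letters that puts the largest letter at position `a` and is given by
`τ` on the other positions. -/
def insertTop {n : ℕ} (a : Fin (n + 1)) (τ : Equiv.Perm (Fin n)) : Equiv.Perm (Fin (n + 1)) :=
  (finSuccEquiv' a).trans ((Equiv.optionCongr τ).trans (finSuccEquiv' (Fin.last n)).symm)

theorem insertTop_self {n : ℕ} (a : Fin (n + 1)) (τ : Equiv.Perm (Fin n)) :
    insertTop a τ a = Fin.last n := by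
  simp [insertTop]

theorem insertTop_succAbove {n : ℕ} (a : Fin (n + 1)) (τ : Equiv.Perm (Fin n)) (i : Fin n) :
    insertTop a τ (a.succAbove i) = (τ i).castSucc := by
  simp [insertTop]

theorem sign_insertTop {n : ℕ} (a : Fin (n + 1)) (τ : Equiv.Perm (Fin n)) :
    Equiv.Perm.sign (insertTop a τ) = (-1) ^ (n - (a : ℕ)) * Equiv.Perm.sign τ := by
  have h1 : insertTop a τ * Fin.cycleIcc a (Fin.last n) = insertTop (Fin.last n) τ := by
    ext i
    refine Fin.lastCases ?_ (fun i => ?_) i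
    · rw [Equiv.Perm.mul_apply, Fin.cycleIcc_of_last (Fin.le_last a), insertTop_self,
        insertTop_self]
    · have h2 := congrFun (Fin.cycleIcc_comp_succAbove a (Fin.last n) (Fin.le_last a)) i
      simp only [Function.comp_apply, Fin.succAbove_last] at h2
      rw [Equiv.Perm.mul_apply, h2, insertTop_succAbove, ← Fin.succAbove_last_apply i,
        insertTop_succAbove]
  have h3 : Equiv.Perm.sign (insertTop (Fin.last n) τ) = Equiv.Perm.sign τ := by
    rw [← Equiv.optionCongr_sign τ]
    exact Equiv.Perm.sign_trans_trans_symm (Equiv.optionCongr τ) (finSuccEquiv' (Fin.last n))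
  have h4 := congrArg Equiv.Perm.sign h1
  rw [Equiv.Perm.sign_mul, Fin.sign_cycleIcc_of_le (Fin.le_last a), h3, Fin.val_last] at h4
  rw [← h4, mul_comm, mul_assoc, ← mul_pow]
  simp

theorem insertTop_surjective {n : ℕ} (a : Fin (n + 1)) (σ : Equiv.Perm (Fin (n + 1)))
    (h : σ a = Fin.last n) : ∃ τ, insertTop a τ = σ := by
  let e : Option (Fin n) ≃ Option (Fin n) :=
    (finSuccEquiv' a).symm.trans (σ.trans (finSuccEquiv' (Fin.last n)))
  have he : e none = none := by simp [e, h]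
  refine ⟨Equiv.removeNone e, ?_⟩
  have h2 : Equiv.optionCongr (Equiv.removeNone e) = e := by
    ext1 o
    cases o with
    | none => simp [he]
    | some i =>
      have : e (some i) ≠ none := fun hh => by
        have := e.injective (hh.trans he.symm)
        simp at this
      exact Equiv.removeNone_some e (Option.ne_none_iff_exists'.1 this)
  ext1 i
  simp [insertTop, h2, e]

theorem sum_unshuffles_top {M : Type*} [AddCommMonoid M] {N n a : ℕ} (h : N = n + 1) (ha : a ≤ n)
    (F : Equiv.Perm (Fin N) → M) (G : Equiv.Perm (Fin n) → M)
    (h0 : ∀ σ ∈ unshuffles N (a + 1), (σ ⟨a, by omega⟩ : ℕ) ≠ n → F σ = 0)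
    (h1 : ∀ (σ : Equiv.Perm (Fin N)) (τ : Equiv.Perm (Fin n)), (σ ⟨a, by omega⟩ : ℕ) = n →
      (∀ (i : ℕ) (hi : i < n), i < a → (σ ⟨i, by omega⟩ : ℕ) = τ ⟨i, hi⟩) →
      (∀ (i : ℕ) (hi : i < n), a ≤ i → (σ ⟨i + 1, by omega⟩ : ℕ) = τ ⟨i, hi⟩) →
      Equiv.Perm.sign σ = (-1) ^ (n - a) * Equiv.Perm.sign τ → F σ = G τ) :
    ∑ σ ∈ unshuffles N (a + 1), F σ = ∑ τ ∈ unshuffles n a, G τ := by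
  classical
  subst h
  set b : Fin (n + 1) := ⟨a, by omega⟩ with hb
  have lo : ∀ (τ : Equiv.Perm (Fin n)) (i : ℕ) (hi : i < n), i < a →
      (insertTop b τ ⟨i, by omega⟩ : ℕ) = τ ⟨i, hi⟩ := by
    intro τ i hi hia
    have := insertTop_succAbove b τ ⟨i, hi⟩
    rw [Fin.succAbove_of_castSucc_lt _ _ (by simpa [Fin.lt_def, hb] using hia)] at this
    exact congrArg Fin.val this
  have up : ∀ (τ : Equiv.Perm (Fin n)) (i : ℕ) (hi : i < n), a ≤ i →
      (insertTop b τ ⟨i + 1, by omega⟩ : ℕ) = τ ⟨i, hi⟩ := by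
    intro τ i hi hia
    have := insertTop_succAbove b τ ⟨i, hi⟩
    rw [Fin.succAbove_of_le_castSucc _ _ (by simpa [Fin.le_def, hb] using hia)] at this
    exact congrArg Fin.val this
  have tp : ∀ τ : Equiv.Perm (Fin n), (insertTop b τ b : ℕ) = n := fun τ => by
    rw [insertTop_self]; rfl
  have mem : ∀ τ : Equiv.Perm (Fin n),
      insertTop b τ ∈ unshuffles (n + 1) (a + 1) ↔ τ ∈ unshuffles n a := by
    intro τ
    simp only [unshuffles, Finset.mem_filter, Finset.mem_univ, true_and, IsUnshuffle]
    constructor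
    · rintro ⟨hl, hr⟩
      constructor
      · rintro ⟨i, hi⟩ ⟨j, hj⟩ hij hja
        have hij' : i < j := hij
        have hja' : j < a := hja
        have := hl ⟨i, by omega⟩ ⟨j, by omega⟩ hij (by simp; omega)
        rw [Fin.lt_def, lo τ i hi (by omega), lo τ j hj hja'] at this
        exact this
      · rintro ⟨i, hi⟩ ⟨j, hj⟩ hij hia
        have hij' : i < j := hij
        have hia' : a ≤ i := hia
        have := hr ⟨i + 1, by omega⟩ ⟨j + 1, by omega⟩ (by simpa [Fin.lt_def] using hij')
          (by simpa using hia')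
        rw [Fin.lt_def, up τ i hi hia', up τ j hj (by omega)] at this
        exact this
    · rintro ⟨hl, hr⟩
      constructor
      · rintro ⟨i, hi⟩ ⟨j, hj⟩ hij hja
        have hij' : i < j := hij
        have hja' : j < a + 1 := hja
        rw [Fin.lt_def, lo τ i (by omega) (by omega)]
        rcases Nat.lt_or_ge j a with hj2 | hj2
        · rw [lo τ j (by omega) hj2]
          exact hl ⟨i, by omega⟩ ⟨j, by omega⟩ hij hj2
        · obtain rfl : j = a := by omega
          have := tp τ
          rw [hb] at this
          rw [this]
          exact (τ _).isLt
      · rintro ⟨i, hi⟩ ⟨j, hj⟩ hij hia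
        have hij' : i < j := hij
        have hia' : a + 1 ≤ i := hia
        obtain ⟨i, rfl⟩ : ∃ i', i = i' + 1 := ⟨i - 1, by omega⟩
        obtain ⟨j, rfl⟩ : ∃ j', j = j' + 1 := ⟨j - 1, by omega⟩
        rw [Fin.lt_def, up τ i (by omega) (by omega), up τ j (by omega) (by omega)]
        exact hr ⟨i, by omega⟩ ⟨j, by omega⟩ (by simpa [Fin.lt_def] using hij')
          (by simp; omega)
  symm
  refine Finset.sum_bij_ne_zero (fun τ _ _ => insertTop b τ) ?_ ?_ ?_ ?_
  · intro τ hτ _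
    exact (mem τ).2 hτ
  · intro τ _ _ τ' _ _ hh
    ext i
    have h2 := insertTop_succAbove b τ i
    rw [hh, insertTop_succAbove] at h2
    simpa using (congrArg Fin.val h2).symm
  · intro σ hσ hne
    have ht : (σ b : ℕ) = n := by
      by_contra hc
      exact hne (h0 σ hσ hc)
    obtain ⟨τ, rfl⟩ := insertTop_surjective b σ (Fin.ext ht)
    refine ⟨τ, (mem τ).1 hσ, ?_, rfl⟩
    rwa [← h1 _ τ ht (lo τ) (up τ) (sign_insertTop b τ)]
  · intro τ _ _
    exact (h1 _ τ (tp τ) (lo τ) (up τ) (sign_insertTop b τ)).symm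

end Unshuffles

section Cochains

variable (K : Type*) [Field K]

/-- `Hom(∧²V ⊗ ⋯ ⊗ ∧²V ⊗ V, W)` with `n` factors `∧²V`, as multilinear maps
`(𝔛₁, …, 𝔛ₙ) ↦ (x ↦ f(𝔛₁, …, 𝔛ₙ, x))`. -/
abbrev PreCochain (n : ℕ) (V W : Type*) [AddCommGroup V] [Module K V] [AddCommGroup W]
    [Module K W] : Type _ :=
  MultilinearMap K (fun _ : Fin n => ⋀[K]^2 V) (V →ₗ[K] W)

/-- `Cⁿ(V, W) = Hom(∧²V ⊗ ⋯ ⊗ ∧²V ∧ V, W)` with `n` factors `∧²V`: the maps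
`f(𝔛₁, …, 𝔛ₙ, x)` that are (for `n ≥ 1`) alternating in the last three vectors `xₙ, yₙ, x`,
where `𝔛ₙ = xₙ ∧ yₙ`. As `f` is alternating in `xₙ, yₙ`, it is enough that it vanishes if
`x = yₙ`. -/
def cochainSubmodule (n : ℕ) (V W : Type*) [AddCommGroup V] [Module K V] [AddCommGroup W] [Module K W] :
    Submodule K (PreCochain K n V W) where
  carrier := {f | ∀ i : Fin n, (i : ℕ) + 1 = n → ∀ (X : Fin n → ⋀[K]^2 V) (x y : V),
    f (Function.update X i (exteriorPower.ιMulti K 2 ![x, y])) y = 0}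
  add_mem' := by
    intro f f' hf hf' i hi X x y
    simp [hf i hi X x y, hf' i hi X x y]
  zero_mem' := by
    intro i hi X x y
    simp
  smul_mem' := by
    intro c f hf i hi X x y
    simp [hf i hi X x y]

/-- The vector space `Cⁿ(V, W)`. -/
def Cochain (n : ℕ) (V W : Type*) [AddCommGroup V] [Module K V] [AddCommGroup W] [Module K W] :
    Type _ :=
  ↥(cochainSubmodule K n V W)

instance (n : ℕ) (V W : Type*) [AddCommGroup V] [Module K V] [AddCommGroup W] [Module K W] :
    AddCommGroup (Cochain K n V W) :=
  inferInstanceAs (AddCommGroup ↥(cochainSubmodule K n V W))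

instance (n : ℕ) (V W : Type*) [AddCommGroup V] [Module K V] [AddCommGroup W] [Module K W] :
    Module K (Cochain K n V W) :=
  inferInstanceAs (Module K ↥(cochainSubmodule K n V W))

/-- The graded vector space `C^*(V, W) = ⨁_{n ≥ 0} Cⁿ(V, W)`. -/
abbrev CochainSum (V W : Type*) [AddCommGroup V] [Module K V] [AddCommGroup W] [Module K W] :
    Type _ :=
  DirectSum ℕ (fun n => Cochain K n V W)

/-- The `ℤ`-grading of `C^*(V, W)`: degree `k` is `Cᵏ(V, W)` for `k ≥ 0` and `0` for `k < 0`. -/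
def grading (V W : Type*) [AddCommGroup V] [Module K V] [AddCommGroup W] [Module K W] (k : ℤ) :
    Submodule K (CochainSum K V W) where
  carrier := {f | ∀ n : ℕ, (n : ℤ) ≠ k → f n = 0}
  add_mem' := by
    intro f f' hf hf' n hn
    simp [hf n hn, hf' n hn]
  zero_mem' := by
    intro n _
    simp
  smul_mem' := by
    intro c f hf n hn
    simp [DirectSum.smul_apply, hf n hn]

end Cochains

section Circle

variable {K V : Type*} [Field K] [AddCommGroup V] [Module K V]

/-- The extension of an endomorphism `φ` of `V` to `∧²V` as a derivation:
`x ∧ y ↦ φ(x) ∧ y + x ∧ φ(y)`. -/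
noncomputable def wedgeDerivation : Module.End K V →ₗ[K] Module.End K (⋀[K]^2 V) :=
  (exteriorPower.alternatingMapLinearEquiv (R := K) (n := 2)).toLinearMap ∘ₗ
    { toFun := fun φ =>
        { toFun := fun v =>
            exteriorPower.ιMulti K 2 ![φ (v 0), v 1] + exteriorPower.ιMulti K 2 ![v 0, φ (v 1)]
          map_update_add' := by
            intro inst m i x y
            obtain rfl : inst = instDecidableEqFin 2 := Subsingleton.elim _ _
            fin_cases i <;>
              simp [-exteriorPower.ιMulti_apply_coe, Function.update, alt₂_add_left,
                alt₂_add_right] <;> abel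
          map_update_smul' := by
            intro inst m i c x
            obtain rfl : inst = instDecidableEqFin 2 := Subsingleton.elim _ _
            fin_cases i <;>
              simp [-exteriorPower.ιMulti_apply_coe, Function.update, alt₂_smul_left,
                alt₂_smul_right]
          map_eq_zero_of_eq' := by
            intro v i j hij hne
            have h01 : v 0 = v 1 := by
              fin_cases i <;> fin_cases j <;> simp_all
            rw [h01, alt₂_swap]
            exact neg_add_cancel _ }
      map_add' := by
        intro φ ψ
        ext v
        simp [-exteriorPower.ιMulti_apply_coe, alt₂_add_left, alt₂_add_right]
        abel
      map_smul' := by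
        intro c φ
        ext v
        simp [-exteriorPower.ιMulti_apply_coe, alt₂_smul_left, alt₂_smul_right] }

theorem wedgeDerivation_apply (φ : Module.End K V) (x y : V) :
    wedgeDerivation φ (exteriorPower.ιMulti K 2 ![x, y]) =
      exteriorPower.ιMulti K 2 ![φ x, y] + exteriorPower.ιMulti K 2 ![x, φ y] := by
  simp [wedgeDerivation, -exteriorPower.ιMulti_apply_coe]

/-- How the `p + q` arguments `𝔛` are distributed by `σ ∈ S(k, q)`, `k ≤ p` (all positions
counted from `0`): the `j`-th argument of `Q` is `𝔛_{σ(k+j)}`; the `i`-th position of `P` receives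
`𝔛_{σ(i)}` if `i < k` and `𝔛_{i+q}` if `i ≥ k`. -/
def slot {p q k : ℕ} (hk : k ≤ p) (σ : Equiv.Perm (Fin (k + q))) :
    Fin q ⊕ Fin p → Fin (p + q)
  | Sum.inl j => ⟨σ ⟨k + j, by omega⟩, by omega⟩
  | Sum.inr i => if h : (i : ℕ) < k then ⟨σ ⟨i, by omega⟩, by omega⟩ else ⟨i + q, by omega⟩

theorem slot_injective {p q k : ℕ} (hk : k ≤ p) (σ : Equiv.Perm (Fin (k + q))) :
    Function.Injective (slot hk σ) := by
  have key : ∀ (a b : ℕ) (ha : a < k + q) (hb : b < k + q),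
      (σ ⟨a, ha⟩ : ℕ) = σ ⟨b, hb⟩ → a = b := by
    intro a b ha hb hab
    have := σ.injective (Fin.ext hab)
    simpa using this
  rintro (i | i) (j | j) hij
  · simp only [slot] at hij
    have h1 := congrArg Fin.val hij
    have := key _ _ _ _ h1
    congr 1
    ext
    omega
  · exfalso
    simp only [slot] at hij
    split_ifs at hij with hj
    · have h1 := congrArg Fin.val hij
      have := key _ _ _ _ h1
      omega
    · have h1 := congrArg Fin.val hij
      simp only at h1
      have h2 := (σ ⟨k + i, by omega⟩).isLt
      omega
  · exfalso
    simp only [slot] at hij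
    split_ifs at hij with hi
    · have h1 := congrArg Fin.val hij
      have := key _ _ _ _ h1
      omega
    · have h1 := congrArg Fin.val hij
      simp only at h1
      have h2 := (σ ⟨k + j, by omega⟩).isLt
      omega
  · simp only [slot] at hij
    congr 1
    ext
    split_ifs at hij with hi hj hj
    · have h1 := congrArg Fin.val hij
      exact key _ _ _ _ h1
    · have h1 := congrArg Fin.val hij
      simp only at h1
      have h2 := (σ ⟨i, by omega⟩).isLt
      omega
    · have h1 := congrArg Fin.val hij
      simp only at h1
      have h2 := (σ ⟨j, by omega⟩).isLt
      omega
    · have h1 := congrArg Fin.val hij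
      simp only at h1
      omega

theorem slot_bijective {p q k : ℕ} (hk : k ≤ p) (σ : Equiv.Perm (Fin (k + q))) :
    Function.Bijective (slot hk σ) := by
  rw [Fintype.bijective_iff_injective_and_card]
  exact ⟨slot_injective hk σ, by simp [add_comm]⟩

/-- `slot` as a bijection. -/
noncomputable def slotEquiv {p q k : ℕ} (hk : k ≤ p) (σ : Equiv.Perm (Fin (k + q))) :
    Fin q ⊕ Fin p ≃ Fin (p + q) :=
  Equiv.ofBijective (slot hk σ) (slot_bijective hk σ)

/-- Insertion of `Q` into the `k`-th wedge factor of `P`: for `B` a family of `p` elements and `A`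
a family of `q` elements of `∧²V`, with `B_k = x ∧ y`, this is
`P(B₁, …, Q(A, x) ∧ y + x ∧ Q(A, y), …, B_p, ·)`. -/
noncomputable def insertWedge {p q : ℕ} (P : PreCochain K p V V) (Q : PreCochain K q V V)
    (k : Fin p) :
    MultilinearMap K (fun _ : Fin q ⊕ Fin p => ⋀[K]^2 V) (V →ₗ[K] V) where
  toFun Y := P (Function.update (fun i => Y (Sum.inr i)) k
    (wedgeDerivation (Q fun j => Y (Sum.inl j)) (Y (Sum.inr k))))
  map_update_add' := by
    intro inst Y s a b
    obtain rfl : inst = instDecidableEqSum := Subsingleton.elim _ _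
    rcases s with j | i
    · simp
    · by_cases hik : k = i
      · subst hik
        simp
      · simp [hik, Function.update_comm (Ne.symm hik)]
  map_update_smul' := by
    intro inst Y s c a
    obtain rfl : inst = instDecidableEqSum := Subsingleton.elim _ _
    rcases s with j | i
    · simp
    · by_cases hik : k = i
      · subst hik
        simp
      · simp [hik, Function.update_comm (Ne.symm hik)]

/-- Insertion of `Q` into the last argument of `P`: `P(B, Q(A, ·))`. -/
def insertLast {p q : ℕ} (P : PreCochain K p V V) (Q : PreCochain K q V V) :
    MultilinearMap K (fun _ : Fin q ⊕ Fin p => ⋀[K]^2 V) (V →ₗ[K] V) where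
  toFun Y := (P fun i => Y (Sum.inr i)) ∘ₗ (Q fun j => Y (Sum.inl j))
  map_update_add' := by
    intro inst Y s a b
    obtain rfl : inst = instDecidableEqSum := Subsingleton.elim _ _
    rcases s with j | i
    · simp [LinearMap.comp_add]
    · simp [LinearMap.add_comp]
  map_update_smul' := by
    intro inst Y s c a
    obtain rfl : inst = instDecidableEqSum := Subsingleton.elim _ _
    rcases s with j | i
    · simp [LinearMap.comp_smul]
    · simp [LinearMap.smul_comp]

/-- The circle product `P ∘ Q`. With `k` counted from `0`, it is
`∑_{k < p} (-1)^{kq} ∑_{σ ∈ S(k,q)} (-1)^σ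
  P(𝔛_{σ(0)}, …, 𝔛_{σ(k-1)}, Q(𝔛_{σ(k)}, …, 𝔛_{σ(k+q-1)}, ·) ⋆ 𝔛_{k+q}, 𝔛_{k+q+1}, …, x)
  + (-1)^{pq} ∑_{σ ∈ S(p,q)} (-1)^σ
  P(𝔛_{σ(0)}, …, 𝔛_{σ(p-1)}, Q(𝔛_{σ(p)}, …, 𝔛_{σ(p+q-1)}, x))`,
where `φ ⋆ (x ∧ y) = φ(x) ∧ y + x ∧ φ(y)`. -/
noncomputable def preCircle {p q : ℕ} (P : PreCochain K p V V) (Q : PreCochain K q V V) :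
    PreCochain K (p + q) V V :=
  (∑ k : Fin p, (-1 : ℤ) ^ ((k : ℕ) * q) • ∑ σ ∈ unshuffles ((k : ℕ) + q) k,
      Equiv.Perm.sign σ • (insertWedge P Q k).domDomCongr (slotEquiv k.isLt.le σ))
    + (-1 : ℤ) ^ (p * q) • ∑ σ ∈ unshuffles (p + q) p,
      Equiv.Perm.sign σ • (insertLast P Q).domDomCongr (slotEquiv le_rfl σ)

end Circle

section Closure

variable {K V : Type*} [Field K] [AddCommGroup V] [Module K V]

theorem preCircle_apply {p q : ℕ} (P : PreCochain K p V V) (Q : PreCochain K q V V)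
    (X : Fin (p + q) → ⋀[K]^2 V) (x : V) :
    preCircle P Q X x =
      (∑ k : Fin p, (-1 : ℤ) ^ ((k : ℕ) * q) • ∑ σ ∈ unshuffles ((k : ℕ) + q) k,
        Equiv.Perm.sign σ • P (Function.update
          (fun i => X (slotEquiv k.isLt.le σ (Sum.inr i))) k
          (wedgeDerivation (Q fun j => X (slotEquiv k.isLt.le σ (Sum.inl j)))
            (X (slotEquiv k.isLt.le σ (Sum.inr k))))) x)
      + (-1 : ℤ) ^ (p * q) • ∑ σ ∈ unshuffles (p + q) p, Equiv.Perm.sign σ •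
        (P fun i => X (slotEquiv le_rfl σ (Sum.inr i)))
          ((Q fun j => X (slotEquiv le_rfl σ (Sum.inl j))) x) := by
  simp only [preCircle, add_apply, sum_apply, smul_apply,
    LinearMap.add_apply, LinearMap.sum_apply, LinearMap.smul_apply]
  rfl

theorem slotEquiv_inl {p q k : ℕ} (hk : k ≤ p) (σ : Equiv.Perm (Fin (k + q))) (j : Fin q) :
    slotEquiv hk σ (Sum.inl j) = ⟨σ ⟨k + j, by omega⟩, by omega⟩ := rfl

theorem slotEquiv_inr_lt {p q k : ℕ} (hk : k ≤ p) (σ : Equiv.Perm (Fin (k + q))) (i : Fin p)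
    (hi : (i : ℕ) < k) : slotEquiv hk σ (Sum.inr i) = ⟨σ ⟨i, by omega⟩, by omega⟩ :=
  dif_pos hi

theorem slotEquiv_inr_ge {p q k : ℕ} (hk : k ≤ p) (σ : Equiv.Perm (Fin (k + q))) (i : Fin p)
    (hi : ¬ (i : ℕ) < k) : slotEquiv hk σ (Sum.inr i) = ⟨i + q, by omega⟩ :=
  dif_neg hi

theorem cochain_swap {n : ℕ} {f : PreCochain K n V V} (hf : f ∈ cochainSubmodule K n V V) (i : Fin n)
    (hi : (i : ℕ) + 1 = n) (X : Fin n → ⋀[K]^2 V) (x y z : V) :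
    f (Function.update X i (exteriorPower.ιMulti K 2 ![x, y])) z =
      -f (Function.update X i (exteriorPower.ιMulti K 2 ![x, z])) y := by
  have h := hf i hi X x (y + z)
  have h1 := hf i hi X x y
  have h2 := hf i hi X x z
  rw [alt₂_add_right, MultilinearMap.map_update_add, LinearMap.add_apply, map_add, map_add, h1,
    h2, zero_add, add_zero] at h
  exact eq_neg_of_add_eq_zero_left h

theorem preCircle_mem {p q : ℕ} {P : PreCochain K p V V} {Q : PreCochain K q V V}
    (hP : P ∈ cochainSubmodule K p V V) (hQ : Q ∈ cochainSubmodule K q V V) :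
    preCircle P Q ∈ cochainSubmodule K (p + q) V V := by
  intro N hN X x y
  set X' := Function.update X N (exteriorPower.ιMulti K 2 ![x, y]) with hX'
  have hX'N : X' N = exteriorPower.ιMulti K 2 ![x, y] := by simp [hX']
  -- a family whose value at the last index is `x ∧ y`
  have hP0 : ∀ (i : Fin p), (i : ℕ) + 1 = p → ∀ Y : Fin p → ⋀[K]^2 V,
      Y i = exteriorPower.ιMulti K 2 ![x, y] → P Y y = 0 := by
    intro i hi Y hY
    have := hP i hi Y x y
    rwa [← hY, Function.update_eq_self] at this
  have hQ0 : ∀ (i : Fin q), (i : ℕ) + 1 = q → ∀ Y : Fin q → ⋀[K]^2 V,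
      Y i = exteriorPower.ιMulti K 2 ![x, y] → Q Y y = 0 := by
    intro i hi Y hY
    have := hQ i hi Y x y
    rwa [← hY, Function.update_eq_self] at this
  -- a term of the last sum vanishes unless the last index sits at position `p - 1`
  have last0 : ∀ σ ∈ unshuffles (p + q) p,
      (∀ i : Fin (p + q), (i : ℕ) + 1 = p → σ i ≠ N) →
      (P fun i => X' (slotEquiv le_rfl σ (Sum.inr i)))
        ((Q fun j => X' (slotEquiv le_rfl σ (Sum.inl j))) y) = 0 := by
    intro σ hσ hne
    have hσ' : IsUnshuffle p σ := by simpa [unshuffles] using hσ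
    obtain ⟨r, hr⟩ := σ.surjective N
    have hmax : ∀ s, ¬ σ r < σ s := by
      intro s hs
      rw [hr, Fin.lt_def] at hs
      have := (σ s).isLt
      omega
    have hrq : p ≤ (r : ℕ) := by
      by_contra hc
      by_cases hr1 : (r : ℕ) + 1 = p
      · exact hne r hr1 hr
      · exact hmax ⟨p - 1, by omega⟩
          (hσ'.1 r ⟨p - 1, by omega⟩ (by rw [Fin.lt_def]; simp; omega) (by simp; omega))
    have hrl : (r : ℕ) + 1 = p + q := by
      by_contra hc
      exact hmax ⟨r + 1, by omega⟩
        (hσ'.2 r ⟨r + 1, by omega⟩ (by rw [Fin.lt_def]; simp) hrq)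
    rw [hQ0 ⟨r - p, by omega⟩ (by simp; omega), map_zero]
    rw [slotEquiv_inl]
    have : (⟨p + (r - p : ℕ), by omega⟩ : Fin (p + q)) = r := Fin.ext (by simp; omega)
    simp only [this, hr]
    exact hX'N
  rw [preCircle_apply]
  rcases p with _ | p
  · rw [Fin.sum_univ_zero, zero_add, Finset.sum_eq_zero, smul_zero]
    intro σ hσ
    rw [last0 σ hσ (fun i hi => by omega), smul_zero]
  · rw [Fin.sum_univ_castSucc, Finset.sum_eq_zero, zero_add]
    · have key := sum_unshuffles_top (M := V) (N := p + 1 + q) (n := p + q) (a := p) (by omega)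
        (by omega)
        (fun σ => Equiv.Perm.sign σ • (P fun i => X' (slotEquiv le_rfl σ (Sum.inr i)))
          ((Q fun j => X' (slotEquiv le_rfl σ (Sum.inl j))) y))
        (fun τ => (-1 : ℤ) ^ (q + 1) • Equiv.Perm.sign τ • P (Function.update
          (fun i => X' (slotEquiv (Fin.last p).isLt.le τ (Sum.inr i))) (Fin.last p)
          (wedgeDerivation (Q fun j => X' (slotEquiv (Fin.last p).isLt.le τ (Sum.inl j)))
            (X' (slotEquiv (Fin.last p).isLt.le τ (Sum.inr (Fin.last p)))))) y) ?_ ?_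
      · rw [key, ← Finset.smul_sum, smul_smul, ← pow_add]
        have hs : (-1 : ℤ) ^ ((p + 1) * q + (q + 1)) = -(-1 : ℤ) ^ (p * q) := by
          rw [show (p + 1) * q + (q + 1) = p * q + 1 + 2 * q by ring, pow_add, pow_mul, pow_succ]
          simp
        rw [hs, neg_smul]
        exact add_neg_cancel _
      · intro σ hσ hne
        rw [last0 σ hσ, smul_zero]
        intro i hi hiN
        apply hne
        have : (⟨p, by omega⟩ : Fin (p + 1 + q)) = i := Fin.ext (by simp; omega)
        rw [this, hiN]
        omega
      · intro σ τ htop hlo hup hsign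
        have eQ : (fun j => X' (slotEquiv (Fin.last p).isLt.le τ (Sum.inl j))) =
            fun j => X' (slotEquiv le_rfl σ (Sum.inl j)) := by
          funext j
          congr 1
          rw [slotEquiv_inl, slotEquiv_inl, Fin.mk.injEq]
          have := hup (p + j) (by omega) (by omega)
          simp only [Fin.val_last]
          rw [← this]
          congr 3
          omega
        have eN1 : X' (slotEquiv (Fin.last p).isLt.le τ (Sum.inr (Fin.last p))) =
            exteriorPower.ιMulti K 2 ![x, y] := by
          rw [← hX'N]
          congr 1
          rw [slotEquiv_inr_ge _ _ _ (by simp)]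
          ext
          simp
          omega
        have eN2 : X' (slotEquiv le_rfl σ (Sum.inr (Fin.last p))) =
            exteriorPower.ιMulti K 2 ![x, y] := by
          rw [← hX'N]
          congr 1
          rw [slotEquiv_inr_lt _ _ _ (by simp)]
          ext
          simp only [Fin.val_last]
          omega
        have eP : ∀ w, Function.update (fun i => X' (slotEquiv (Fin.last p).isLt.le τ (Sum.inr i)))
              (Fin.last p) w =
            Function.update (fun i => X' (slotEquiv le_rfl σ (Sum.inr i))) (Fin.last p) w := by
          intro w
          funext i
          by_cases hi : i = Fin.last p
          · subst hi
            simp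
          · have hi' : (i : ℕ) < p := by
              have := i.isLt
              have h2 : (i : ℕ) ≠ p := fun h => hi (Fin.ext h)
              omega
            rw [Function.update_of_ne hi, Function.update_of_ne hi]
            congr 1
            rw [slotEquiv_inr_lt _ _ _ (by simpa using hi'), slotEquiv_inr_lt _ _ _ (by omega),
              Fin.mk.injEq]
            exact (hlo i (by omega) hi').symm
        rw [eQ, eN1, eP, wedgeDerivation_apply, MultilinearMap.map_update_add,
          LinearMap.add_apply, hP _ (by simp), zero_add, cochain_swap hP _ (by simp), ← eN2,
          Function.update_eq_self, hsign, smul_neg, smul_neg, pow_succ]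
        have hpq : p + q - p = q := by omega
        rw [hpq, mul_smul, Units.smul_def ((-1 : ℤˣ) ^ q)]
        simp
    · intro k _
      rw [Finset.sum_eq_zero, smul_zero]
      intro σ _
      rw [hP0 (Fin.last p) (by simp), smul_zero]
      rw [Function.update_of_ne (by simp [Fin.ext_iff]; omega), ← hX'N]
      congr 1
      rw [slotEquiv_inr_ge _ _ _ (by simp)]
      ext
      simp
      omega

end Closure

section Bracket

variable {K : Type*} (V : Type*) [Field K] [AddCommGroup V] [Module K V]

/-- The circle product as a bilinear map `Cᵖ(V, V) × C^q(V, V) → C^{p+q}(V, V)`. -/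
noncomputable def circle (p q : ℕ) :
    Cochain K p V V →ₗ[K] Cochain K q V V →ₗ[K] Cochain K (p + q) V V :=
  LinearMap.mk₂ K (fun P Q => ⟨preCircle P.1 Q.1, preCircle_mem P.2 Q.2⟩)
    (by
      intro P P' Q
      refine Subtype.ext (MultilinearMap.ext fun X => LinearMap.ext fun x => ?_)
      change preCircle (P.1 + P'.1) Q.1 X x = preCircle P.1 Q.1 X x + preCircle P'.1 Q.1 X x
      simp only [add_apply, LinearMap.add_apply, preCircle_apply, smul_add,
        Finset.sum_add_distrib]
      abel)
    (by
      intro c P Q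
      refine Subtype.ext (MultilinearMap.ext fun X => LinearMap.ext fun x => ?_)
      change preCircle (c • P.1) Q.1 X x = c • preCircle P.1 Q.1 X x
      simp only [smul_apply, LinearMap.smul_apply, preCircle_apply, smul_add,
        Finset.smul_sum, smul_comm c])
    (by
      intro P Q Q'
      refine Subtype.ext (MultilinearMap.ext fun X => LinearMap.ext fun x => ?_)
      change preCircle P.1 (Q.1 + Q'.1) X x = preCircle P.1 Q.1 X x + preCircle P.1 Q'.1 X x
      simp only [add_apply, LinearMap.add_apply, preCircle_apply, smul_add,
        map_add, MultilinearMap.map_update_add, Finset.sum_add_distrib]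
      abel)
    (by
      intro c P Q
      refine Subtype.ext (MultilinearMap.ext fun X => LinearMap.ext fun x => ?_)
      change preCircle P.1 (c • Q.1) X x = c • preCircle P.1 Q.1 X x
      simp only [smul_apply, LinearMap.smul_apply, preCircle_apply, smul_add,
        map_smul, MultilinearMap.map_update_smul, Finset.smul_sum, smul_comm c])

/-- The graded commutator bracket on `C^*(V, V)`, the bilinear map with
`[P, Q] = P ∘ Q - (-1)^{pq} Q ∘ P` for `P ∈ Cᵖ(V, V)` and `Q ∈ C^q(V, V)`. -/
noncomputable def bracket :
    CochainSum K V V →ₗ[K] CochainSum K V V →ₗ[K] CochainSum K V V :=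
  DirectSum.toModule K ℕ _ fun p => LinearMap.flip <| DirectSum.toModule K ℕ _ fun q =>
    LinearMap.flip <|
      (circle V p q).compr₂ (DirectSum.lof K ℕ (fun n => Cochain K n V V) (p + q))
        - (-1 : ℤ) ^ (p * q) •
          ((circle V q p).compr₂ (DirectSum.lof K ℕ (fun n => Cochain K n V V) (q + p))).flip

theorem bracket_lof (p q : ℕ) (P : Cochain K p V V) (Q : Cochain K q V V) :
    bracket V (DirectSum.lof K ℕ (fun n => Cochain K n V V) p P)
        (DirectSum.lof K ℕ (fun n => Cochain K n V V) q Q) =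
      DirectSum.lof K ℕ (fun n => Cochain K n V V) (p + q) (circle V p q P Q)
        - (-1 : ℤ) ^ (p * q) •
          DirectSum.lof K ℕ (fun n => Cochain K n V V) (q + p) (circle V q p Q P) := by
  simp only [bracket, DirectSum.toModule_lof, LinearMap.flip_apply, LinearMap.sub_apply,
    LinearMap.compr₂_apply, LinearMap.smul_apply]

end Bracket

section Trilinear

variable {K V W : Type*} [Field K] [AddCommGroup V] [Module K V] [AddCommGroup W] [Module K W]

/-- The linear map `∧²V → Hom(V, W)`, `x ∧ y ↦ (z ↦ f(x, y, z))`, of an alternating trilinear map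
(written with `f(z, x, y) = f(x, y, z)`). -/
noncomputable def wedgeCurry (f : V [⋀^Fin 3]→ₗ[K] W) : ⋀[K]^2 V →ₗ[K] V →ₗ[K] W :=
  ((exteriorPower.alternatingMapLinearEquiv (R := K) (n := 2)).toLinearMap ∘ₗ
    AlternatingMap.curryLeft f).flip

theorem wedgeCurry_apply (f : V [⋀^Fin 3]→ₗ[K] W) (x y z : V) :
    wedgeCurry f (exteriorPower.ιMulti K 2 ![x, y]) z = f ![x, y, z] := by
  have h1 : wedgeCurry f (exteriorPower.ιMulti K 2 ![x, y]) z = f ![z, x, y] := by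
    simp [wedgeCurry, -exteriorPower.ιMulti_apply_coe]
  rw [h1]
  have h2 := f.map_perm ![x, y, z] (finRotate 3).symm
  have h3 : Equiv.Perm.sign (finRotate 3).symm = 1 := by decide
  rw [h3, one_smul] at h2
  rw [← h2]
  congr 1
  ext i
  fin_cases i <;> rfl

/-- An alternating trilinear map `∧³V → W` as an element of `C¹(V, W)`. -/
noncomputable def ofAlternating (f : V [⋀^Fin 3]→ₗ[K] W) : Cochain K 1 V W :=
  ⟨MultilinearMap.ofSubsingleton K (⋀[K]^2 V) (V →ₗ[K] W) (0 : Fin 1) (wedgeCurry f), by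
    intro i _ X x y
    obtain rfl : i = 0 := Subsingleton.elim _ _
    rw [MultilinearMap.ofSubsingleton_apply_apply, Function.update_self, wedgeCurry_apply]
    exact f.map_eq_zero_of_eq _ (i := 1) (j := 2) (by simp) (by decide)⟩

end Trilinear

section Functoriality

variable {K V W V' W' : Type*} [Field K] [AddCommGroup V] [Module K V] [AddCommGroup W]
  [Module K W] [AddCommGroup V'] [Module K V'] [AddCommGroup W'] [Module K W']

/-- The map `Cⁿ(V, W) → Cⁿ(V', W')` induced by `α : V' → V` and `β : W → W'`:
`f ↦ ((𝔛₁, …, 𝔛ₙ, x) ↦ β(f(∧²α(𝔛₁), …, ∧²α(𝔛ₙ), α(x))))`. -/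
noncomputable def Cochain.map (α : V' →ₗ[K] V) (β : W →ₗ[K] W') (n : ℕ) :
    Cochain K n V W →ₗ[K] Cochain K n V' W' where
  toFun f :=
    ⟨((LinearMap.lcomp K W' α) ∘ₗ (LinearMap.llcomp K V W W' β)).compMultilinearMap
      (f.1.compLinearMap fun _ => exteriorPower.map 2 α), by
      intro i hi X x y
      have e : (fun j => exteriorPower.map 2 α
            (Function.update X i (exteriorPower.ιMulti K 2 ![x, y]) j)) =
          Function.update (fun j => exteriorPower.map 2 α (X j)) i
            (exteriorPower.ιMulti K 2 ![α x, α y]) := by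
        funext j
        by_cases hj : j = i
        · subst hj
          rw [Function.update_self, Function.update_self, exteriorPower.map_apply_ιMulti]
          congr 1
          ext t
          fin_cases t <;> rfl
        · rw [Function.update_of_ne hj, Function.update_of_ne hj]
      change β (f.1 (fun j => exteriorPower.map 2 α
            (Function.update X i (exteriorPower.ιMulti K 2 ![x, y]) j)) (α y)) = 0
      rw [e, f.2 i hi, map_zero]⟩
  map_add' f f' := by
    refine Subtype.ext (MultilinearMap.ext fun X => LinearMap.ext fun x => ?_)
    exact map_add β _ _
  map_smul' c f := by
    refine Subtype.ext (MultilinearMap.ext fun X => LinearMap.ext fun x => ?_)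
    exact map_smul β _ _

theorem Cochain.map_apply (α : V' →ₗ[K] V) (β : W →ₗ[K] W') (n : ℕ) (f : Cochain K n V W)
    (X : Fin n → ⋀[K]^2 V') (x : V') :
    (Cochain.map α β n f).1 X x = β (f.1 (fun i => exteriorPower.map 2 α (X i)) (α x)) := rfl

variable (K g h : Type*) [Field K] [AddCommGroup g] [Module K g] [AddCommGroup h] [Module K h]

/-- The inclusion `C^*(g, h) → C^*(g ⊕ h, g ⊕ h)`: an element of `Cⁿ(g, h)` is extended by `0` to
arguments in `h` and regarded as having values in `g ⊕ h`. -/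
noncomputable def embed : CochainSum K g h →ₗ[K] CochainSum K (g × h) (g × h) :=
  DirectSum.lmap (Cochain.map (LinearMap.fst K g h) (LinearMap.inr K g h))

/-- The map `C^*(g ⊕ h, g ⊕ h) → C^*(g, h)` that restricts the arguments to `g` and takes the
`h`-component of the value. -/
noncomputable def restrict : CochainSum K (g × h) (g × h) →ₗ[K] CochainSum K g h :=
  DirectSum.lmap (Cochain.map (LinearMap.inl K g h) (LinearMap.snd K g h))

theorem restrict_embed (P : CochainSum K g h) : restrict K g h (embed K g h P) = P := by
  refine DFinsupp.ext fun n => ?_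
  refine Subtype.ext (MultilinearMap.ext fun X => LinearMap.ext fun x => ?_)
  have e : ∀ w : ⋀[K]^2 g,
      exteriorPower.map 2 (LinearMap.fst K g h)
        (exteriorPower.map 2 (LinearMap.inl K g h) w) = w := by
    intro w
    rw [← LinearMap.comp_apply, ← exteriorPower.map_comp, LinearMap.fst_comp_inl,
      exteriorPower.map_id, LinearMap.id_apply]
  change (P n).1 (fun i => exteriorPower.map 2 (LinearMap.fst K g h)
    (exteriorPower.map 2 (LinearMap.inl K g h) (X i))) x = (P n).1 X x
  simp only [e]

/-- The projection of `C^*(g ⊕ h, g ⊕ h)` onto the subspace `C^*(g, h)`. -/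
noncomputable def projection : CochainSum K (g × h) (g × h) →ₗ[K] CochainSum K (g × h) (g × h) :=
  embed K g h ∘ₗ restrict K g h

end Functoriality

section Graded

variable {K A : Type*} [Field K] [AddCommGroup A] [Module K A]

/-- `(A, br)` with `A = ⨁_{k ∈ ℤ} 𝒜 k` is a graded Lie algebra. -/
structure IsGradedLieAlgebra (𝒜 : ℤ → Submodule K A) (br : A →ₗ[K] A →ₗ[K] A) : Prop where
  internal : DirectSum.IsInternal 𝒜
  degree : ∀ (p q : ℤ) (a b : A), a ∈ 𝒜 p → b ∈ 𝒜 q → br a b ∈ 𝒜 (p + q)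
  skew : ∀ (p q : ℤ) (a b : A), a ∈ 𝒜 p → b ∈ 𝒜 q → br a b = -((p * q).negOnePow • br b a)
  jacobi : ∀ (p q r : ℤ) (a b c : A), a ∈ 𝒜 p → b ∈ 𝒜 q → c ∈ 𝒜 r →
    br a (br b c) = br (br a b) c + (p * q).negOnePow • br b (br a c)

/-- `S` is a graded Lie subalgebra: it is spanned by its homogeneous elements and closed under the
bracket. -/
structure IsGradedLieSubalgebra (𝒜 : ℤ → Submodule K A) (br : A →ₗ[K] A →ₗ[K] A)
    (S : Submodule K A) : Prop where
  graded : S = ⨆ k : ℤ, S ⊓ 𝒜 k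
  closed : ∀ a ∈ S, ∀ b ∈ S, br a b ∈ S

/-- `(A, F, proj, Δ)` is a V-data: `A` is a graded Lie algebra, `F` an abelian graded Lie
subalgebra, `proj` a projection with image `F` whose kernel is a graded Lie subalgebra, and `Δ` an
element of degree `1` of the kernel with `[Δ, Δ] = 0`. -/
structure IsVData (𝒜 : ℤ → Submodule K A) (br : A →ₗ[K] A →ₗ[K] A) (F : Submodule K A)
    (proj : A →ₗ[K] A) (Δ : A) : Prop where
  lie : IsGradedLieAlgebra 𝒜 br
  subalgebra : IsGradedLieSubalgebra 𝒜 br F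
  abelian : ∀ a ∈ F, ∀ b ∈ F, br a b = 0
  idempotent : proj ∘ₗ proj = proj
  range_eq : LinearMap.range proj = F
  ker_subalgebra : IsGradedLieSubalgebra 𝒜 br (LinearMap.ker proj)
  mem_ker : Δ ∈ LinearMap.ker proj
  mem_degree_one : Δ ∈ 𝒜 1
  square_zero : br Δ Δ = 0

/-- The iterated bracket `[⋯[[Δ, a₁], a₂], ⋯, a_k]` as a multilinear map. -/
noncomputable def iteratedBracket (br : A →ₗ[K] A →ₗ[K] A) (Δ : A) :
    (k : ℕ) → MultilinearMap K (fun _ : Fin k => A) A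
  | 0 => MultilinearMap.constOfIsEmpty K _ Δ
  | k + 1 => (br.compMultilinearMap (iteratedBracket br Δ k)).uncurryRight

theorem iteratedBracket_succ (br : A →ₗ[K] A →ₗ[K] A) (Δ : A) (k : ℕ) (a : Fin (k + 1) → A) :
    iteratedBracket br Δ (k + 1) a =
      br (iteratedBracket br Δ k (fun i => a i.castSucc)) (a (Fin.last k)) := rfl

/-- The Koszul sign `ε(σ) = ε(σ; x₁, …, xₙ)` for homogeneous elements of degrees `d₁, …, dₙ`,
defined by `x_{σ(1)} ⊙ ⋯ ⊙ x_{σ(n)} = ε(σ) x₁ ⊙ ⋯ ⊙ xₙ`: every inversion `i < j`,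
`σ(j) < σ(i)` contributes `(-1)^{d_{σ(i)} d_{σ(j)}}`. -/
def koszulSign {n : ℕ} (d : Fin n → ℤ) (σ : Equiv.Perm (Fin n)) : ℤˣ :=
  ∏ i : Fin n, ∏ j : Fin n, if i < j ∧ σ j < σ i then (d (σ i) * d (σ j)).negOnePow else 1

/-- `(A, {l_k}_{k ≥ 1})` with `A = ⨁_{k ∈ ℤ} 𝒜 k` is an `L_∞`-algebra, with all `l_k` graded
symmetric of degree `1`. (The map `l 0` plays no role.) In `jacobi`, the inner bracket has `i + 1`
arguments and the outer one has `n - i`. -/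
structure IsLInftyAlgebra (𝒜 : ℤ → Submodule K A)
    (l : (k : ℕ) → MultilinearMap K (fun _ : Fin k => A) A) : Prop where
  internal : DirectSum.IsInternal 𝒜
  degree : ∀ n : ℕ, 1 ≤ n → ∀ (d : Fin n → ℤ) (x : Fin n → A), (∀ i, x i ∈ 𝒜 (d i)) →
    l n x ∈ 𝒜 ((∑ i, d i) + 1)
  symm : ∀ n : ℕ, 1 ≤ n → ∀ (d : Fin n → ℤ) (x : Fin n → A), (∀ i, x i ∈ 𝒜 (d i)) →
    ∀ σ : Equiv.Perm (Fin n), l n (fun i => x (σ i)) = koszulSign d σ • l n x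
  jacobi : ∀ n : ℕ, 1 ≤ n → ∀ (d : Fin n → ℤ) (x : Fin n → A), (∀ i, x i ∈ 𝒜 (d i)) →
    ∑ i : Fin n, ∑ σ ∈ unshuffles n (i + 1), koszulSign d σ •
      l (n - i) (fun r : Fin (n - i) =>
        if (r : ℕ) = 0 then l (i + 1) (fun s : Fin (i + 1) => x (σ ⟨s, by omega⟩))
        else x (σ ⟨i + r, by omega⟩)) = 0

end Graded

section CrossedHomomorphisms

variable {K g h : Type*} [Field K] [AddCommGroup g] [Module K g] [AddCommGroup h] [Module K h]

/-- `Δ = π + ρ + μ` as an element of degree `1` of `C^*(g ⊕ h, g ⊕ h)`. -/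
noncomputable def delta (π : g [⋀^Fin 3]→ₗ[K] g) (ρ : g [⋀^Fin 2]→ₗ[K] Module.End K h)
    (μ : h [⋀^Fin 3]→ₗ[K] h) : CochainSum K (g × h) (g × h) :=
  DirectSum.lof K ℕ (fun n => Cochain K n (g × h) (g × h)) 1 (ofAlternating (semidirect π ρ μ))

/-- The higher derived brackets `l_k(a₁, …, a_k) = 𝒫[⋯[[Δ, a₁], a₂], ⋯, a_k]` on `C^*(g, h)`, the
element `𝒫(⋯)` of the subspace `C^*(g, h)` being read off through `restrict`. -/
noncomputable def derivedBracket (π : g [⋀^Fin 3]→ₗ[K] g)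
    (ρ : g [⋀^Fin 2]→ₗ[K] Module.End K h) (μ : h [⋀^Fin 3]→ₗ[K] h) (k : ℕ) :
    MultilinearMap K (fun _ : Fin k => CochainSum K g h) (CochainSum K g h) :=
  (restrict K g h).compMultilinearMap
    ((iteratedBracket (bracket (g × h)) (delta π ρ μ) k).compLinearMap fun _ => embed K g h)

end CrossedHomomorphisms

end ThreeLie

/-! There are four ingredients.

The graded Lie algebra. The circle product is a graded right pre-Lie product: the associator (P∘Q)∘R
- P∘(Q∘R) is symmetric in Q and R up to (-1)^{qr}, and the graded commutator of such a product
satisfies the Jacobi identity. Double sums over unshuffles are avoided as follows. Let i_X insert X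
as first argument. Sorting the unshuffles by the place of their smallest letter gives
(`contract_circ`) i_X(P∘Q) = P∘i_X Q + (-1)^q (i_X P)∘Q + i_{Q₀·X} P, where Q₀ is the part of Q of
degree 0, an endomorphism of V acting on ∧²V as a derivation. So i_X of an associator is a sum of
associators of smaller total degree and an explicit remainder; the remainder is symmetric because
End(V) acts on ∧²V by a homomorphism of Lie algebras (`wedgeDerivation_mul`). Induction on the total
degree gives `assoc_symm`. Alternation in the last three vectors plays no role here, so the argument
runs in the larger space `PreSum`.

The V-data. Elements of F have values in h and vanish on arguments in h, so their circle products
are 0. The kernel of 𝒫 consists of the cochains that send arguments in g to values in g, a condition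
stable under composition. Finally Δ∘Δ = 0 is the Fundamental Identity of the semidirect product
bracket.

The L_∞-algebra, by Voronov's argument. As F is abelian and ker 𝒫 is a subalgebra, 𝒫[x, y] = 𝒫[𝒫x,
y] + 𝒫[x, 𝒫y] (`IsVData.proj_bracket`). Bracket [Δ, Δ] = 0 with a₁, …, aₙ, expand by the Leibniz
rule into a sum over the splittings of the arguments, and apply 𝒫. Exchanging the two parts of a
splitting identifies the two resulting sums, so twice the Jacobi sum vanishes
(`IsVData.splitSum_eq_zero`). Splittings are encoded as pairs of lists and matched with unshuffles
in `sum_unshuffles_eq_splitSum`.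

The explicit brackets. Let E be the projection of g ⊕ h onto h, a cochain of degree 0. Then [E, ·]
is a derivation which, on a component with T arguments in h, is multiplication by 1 - T for values
in h and by -T for values in g. Elements of F have weight 1, π + ρ has weight 0 and μ has weight -2,
so the k-fold bracket of Δ has parts of weights k and k - 2. The restriction to arguments in g and
values in h sees weight 1 only, which forces k = 1 or k = 3; and in weights ≥ 1 there is nothing
outside F, so 𝒫 is not needed in l₃. -/

namespace ThreeLie

/-! ### Unshuffles sorted by the place of the smallest letter -/

section UnshufflesBottom

/-- The permutation of `n + 1` letters that puts the smallest letter at position `a` and is given by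
`τ` on the other positions. -/
def insertBot {n : ℕ} (a : Fin (n + 1)) (τ : Equiv.Perm (Fin n)) : Equiv.Perm (Fin (n + 1)) :=
  (finSuccEquiv' a).trans ((Equiv.optionCongr τ).trans (finSuccEquiv' 0).symm)

theorem insertBot_self {n : ℕ} (a : Fin (n + 1)) (τ : Equiv.Perm (Fin n)) :
    insertBot a τ a = 0 := by
  simp [insertBot]

theorem insertBot_succAbove {n : ℕ} (a : Fin (n + 1)) (τ : Equiv.Perm (Fin n)) (i : Fin n) :
    insertBot a τ (a.succAbove i) = (τ i).succ := by
  simp [insertBot]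

theorem sign_insertBot {n : ℕ} (a : Fin (n + 1)) (τ : Equiv.Perm (Fin n)) :
    Equiv.Perm.sign (insertBot a τ) = (-1) ^ (a : ℕ) * Equiv.Perm.sign τ := by
  -- Moving the letter 0 from position a to the front is a cycle of length a + 1, which gives the
  -- sign (-1)^a.
  have h1 : insertBot a τ = insertBot 0 τ * a.cycleRange := by
    ext i
    rcases eq_or_ne i a with rfl | hi
    · rw [Equiv.Perm.mul_apply, Fin.cycleRange_self, insertBot_self, insertBot_self]
    · obtain ⟨j, rfl⟩ := Fin.exists_succAbove_eq hi
      rw [Equiv.Perm.mul_apply, Fin.cycleRange_succAbove, insertBot_succAbove,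
        ← Fin.succAbove_zero_apply j, insertBot_succAbove]
  have h3 : Equiv.Perm.sign (insertBot 0 τ) = Equiv.Perm.sign τ := by
    rw [← Equiv.optionCongr_sign τ]
    exact Equiv.Perm.sign_trans_trans_symm (Equiv.optionCongr τ) (finSuccEquiv' 0)
  rw [h1, Equiv.Perm.sign_mul, h3, Fin.sign_cycleRange, mul_comm]

theorem insertBot_injective {n : ℕ} (a : Fin (n + 1)) :
    Function.Injective (insertBot a : Equiv.Perm (Fin n) → _) := by
  intro τ τ' h
  ext i
  have h2 := insertBot_succAbove a τ i
  rw [h, insertBot_succAbove] at h2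
  simpa using (congrArg Fin.val h2).symm

theorem insertBot_surjective {n : ℕ} (a : Fin (n + 1)) (σ : Equiv.Perm (Fin (n + 1)))
    (h : σ a = 0) : ∃ τ, insertBot a τ = σ := by
  let e : Option (Fin n) ≃ Option (Fin n) :=
    (finSuccEquiv' a).symm.trans (σ.trans (finSuccEquiv' 0))
  have he : e none = none := by simp [e, h]
  refine ⟨Equiv.removeNone e, ?_⟩
  have h2 : Equiv.optionCongr (Equiv.removeNone e) = e := by
    ext1 o
    cases o with
    | none => simp [he]
    | some i =>
      have : e (some i) ≠ none := fun hh => by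
        have := e.injective (hh.trans he.symm)
        simp at this
      exact Equiv.removeNone_some e (Option.ne_none_iff_exists'.1 this)
  ext1 i
  simp [insertBot, h2, e]

theorem insertBot_zero_succ {n : ℕ} (τ : Equiv.Perm (Fin n)) (i : Fin n) :
    insertBot 0 τ i.succ = (τ i).succ := by
  rw [← Fin.succAbove_zero_apply, insertBot_succAbove]

theorem insertBot_of_lt {n : ℕ} (a : Fin (n + 1)) (τ : Equiv.Perm (Fin n)) (i : Fin n)
    (h : (i : ℕ) < a) : insertBot a τ i.castSucc = (τ i).succ := by
  rw [← insertBot_succAbove a, Fin.succAbove_of_castSucc_lt _ _ (by simpa [Fin.lt_def] using h)]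

theorem insertBot_of_ge {n : ℕ} (a : Fin (n + 1)) (τ : Equiv.Perm (Fin n)) (i : Fin n)
    (h : (a : ℕ) ≤ i) : insertBot a τ i.succ = (τ i).succ := by
  rw [← insertBot_succAbove a, Fin.succAbove_of_le_castSucc _ _ (by simpa [Fin.le_def] using h)]

theorem mem_unshuffles {n a : ℕ} {σ : Equiv.Perm (Fin n)} :
    σ ∈ unshuffles n a ↔ IsUnshuffle a σ := by
  simp [unshuffles]

theorem insertBot_zero_mem {n k : ℕ} (τ : Equiv.Perm (Fin n)) :
    insertBot 0 τ ∈ unshuffles (n + 1) (k + 1) ↔ τ ∈ unshuffles n k := by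
  simp only [mem_unshuffles, IsUnshuffle]
  constructor
  · rintro ⟨hl, hr⟩
    refine ⟨fun i j hij hj => ?_, fun i j hij hj => ?_⟩
    · have := hl i.succ j.succ (by simpa using hij) (by simpa using hj)
      simpa [insertBot_zero_succ] using this
    · have := hr i.succ j.succ (by simpa using hij) (by simpa using hj)
      simpa [insertBot_zero_succ] using this
  · rintro ⟨hl, hr⟩
    refine ⟨fun i j hij hj => ?_, fun i j hij hj => ?_⟩
    · obtain ⟨j, rfl⟩ := Fin.exists_succ_eq.2 (Fin.ne_zero_of_lt hij)
      rcases Fin.eq_zero_or_eq_succ i with rfl | ⟨i, rfl⟩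
      · rw [insertBot_self, insertBot_zero_succ]
        exact Fin.succ_pos _
      · rw [insertBot_zero_succ, insertBot_zero_succ]
        simpa using hl i j (by simpa using hij) (by simpa using hj)
    · obtain ⟨j, rfl⟩ := Fin.exists_succ_eq.2 (Fin.ne_zero_of_lt hij)
      rcases Fin.eq_zero_or_eq_succ i with rfl | ⟨i, rfl⟩
      · simp at hj
      · rw [insertBot_zero_succ, insertBot_zero_succ]
        simpa using hr i j (by simpa using hij) (by simpa using hj)

theorem insertBot_mem {n : ℕ} (k : Fin (n + 1)) (τ : Equiv.Perm (Fin n)) :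
    insertBot k τ ∈ unshuffles (n + 1) k ↔ τ ∈ unshuffles n k := by
  simp only [mem_unshuffles, IsUnshuffle]
  constructor
  · rintro ⟨hl, hr⟩
    refine ⟨fun i j hij hj => ?_, fun i j hij hj => ?_⟩
    · have := hl i.castSucc j.castSucc (by simpa using hij) (by simpa using hj)
      rw [insertBot_of_lt _ _ _ hj, insertBot_of_lt _ _ _ (lt_trans hij hj)] at this
      simpa using this
    · have hij' : (i : ℕ) < j := hij
      have := hr i.succ j.succ (by simpa using hij) (by simp; omega)
      rw [insertBot_of_ge _ _ _ hj, insertBot_of_ge _ _ _ (by omega)] at this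
      simpa using this
  · rintro ⟨hl, hr⟩
    refine ⟨fun i j hij hj => ?_, fun i j hij hj => ?_⟩
    · have hij' : (i : ℕ) < j := hij
      obtain ⟨j, rfl⟩ : ∃ j', j = Fin.castSucc j' := ⟨⟨j, by omega⟩, rfl⟩
      obtain ⟨i, rfl⟩ : ∃ i', i = Fin.castSucc i' := ⟨⟨i, by simp at hij'; omega⟩, rfl⟩
      simp only [Fin.val_castSucc] at hj hij'
      rw [insertBot_of_lt _ _ _ hj, insertBot_of_lt _ _ _ (by omega)]
      simpa using hl i j hij' hj
    · have hij' : (i : ℕ) < j := hij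
      obtain ⟨j, rfl⟩ := Fin.exists_succ_eq.2 (Fin.ne_zero_of_lt hij)
      simp only [Fin.val_succ] at hij'
      rw [insertBot_of_ge _ _ _ (by omega)]
      rcases eq_or_ne i k with rfl | hne
      · rw [insertBot_self]; exact Fin.succ_pos _
      · have hne' : (i : ℕ) ≠ k := fun h => hne (Fin.ext h)
        obtain ⟨i, rfl⟩ : ∃ i', i = Fin.succ i' := ⟨⟨i - 1, by omega⟩, by ext; simp; omega⟩
        simp only [Fin.val_succ] at hij' hne' hj
        rw [insertBot_of_ge _ _ _ (by omega)]
        simpa using hr i j (Fin.lt_def.2 (by omega)) (by omega)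

/-- Both blocks are increasing, so the smallest letter opens one of them: it is at position 0 or at
position k. The recursions of the circle product rest on this alternative. -/
theorem unshuffle_zero_or {n k : ℕ} (σ : Equiv.Perm (Fin (n + 1))) (hσ : σ ∈ unshuffles (n + 1) k) :
    (0 < k ∧ σ 0 = 0) ∨ ∃ h : k < n + 1, σ ⟨k, h⟩ = 0 := by
  rw [mem_unshuffles] at hσ
  obtain ⟨r, hr⟩ := σ.surjective 0
  have hmin : ∀ s, ¬ σ s < σ r := by simp [hr]
  by_cases hrk : (r : ℕ) < k
  · left
    refine ⟨by omega, ?_⟩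
    by_contra hc
    have : 0 < r := Fin.pos_of_ne_zero (by rintro rfl; exact hc hr)
    exact hmin _ (hσ.1 0 r this hrk)
  · right
    refine ⟨by omega, ?_⟩
    by_contra hc
    have : (⟨k, by omega⟩ : Fin (n + 1)) ≠ r := fun h => hc (by rw [h, hr])
    have h2 : k ≠ r := fun h => this (Fin.ext h)
    exact hmin _ (hσ.2 ⟨k, by omega⟩ r (by simp [Fin.lt_def]; omega) le_rfl)

theorem sum_unshuffles_bot_zero {M : Type*} [AddCommMonoid M] {n : ℕ}
    (F : Equiv.Perm (Fin (n + 1)) → M) :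
    ∑ σ ∈ unshuffles (n + 1) 0, F σ = ∑ τ ∈ unshuffles n 0, F (insertBot 0 τ) := by
  symm
  refine Finset.sum_bij (fun τ _ => insertBot 0 τ) ?_ ?_ ?_ ?_
  · exact fun τ hτ => (insertBot_mem 0 τ).2 hτ
  · exact fun τ _ τ' _ h => insertBot_injective _ h
  · intro σ hσ
    have h0 : σ 0 = 0 := by
      rcases unshuffle_zero_or σ hσ with ⟨h, _⟩ | ⟨_, h⟩
      · omega
      · exact h
    obtain ⟨τ, rfl⟩ := insertBot_surjective 0 σ h0
    exact ⟨τ, (insertBot_mem 0 τ).1 hσ, rfl⟩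
  · exact fun _ _ => rfl

/-- The condition `k + 1 < n + 1` says that the second block is not empty; otherwise the letter 0
can only open the first one. -/
theorem sum_unshuffles_bot_succ {M : Type*} [AddCommMonoid M] {n k : ℕ}
    (F : Equiv.Perm (Fin (n + 1)) → M) :
    ∑ σ ∈ unshuffles (n + 1) (k + 1), F σ = ∑ τ ∈ unshuffles n k, F (insertBot 0 τ) +
      if h : k + 1 < n + 1 then ∑ τ ∈ unshuffles n (k + 1), F (insertBot ⟨k + 1, h⟩ τ) else 0 := by
  classical
  rw [← Finset.sum_filter_add_sum_filter_not _ (fun σ : Equiv.Perm (Fin (n + 1)) => σ 0 = 0)]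
  congr 1
  · symm
    refine Finset.sum_bij (fun τ _ => insertBot 0 τ) ?_ ?_ ?_ ?_
    · exact fun τ hτ => Finset.mem_filter.2 ⟨(insertBot_zero_mem τ).2 hτ, insertBot_self _ _⟩
    · exact fun τ _ τ' _ h => insertBot_injective _ h
    · intro σ hσ
      rw [Finset.mem_filter] at hσ
      obtain ⟨τ, rfl⟩ := insertBot_surjective 0 σ hσ.2
      exact ⟨τ, (insertBot_zero_mem τ).1 hσ.1, rfl⟩
    · exact fun _ _ => rfl
  · split_ifs with h
    · symm
      refine Finset.sum_bij (fun τ _ => insertBot ⟨k + 1, h⟩ τ) ?_ ?_ ?_ ?_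
      · refine fun τ hτ => Finset.mem_filter.2 ⟨(insertBot_mem ⟨k + 1, h⟩ τ).2 hτ, fun hc => ?_⟩
        have := (insertBot ⟨k + 1, h⟩ τ).injective (hc.trans (insertBot_self _ τ).symm)
        simp [Fin.ext_iff] at this
      · exact fun τ _ τ' _ h => insertBot_injective _ h
      · intro σ hσ
        rw [Finset.mem_filter] at hσ
        rcases unshuffle_zero_or σ hσ.1 with ⟨_, h0⟩ | ⟨_, h0⟩
        · exact absurd h0 hσ.2
        · obtain ⟨τ, rfl⟩ := insertBot_surjective _ σ h0
          exact ⟨τ, (insertBot_mem ⟨k + 1, h⟩ τ).1 hσ.1, rfl⟩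
      · exact fun _ _ => rfl
    · refine Finset.sum_eq_zero fun σ hσ => ?_
      rw [Finset.mem_filter] at hσ
      rcases unshuffle_zero_or σ hσ.1 with ⟨_, h0⟩ | ⟨h', _⟩
      · exact absurd h0 hσ.2
      · exact absurd h' h

/-- The extension of a permutation of `Fin n` to `ℕ` by the identity. -/
def extendNat {n : ℕ} (σ : Equiv.Perm (Fin n)) (i : ℕ) : ℕ :=
  if h : i < n then σ ⟨i, h⟩ else i

/-- The map on positions obtained from `f` by putting the letter `0` at position `a`. -/
def shiftAt (a : ℕ) (f : ℕ → ℕ) (i : ℕ) : ℕ :=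
  if i < a then f i + 1 else if i = a then 0 else f (i - 1) + 1

theorem extendNat_insertBot {n : ℕ} (a : Fin (n + 1)) (τ : Equiv.Perm (Fin n)) :
    extendNat (insertBot a τ) = shiftAt a (extendNat τ) := by
  funext i
  unfold shiftAt extendNat
  rcases lt_trichotomy i (a : ℕ) with h | h | h
  · rw [if_pos h, dif_pos (by omega), dif_pos (by omega)]
    exact congrArg Fin.val (insertBot_of_lt a τ ⟨i, by omega⟩ h)
  · subst h
    rw [if_neg (lt_irrefl _), if_pos rfl, dif_pos a.isLt]
    exact congrArg Fin.val (insertBot_self a τ)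
  · rw [if_neg (by omega), if_neg (by omega)]
    split_ifs with h1 h2
    · have := congrArg Fin.val (insertBot_of_ge a τ ⟨i - 1, by omega⟩ (by simp; omega))
      rw [Fin.val_succ] at this
      rw [← this]
      congr 2
      ext
      simp
      omega
    · omega
    · omega
    · omega

/-- The signed sum over the unshuffles `S(k, n - k)` of a function of the positions. -/
noncomputable def unshuffleSum {M : Type*} [AddCommGroup M] (n k : ℕ) (Φ : (ℕ → ℕ) → M) : M :=
  ∑ σ ∈ unshuffles n k, Equiv.Perm.sign σ • Φ (extendNat σ)

variable {M : Type*} [AddCommGroup M]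

theorem unshuffleSum_zero_right (n : ℕ) (Φ : (ℕ → ℕ) → M) :
    unshuffleSum (n + 1) 0 Φ = unshuffleSum n 0 (fun f => Φ (shiftAt 0 f)) := by
  unfold unshuffleSum
  rw [sum_unshuffles_bot_zero]
  simp [sign_insertBot, extendNat_insertBot]

theorem unshuffleSum_succ (n k : ℕ) (Φ : (ℕ → ℕ) → M) :
    unshuffleSum (n + 1) (k + 1) Φ = unshuffleSum n k (fun f => Φ (shiftAt 0 f)) +
      if k + 1 < n + 1 then
        (-1 : ℤ) ^ (k + 1) • unshuffleSum n (k + 1) (fun f => Φ (shiftAt (k + 1) f)) else 0 := by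
  unfold unshuffleSum
  rw [sum_unshuffles_bot_succ]
  simp only [sign_insertBot, extendNat_insertBot]
  congr 1
  · simp
  · split_ifs
    · simp [Finset.smul_sum, mul_smul, Units.smul_def]
    · rfl

theorem unshuffleSum_congr (n k : ℕ) {Φ Ψ : (ℕ → ℕ) → M} (h : ∀ f, Φ f = Ψ f) :
    unshuffleSum n k Φ = unshuffleSum n k Ψ := by
  rw [funext h]

end UnshufflesBottom

/-! ### Recursion of the circle product in its first argument -/

section Recursion

variable {K V : Type*} [Field K] [AddCommGroup V] [Module K V]

/-- The value of a cochain on the first terms of a sequence. -/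
def onSeq {n : ℕ} (P : PreCochain K n V V) (s : ℕ → ⋀[K]^2 V) : V →ₗ[K] V :=
  P fun i => s i

/-- The summand of the circle product in which `Q` is inserted into the `k`-th wedge factor. -/
noncomputable def wedgeTerm {p q : ℕ} (P : PreCochain K p V V) (Q : PreCochain K q V V) (k : Fin p)
    (s : ℕ → ⋀[K]^2 V) (f : ℕ → ℕ) : V →ₗ[K] V :=
  P (Function.update (fun i : Fin p => s (if (i : ℕ) < k then f i else i + q)) k
    (wedgeDerivation (Q fun j : Fin q => s (f (k + j))) (s (k + q))))

/-- The summand of the circle product in which `Q` is inserted into the last argument. -/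
def lastTerm {p q : ℕ} (P : PreCochain K p V V) (Q : PreCochain K q V V)
    (s : ℕ → ⋀[K]^2 V) (f : ℕ → ℕ) : V →ₗ[K] V :=
  (P fun i : Fin p => s (f i)) ∘ₗ (Q fun j : Fin q => s (f (p + j)))

theorem slotEquiv_inl_val {p q k : ℕ} (hk : k ≤ p) (σ : Equiv.Perm (Fin (k + q))) (j : Fin q) :
    (slotEquiv hk σ (Sum.inl j) : ℕ) = extendNat σ (k + j) := by
  rw [slotEquiv_inl, extendNat, dif_pos (by omega)]

theorem slotEquiv_inr_val {p q k : ℕ} (hk : k ≤ p) (σ : Equiv.Perm (Fin (k + q))) (i : Fin p) :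
    (slotEquiv hk σ (Sum.inr i) : ℕ) = if (i : ℕ) < k then extendNat σ i else i + q := by
  split_ifs with h
  · rw [slotEquiv_inr_lt _ _ _ h, extendNat, dif_pos (by omega)]
  · rw [slotEquiv_inr_ge _ _ _ h]

theorem onSeq_preCircle {p q : ℕ} (P : PreCochain K p V V) (Q : PreCochain K q V V)
    (s : ℕ → ⋀[K]^2 V) :
    onSeq (preCircle P Q) s =
      ∑ k : Fin p, (-1 : ℤ) ^ ((k : ℕ) * q) • unshuffleSum (k + q) k (wedgeTerm P Q k s) +
        (-1 : ℤ) ^ (p * q) • unshuffleSum (p + q) p (lastTerm P Q s) := by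
  ext x
  simp only [onSeq, preCircle_apply, unshuffleSum, wedgeTerm, lastTerm, LinearMap.add_apply,
    LinearMap.sum_apply, LinearMap.smul_apply, slotEquiv_inl_val, slotEquiv_inr_val, lt_irrefl,
    if_false, LinearMap.comp_apply, Fin.is_lt, if_true]

theorem unshuffleSum_add_succ {M : Type*} [AddCommGroup M] (k q : ℕ) (Φ : (ℕ → ℕ) → M) :
    unshuffleSum (k + 1 + (q + 1)) (k + 1) Φ =
      unshuffleSum (k + (q + 1)) k (fun f => Φ (shiftAt 0 f)) +
        (-1 : ℤ) ^ (k + 1) • unshuffleSum (k + 1 + q) (k + 1) (fun f => Φ (shiftAt (k + 1) f)) := by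
  rw [show k + 1 + (q + 1) = (k + 1 + q) + 1 by omega, unshuffleSum_succ, if_pos (by omega),
    show k + 1 + q = k + (q + 1) by omega]

theorem unshuffleSum_succ_self {M : Type*} [AddCommGroup M] (k : ℕ) (Φ : (ℕ → ℕ) → M) :
    unshuffleSum (k + 1 + 0) (k + 1) Φ = unshuffleSum (k + 0) k (fun f => Φ (shiftAt 0 f)) := by
  rw [show k + 1 + 0 = k + 1 by omega, unshuffleSum_succ, if_neg (by omega), add_zero, add_zero]

theorem shiftAt_zero_zero (f : ℕ → ℕ) : shiftAt 0 f 0 = 0 := by simp [shiftAt]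

theorem shiftAt_zero_succ (f : ℕ → ℕ) (i : ℕ) : shiftAt 0 f (i + 1) = f i + 1 := by
  simp [shiftAt]

theorem shiftAt_lt (a : ℕ) (f : ℕ → ℕ) (i : ℕ) (h : i < a) : shiftAt a f i = f i + 1 := by
  simp [shiftAt, h]

theorem shiftAt_self (a : ℕ) (f : ℕ → ℕ) : shiftAt a f a = 0 := by
  simp [shiftAt]

theorem shiftAt_gt (a : ℕ) (f : ℕ → ℕ) (i : ℕ) (h : a ≤ i) : shiftAt a f (i + 1) = f i + 1 := by
  simp [shiftAt, show ¬ i + 1 < a by omega, show i + 1 ≠ a by omega]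

/-- With the letter 0 in front of the first block, `s 0` is the first argument of P. -/
theorem wedgeTerm_shift_left {p q : ℕ} (P : PreCochain K (p + 1) V V) (Q : PreCochain K q V V)
    (k : Fin p) (s : ℕ → ⋀[K]^2 V) (f : ℕ → ℕ) :
    wedgeTerm P Q k.succ s (shiftAt 0 f) =
      wedgeTerm (P.curryLeft (s 0)) Q k (fun i => s (i + 1)) f := by
  unfold wedgeTerm
  rw [MultilinearMap.curryLeft_apply]
  have e1 : (fun j : Fin q => s (shiftAt 0 f (k.succ + j))) =
      fun j : Fin q => s (f (k + j) + 1) := by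
    funext j
    rw [Fin.val_succ, show (k : ℕ) + 1 + j = k + j + 1 by omega, shiftAt_zero_succ]
  rw [e1, Fin.val_succ, show (k : ℕ) + 1 + q = k + q + 1 by omega, Fin.cons_update]
  congr 2
  funext i
  refine Fin.cases ?_ (fun i => ?_) i
  · simp [shiftAt_zero_zero]
  · simp only [Fin.cons_succ, Fin.val_succ, shiftAt_zero_succ, add_lt_add_iff_right]
    split_ifs
    · rfl
    · congr 1; omega

/-- With the letter 0 at position k, where the block of Q begins, `s 0` is the first argument of Q.
-/
theorem wedgeTerm_shift_right {p q : ℕ} (P : PreCochain K p V V) (Q : PreCochain K (q + 1) V V)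
    (k : Fin p) (s : ℕ → ⋀[K]^2 V) (f : ℕ → ℕ) :
    wedgeTerm P Q k s (shiftAt k f) =
      wedgeTerm P (Q.curryLeft (s 0)) k (fun i => s (i + 1)) f := by
  unfold wedgeTerm
  rw [MultilinearMap.curryLeft_apply]
  have e1 : (fun j : Fin (q + 1) => s (shiftAt k f (k + j))) =
      Fin.cons (s 0) fun j : Fin q => s (f (k + j) + 1) := by
    funext j
    refine Fin.cases ?_ (fun j => ?_) j
    · simp [shiftAt_self]
    · rw [Fin.cons_succ, Fin.val_succ, ← add_assoc, shiftAt_gt _ _ _ (by omega)]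
  have e2 : (fun i : Fin p => s (if (i : ℕ) < k then shiftAt k f i else i + (q + 1))) =
      fun i : Fin p => s ((if (i : ℕ) < k then f i else i + q) + 1) := by
    funext i
    split_ifs with h
    · rw [shiftAt_lt _ _ _ h]
    · rfl
  rw [e1, e2]
  rfl

theorem lastTerm_shift_left {p q : ℕ} (P : PreCochain K (p + 1) V V) (Q : PreCochain K q V V)
    (s : ℕ → ⋀[K]^2 V) (f : ℕ → ℕ) :
    lastTerm P Q s (shiftAt 0 f) = lastTerm (P.curryLeft (s 0)) Q (fun i => s (i + 1)) f := by
  unfold lastTerm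
  rw [MultilinearMap.curryLeft_apply]
  have e1 : (fun j : Fin q => s (shiftAt 0 f (p + 1 + j))) =
      fun j : Fin q => s (f (p + j) + 1) := by
    funext j
    rw [show p + 1 + (j : ℕ) = p + j + 1 by omega, shiftAt_zero_succ]
  have e2 : (fun i : Fin (p + 1) => s (shiftAt 0 f i)) =
      Fin.cons (s 0) fun i : Fin p => s (f i + 1) := by
    funext i
    refine Fin.cases ?_ (fun i => ?_) i
    · simp [shiftAt_zero_zero]
    · rw [Fin.cons_succ, Fin.val_succ, shiftAt_zero_succ]
  rw [e1, e2]

theorem lastTerm_shift_right {p q : ℕ} (P : PreCochain K p V V) (Q : PreCochain K (q + 1) V V)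
    (s : ℕ → ⋀[K]^2 V) (f : ℕ → ℕ) :
    lastTerm P Q s (shiftAt p f) = lastTerm P (Q.curryLeft (s 0)) (fun i => s (i + 1)) f := by
  unfold lastTerm
  rw [MultilinearMap.curryLeft_apply]
  have e1 : (fun j : Fin (q + 1) => s (shiftAt p f (p + j))) =
      Fin.cons (s 0) fun j : Fin q => s (f (p + j) + 1) := by
    funext j
    refine Fin.cases ?_ (fun j => ?_) j
    · simp [shiftAt_self]
    · rw [Fin.cons_succ, Fin.val_succ, ← add_assoc, shiftAt_gt _ _ _ (by omega)]
  have e2 : (fun i : Fin p => s (shiftAt p f i)) = fun i : Fin p => s (f i + 1) := by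
    funext i
    rw [shiftAt_lt _ _ _ i.isLt]
  rw [e1, e2]

/-- P has no wedge argument, so the first block is empty and `s 0` can only go to Q. -/
theorem onSeq_preCircle_zero_succ {q : ℕ} (P : PreCochain K 0 V V)
    (Q : PreCochain K (q + 1) V V) (s : ℕ → ⋀[K]^2 V) :
    onSeq (preCircle P Q) s = onSeq (preCircle P (Q.curryLeft (s 0))) (fun i => s (i + 1)) := by
  rw [onSeq_preCircle, onSeq_preCircle, Fin.sum_univ_zero, Fin.sum_univ_zero, zero_mul, zero_mul]
  congr 2
  rw [show 0 + (q + 1) = 0 + q + 1 by omega, unshuffleSum_zero_right]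
  exact unshuffleSum_congr _ _ fun f => lastTerm_shift_right P Q s f

theorem unshuffles_zero_zero : unshuffles 0 0 = {1} := by
  ext σ
  simp [mem_unshuffles, IsUnshuffle, Subsingleton.elim σ 1]

theorem unshuffleSum_zero_zero {M : Type*} [AddCommGroup M] (Φ : (ℕ → ℕ) → M) :
    unshuffleSum (0 + 0) 0 Φ = Φ (extendNat (1 : Equiv.Perm (Fin 0))) := by
  change ∑ σ ∈ unshuffles 0 0, _ = _
  rw [unshuffles_zero_zero, Finset.sum_singleton, Equiv.Perm.sign_one, one_smul]

theorem onSeq_preCircle_zero_zero (P Q : PreCochain K 0 V V) (s : ℕ → ⋀[K]^2 V) :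
    onSeq (preCircle P Q) s = onSeq P s ∘ₗ onSeq Q s := by
  rw [onSeq_preCircle, Fin.sum_univ_zero, unshuffleSum_zero_zero, mul_zero, pow_zero, one_smul,
    zero_add, lastTerm, onSeq, onSeq]
  congr 1
  exact congrArg Q (Subsingleton.elim _ _)

/-- Q takes no wedge argument, so `s 0` stays in P. The summand k = 0, in which Q acts on `s 0`
itself, is the extra term; all others are terms of the circle product for the contracted P. -/
theorem onSeq_preCircle_succ_zero {p : ℕ} (P : PreCochain K (p + 1) V V)
    (Q : PreCochain K 0 V V) (s : ℕ → ⋀[K]^2 V) :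
    onSeq (preCircle P Q) s = onSeq (preCircle (P.curryLeft (s 0)) Q) (fun i => s (i + 1)) +
      onSeq (P.curryLeft (wedgeDerivation (onSeq Q s) (s 0))) (fun i => s (i + 1)) := by
  rw [onSeq_preCircle, onSeq_preCircle, Fin.sum_univ_succ]
  have h0 : (-1 : ℤ) ^ (((0 : Fin (p + 1)) : ℕ) * 0) •
      unshuffleSum (((0 : Fin (p + 1)) : ℕ) + 0) ((0 : Fin (p + 1)) : ℕ) (wedgeTerm P Q 0 s) =
      onSeq (P.curryLeft (wedgeDerivation (onSeq Q s) (s 0))) (fun i => s (i + 1)) := by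
    simp only [Fin.val_zero, mul_zero, pow_zero, one_smul, unshuffleSum_zero_zero, add_zero,
      wedgeTerm, onSeq, MultilinearMap.curryLeft_apply, not_lt_zero, if_false]
    congr 1
    funext i
    refine Fin.cases ?_ (fun i => ?_) i
    · simp only [Function.update_self, Fin.cons_zero]
      congr 2
      exact congrArg Q (Subsingleton.elim _ _)
    · simp
  rw [h0, add_assoc, add_comm]
  congr 1
  simp only [Fin.val_succ, mul_zero, pow_zero, one_smul, unshuffleSum_succ_self,
    wedgeTerm_shift_left, lastTerm_shift_left]

/-- If `s 0` goes to P, then k drops by one and the prefactor (-1)^{k(q+1)} loses (-1)^{q+1}, the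
sign in front of the second term. If it goes to Q, the unshuffle sign (-1)^k turns (-1)^{k(q+1)}
into (-1)^{kq}, the prefactor for Q of degree q, and no sign is left. -/
theorem onSeq_preCircle_succ_succ {p q : ℕ} (P : PreCochain K (p + 1) V V)
    (Q : PreCochain K (q + 1) V V) (s : ℕ → ⋀[K]^2 V) :
    onSeq (preCircle P Q) s = onSeq (preCircle P (Q.curryLeft (s 0))) (fun i => s (i + 1)) +
      (-1 : ℤ) ^ (q + 1) • onSeq (preCircle (P.curryLeft (s 0)) Q) (fun i => s (i + 1)) := by
  have hs : ∀ k : ℕ, (-1 : ℤ) ^ ((k + 1) * (q + 1)) = (-1) ^ (q + 1) * (-1) ^ (k * (q + 1)) := by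
    intro k; ring
  have hs' : ∀ k : ℕ, (-1 : ℤ) ^ ((k + 1) * (q + 1)) * (-1) ^ (k + 1) = (-1) ^ ((k + 1) * q) := by
    intro k
    rw [← pow_add, show (k + 1) * (q + 1) + (k + 1) = (k + 1) * q + 2 * (k + 1) by ring, pow_add,
      pow_mul (-1 : ℤ) 2]
    simp
  rw [onSeq_preCircle, onSeq_preCircle, onSeq_preCircle, Fin.sum_univ_succ, Fin.sum_univ_succ]
  simp only [Fin.val_succ, unshuffleSum_add_succ, wedgeTerm_shift_left, lastTerm_shift_left,
    lastTerm_shift_right, smul_add, Finset.sum_add_distrib, smul_smul, hs', Finset.smul_sum]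
  have hw : ∀ (k : Fin p) f, wedgeTerm P Q k.succ s (shiftAt (k + 1) f) =
      wedgeTerm P (Q.curryLeft (s 0)) k.succ (fun i => s (i + 1)) f :=
    fun k f => wedgeTerm_shift_right P Q k.succ s f
  -- In the summand k = 0 the first block is empty, so only the second alternative occurs.
  have h0 : unshuffleSum (((0 : Fin (p + 1)) : ℕ) + (q + 1)) ((0 : Fin (p + 1)) : ℕ)
        (wedgeTerm P Q 0 s) =
      unshuffleSum (((0 : Fin (p + 1)) : ℕ) + q) ((0 : Fin (p + 1)) : ℕ)
        (wedgeTerm P (Q.curryLeft (s 0)) 0 (fun i => s (i + 1))) := by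
    rw [Fin.val_zero, ← add_assoc, unshuffleSum_zero_right]
    exact unshuffleSum_congr _ _ fun f => wedgeTerm_shift_right P Q 0 s f
  rw [h0]
  simp only [hw, hs, Fin.val_zero, zero_mul, pow_zero]
  abel

end Recursion

/-! ### The pre-Lie identity of the circle product -/

section PreLie

variable (K V : Type*) [Field K] [AddCommGroup V] [Module K V]

/-- The direct sum of the spaces `Hom(∧²V ⊗ ⋯ ⊗ ∧²V ⊗ V, V)`. -/
abbrev PreSum : Type _ := DirectSum ℕ (fun n => PreCochain K n V V)

variable {K V}

noncomputable instance : AddCommGroup (PreSum K V) := inferInstance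

noncomputable instance : Module K (PreSum K V) := inferInstance

noncomputable instance : AddCommGroup (PreSum K V →ₗ[K] PreSum K V) := LinearMap.addCommGroup

/-- The inclusion of a summand. -/
abbrev single (n : ℕ) (P : PreCochain K n V V) : PreSum K V :=
  DirectSum.lof K ℕ (fun n => PreCochain K n V V) n P

/-- A cochain regarded as a cochain of an equal degree. -/
def castDegree {a b : ℕ} (h : a = b) (P : PreCochain K a V V) : PreCochain K b V V :=
  P.domDomCongr (finCongr h)

theorem onSeq_castDegree {a b : ℕ} (h : a = b) (P : PreCochain K a V V) (s : ℕ → ⋀[K]^2 V) :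
    onSeq (castDegree h P) s = onSeq P s := rfl

theorem single_castDegree {a b : ℕ} (h : a = b) (P : PreCochain K a V V) :
    single b (castDegree h P) = single a P := by
  subst h
  rfl

theorem onSeq_add {a : ℕ} (P Q : PreCochain K a V V) (s : ℕ → ⋀[K]^2 V) :
    onSeq (P + Q) s = onSeq P s + onSeq Q s := rfl

theorem onSeq_zsmul {a : ℕ} (c : ℤ) (P : PreCochain K a V V) (s : ℕ → ⋀[K]^2 V) :
    onSeq (c • P) s = c • onSeq P s := rfl

theorem onSeq_ext {a : ℕ} {P Q : PreCochain K a V V} (h : ∀ s, onSeq P s = onSeq Q s) : P = Q := by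
  ext1 X
  -- Only the first `a` terms of the sequence are read; 0 is a filler.
  have := h (fun i => if hi : i < a then X ⟨i, hi⟩ else 0)
  simpa [onSeq] using this

theorem onSeq_curryLeft {a : ℕ} (P : PreCochain K (a + 1) V V) (X : ⋀[K]^2 V)
    (s : ℕ → ⋀[K]^2 V) :
    onSeq (P.curryLeft X) s = onSeq P (fun i => Nat.casesOn i X s) := by
  simp only [onSeq, MultilinearMap.curryLeft_apply]
  congr 1
  funext i
  refine Fin.cases ?_ (fun i => ?_) i <;> rfl

/-- Insertion of `X` as the first argument. -/
noncomputable def contract (X : ⋀[K]^2 V) : PreSum K V →ₗ[K] PreSum K V :=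
  DirectSum.toModule K ℕ _ fun n => match n with
    | 0 => 0
    | n + 1 => DirectSum.lof K ℕ (fun n => PreCochain K n V V) n ∘ₗ
        { toFun := fun P => P.curryLeft X
          map_add' := fun _ _ => rfl
          map_smul' := fun _ _ => rfl }

theorem contract_single_zero (X : ⋀[K]^2 V) (P : PreCochain K 0 V V) :
    contract X (single 0 P) = 0 := by
  simp [contract]

theorem contract_single_succ (X : ⋀[K]^2 V) {n : ℕ} (P : PreCochain K (n + 1) V V) :
    contract X (single (n + 1) P) = single n (P.curryLeft X) := by
  rw [contract, single, DirectSum.toModule_lof]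
  rfl

theorem contract_apply (X : ⋀[K]^2 V) (f : PreSum K V) (n : ℕ) :
    contract X f n = (f (n + 1)).curryLeft X := by
  induction f using DirectSum.induction_on with
  | zero => rw [map_zero]; rfl
  | add f g hf hg => rw [map_add, DirectSum.add_apply, hf, hg]; rfl
  | of m P =>
    change contract X (single m P) n = (single m P (n + 1)).curryLeft X
    rcases m with _ | m
    · rw [contract_single_zero]
      rw [single, DirectSum.lof_eq_of, DirectSum.of_eq_of_ne _ _ _ (by omega)]
      rfl
    · rw [contract_single_succ]
      rcases eq_or_ne n m with rfl | h
      · rw [single, single, DirectSum.lof_apply, DirectSum.lof_apply]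
      · rw [single, single, DirectSum.lof_eq_of, DirectSum.lof_eq_of,
          DirectSum.of_eq_of_ne _ _ _ h, DirectSum.of_eq_of_ne _ _ _ (by omega)]
        rfl

theorem contract_add (X Y : ⋀[K]^2 V) (f : PreSum K V) :
    contract (X + Y) f = contract X f + contract Y f := by
  refine DFinsupp.ext fun n => ?_
  rw [DirectSum.add_apply, contract_apply, contract_apply, contract_apply, map_add]

theorem contract_zero (f : PreSum K V) : contract 0 f = 0 := by
  refine DFinsupp.ext fun n => ?_
  rw [contract_apply, map_zero]
  rfl

/-- The value of the component of degree `0`. -/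
def value : PreSum K V →ₗ[K] Module.End K V where
  toFun f := f 0 fun _ => 0
  map_add' _ _ := rfl
  map_smul' _ _ := rfl

theorem value_single_zero (P : PreCochain K 0 V V) (s : ℕ → ⋀[K]^2 V) :
    value (single 0 P) = onSeq P s := by
  change single 0 P 0 _ = _
  rw [single, DirectSum.lof_apply]
  exact congrArg P (Subsingleton.elim _ _)

theorem value_single_succ {n : ℕ} (P : PreCochain K (n + 1) V V) :
    value (single (n + 1) P) = 0 := by
  change single (n + 1) P 0 (fun _ => 0) = 0
  rw [single, DirectSum.lof_eq_of, DirectSum.of_eq_of_ne _ _ _ (by omega)]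
  rfl

/-- `value` sees degree 0 and the contractions see all positive degrees, so identities can be proved
by induction on the degree. -/
theorem preSum_eq_zero {f : PreSum K V} (h0 : value f = 0) (h : ∀ X, contract X f = 0) :
    f = 0 := by
  refine DFinsupp.ext fun n => ?_
  rcases n with _ | n
  · ext1 X
    rw [Subsingleton.elim X (fun _ => 0)]
    exact h0
  · ext1 X
    have := congrArg (fun f : PreSum K V => f n) (h (X 0))
    simp only [contract_apply] at this
    rw [← Fin.cons_self_tail X, ← MultilinearMap.curryLeft_apply, this]
    rfl

/-- The sign `(-1)ⁿ` in degree `n`. -/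
noncomputable def signOp : PreSum K V →ₗ[K] PreSum K V :=
  DirectSum.lmap fun n => (-1 : ℤ) ^ n • LinearMap.id

theorem signOp_single {n : ℕ} (P : PreCochain K n V V) :
    signOp (single n P) = (-1 : ℤ) ^ n • single n P := by
  rw [signOp, single, DirectSum.lmap_lof, LinearMap.smul_apply, LinearMap.id_apply, map_zsmul]

/-- The circle product as a bilinear map. -/
noncomputable def preCircleHom (p q : ℕ) :
    PreCochain K p V V →ₗ[K] PreCochain K q V V →ₗ[K] PreCochain K (p + q) V V :=
  LinearMap.mk₂ K preCircle
    (by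
      intro P P' Q
      refine (MultilinearMap.ext fun X => LinearMap.ext fun x => ?_)
      simp only [add_apply, LinearMap.add_apply, preCircle_apply, smul_add,
        Finset.sum_add_distrib]
      abel)
    (by
      intro c P Q
      refine (MultilinearMap.ext fun X => LinearMap.ext fun x => ?_)
      simp only [smul_apply, LinearMap.smul_apply, preCircle_apply, smul_add,
        Finset.smul_sum, smul_comm c])
    (by
      intro P Q Q'
      refine (MultilinearMap.ext fun X => LinearMap.ext fun x => ?_)
      simp only [add_apply, LinearMap.add_apply, preCircle_apply, smul_add,
        map_add, MultilinearMap.map_update_add, Finset.sum_add_distrib]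
      abel)
    (by
      intro c P Q
      refine (MultilinearMap.ext fun X => LinearMap.ext fun x => ?_)
      simp only [smul_apply, LinearMap.smul_apply, preCircle_apply, smul_add,
        map_smul, MultilinearMap.map_update_smul, Finset.smul_sum, smul_comm c])

/-- The circle product on the direct sum. -/
noncomputable def circ : PreSum K V →ₗ[K] PreSum K V →ₗ[K] PreSum K V :=
  DirectSum.toModule K ℕ _ fun p => LinearMap.flip <| DirectSum.toModule K ℕ _ fun q =>
    LinearMap.flip <|
      (preCircleHom p q).compr₂ (DirectSum.lof K ℕ (fun n => PreCochain K n V V) (p + q))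

theorem circ_single {p q : ℕ} (P : PreCochain K p V V) (Q : PreCochain K q V V) :
    circ (single p P) (single q Q) = single (p + q) (preCircle P Q) := by
  simp only [circ, single, DirectSum.toModule_lof, LinearMap.flip_apply, LinearMap.compr₂_apply]
  rfl

theorem preSum_induction {C : PreSum K V → Prop} (f : PreSum K V) (h0 : C 0)
    (hadd : ∀ f g, C f → C g → C (f + g)) (h : ∀ n P, C (single n P)) : C f :=
  DirectSum.induction_on f h0 h hadd

theorem value_circ (P Q : PreSum K V) : value (circ P Q) = value P * value Q := by
  induction P using preSum_induction with
  | h0 => simp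
  | hadd f g hf hg => simp only [map_add, LinearMap.add_apply, hf, hg, add_mul]
  | h p P =>
    induction Q using preSum_induction with
    | h0 => simp
    | hadd f g hf hg => simp only [map_add, hf, hg, mul_add]
    | h q Q =>
      rw [circ_single]
      rcases q with _ | q
      · rcases p with _ | p
        · rw [value_single_zero P fun _ => 0, value_single_zero Q fun _ => 0]
          exact (value_single_zero (preCircle P Q) fun _ => 0).trans
            (onSeq_preCircle_zero_zero P Q _)
        · rw [value_single_succ P, zero_mul]
          exact value_single_succ (preCircle P Q :)
      · rw [value_single_succ Q, mul_zero]
        exact value_single_succ (preCircle P Q :)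

/-- The recursions above in one formula: X goes to Q, or to P with a sign for passing Q, or it is
acted on by a Q of degree 0. Since `value` vanishes in positive degree and `contract` in degree 0,
no distinction of cases remains in the statement. -/
theorem contract_circ (X : ⋀[K]^2 V) (P Q : PreSum K V) :
    contract X (circ P Q) = circ P (contract X Q) + circ (contract X P) (signOp Q) +
      contract (wedgeDerivation (value Q) X) P := by
  induction P using preSum_induction with
  | h0 => simp
  | hadd f g hf hg =>
    simp only [map_add, LinearMap.add_apply, hf, hg]
    abel
  | h p P =>
    induction Q using preSum_induction with
    | h0 => simp [contract_zero]
    | hadd f g hf hg =>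
      simp only [map_add, LinearMap.add_apply, hf, hg, contract_add]
      abel
    | h q Q =>
      rw [circ_single, signOp_single]
      rcases q with _ | q <;> rcases p with _ | p
      · rw [contract_single_zero _ P, contract_single_zero _ P, contract_single_zero _ Q, map_zero,
          map_zero, LinearMap.zero_apply]
        simp only [add_zero]
        exact contract_single_zero X (preCircle P Q)
      · rw [contract_single_zero, contract_single_succ _ P, contract_single_succ _ P, map_zero,
          pow_zero, one_smul, circ_single, zero_add, value_single_zero Q fun _ => X]
        refine (contract_single_succ X (preCircle P Q :)).trans ?_
        change single p _ = single p _ + single p _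
        rw [single, single, ← map_add]
        congr 1
        refine onSeq_ext fun s => ?_
        rw [onSeq_curryLeft, onSeq_add]
        refine (onSeq_preCircle_succ_zero P Q _).trans ?_
        congr 5
        exact congrArg Q (Subsingleton.elim _ _)
      · rw [contract_single_succ _ Q, value_single_succ, contract_single_zero, contract_single_zero,
          map_zero, LinearMap.zero_apply, add_zero, add_zero, circ_single]
        refine (contract_single_succ X (preCircle P Q :)).trans ?_
        change single (0 + q) _ = single (0 + q) _
        congr 1
        refine onSeq_ext fun s => ?_
        rw [onSeq_curryLeft]
        exact onSeq_preCircle_zero_succ P Q _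
      · rw [contract_single_succ _ P, contract_single_succ _ Q, value_single_succ, map_zero,
          LinearMap.zero_apply, contract_zero, add_zero, map_zsmul, circ_single, circ_single]
        refine (contract_single_succ X (preCircle P Q :)).trans ?_
        -- The degrees p + (q + 1) and p + 1 + q are not definitionally equal, so one summand is
        -- moved before the components are compared.
        rw [← single_castDegree (show p + (q + 1) = p + 1 + q by omega)]
        change single (p + 1 + q) _ = single (p + 1 + q) _ + _
        rw [single, single, ← map_zsmul, ← map_add]
        congr 1
        refine onSeq_ext fun s => ?_
        rw [onSeq_curryLeft, onSeq_add, onSeq_zsmul, onSeq_castDegree]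
        exact onSeq_preCircle_succ_succ P Q _

theorem circ_zsmul_left (c : ℤ) (P Q : PreSum K V) : circ (c • P) Q = c • circ P Q :=
  map_zsmul (circ.flip Q) c P

theorem signOp_circ (P Q : PreSum K V) : signOp (circ P Q) = circ (signOp P) (signOp Q) := by
  induction P using preSum_induction with
  | h0 => simp
  | hadd f g hf hg => simp only [map_add, LinearMap.add_apply, hf, hg]
  | h p P =>
    induction Q using preSum_induction with
    | h0 => simp
    | hadd f g hf hg => simp only [map_add, hf, hg]
    | h q Q =>
      rw [circ_single, signOp_single, signOp_single, signOp_single, map_zsmul,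
        circ_zsmul_left, circ_single, smul_smul, pow_add, mul_comm]

theorem wedge_induction {C : ⋀[K]^2 V → Prop} (w : ⋀[K]^2 V) (h0 : C 0)
    (hadd : ∀ a b, C a → C b → C (a + b)) (hsmul : ∀ (c : K) a, C a → C (c • a))
    (h : ∀ x y, C (exteriorPower.ιMulti K 2 ![x, y])) : C w := by
  have hw : w ∈ Submodule.span K (Set.range (exteriorPower.ιMulti K 2 (M := V))) := by
    rw [exteriorPower.ιMulti_span]
    trivial
  induction hw using Submodule.span_induction with
  | mem x hx =>
    obtain ⟨v, rfl⟩ := hx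
    have : v = ![v 0, v 1] := by ext i; fin_cases i <;> rfl
    rw [this]
    exact h _ _
  | zero => exact h0
  | add x y _ _ hx hy => exact hadd x y hx hy
  | smul a x _ hx => exact hsmul a x hx

/-- [D_φ, D_ψ] = D_{[φ, ψ]} for the extension D of endomorphisms to derivations of ∧²V, written
without subtraction. -/
theorem wedgeDerivation_mul (φ ψ : Module.End K V) (X : ⋀[K]^2 V) :
    wedgeDerivation φ (wedgeDerivation ψ X) + wedgeDerivation (ψ * φ) X =
      wedgeDerivation ψ (wedgeDerivation φ X) + wedgeDerivation (φ * ψ) X := by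
  induction X using wedge_induction with
  | h0 => simp
  | hadd a b ha hb =>
    simp only [map_add]
    calc _ = (wedgeDerivation φ (wedgeDerivation ψ a) + wedgeDerivation (ψ * φ) a) +
          (wedgeDerivation φ (wedgeDerivation ψ b) + wedgeDerivation (ψ * φ) b) := by abel
      _ = _ := by rw [ha, hb]; abel
  | hsmul c a ha => simp only [map_smul, ← smul_add, ha]
  | h x y =>
    simp only [wedgeDerivation_apply, map_add, Module.End.mul_apply]
    abel

/-- The associator of the circle product. -/
noncomputable def assoc (P Q R : PreSum K V) : PreSum K V :=
  circ (circ P Q) R - circ P (circ Q R)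

/-- The last bracket collects the terms in which Q or R acts on X. Exchanging Q and R swaps its
first two summands, up to the signs in `signOp`, and fixes the difference of the other two by
`wedgeDerivation_mul`. -/
theorem contract_assoc (X : ⋀[K]^2 V) (P Q R : PreSum K V) :
    contract X (assoc P Q R) = assoc P Q (contract X R) + assoc P (contract X Q) (signOp R) +
      assoc (contract X P) (signOp Q) (signOp R) +
      (circ (contract (wedgeDerivation (value Q) X) P) (signOp R) +
        circ (contract (wedgeDerivation (value R) X) P) (signOp Q) +
        contract (wedgeDerivation (value Q) (wedgeDerivation (value R) X)) P -
        contract (wedgeDerivation (value Q * value R) X) P) := by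
  simp only [assoc, map_sub, contract_circ, value_circ, signOp_circ, map_add, LinearMap.add_apply]
  abel

theorem assoc_zero_left (Q R : PreSum K V) : assoc 0 Q R = 0 := by simp [assoc]

theorem assoc_zero_mid (P R : PreSum K V) : assoc P 0 R = 0 := by simp [assoc]

theorem assoc_zero_right (P Q : PreSum K V) : assoc P Q 0 = 0 := by simp [assoc]

theorem assoc_zsmul_mid (c : ℤ) (P Q R : PreSum K V) : assoc P (c • Q) R = c • assoc P Q R := by
  simp [assoc, smul_sub]

theorem assoc_zsmul_right (c : ℤ) (P Q R : PreSum K V) : assoc P Q (c • R) = c • assoc P Q R := by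
  simp [assoc, smul_sub]

theorem value_assoc (P Q R : PreSum K V) : value (assoc P Q R) = 0 := by
  simp only [assoc, map_sub, value_circ, mul_assoc, sub_self]

theorem add_add_sub_swap {M : Type*} [AddCommGroup M] (a b : M) {c d c' d' : M}
    (h : c - d = c' - d') : a + b + c - d = b + a + c' - d' := by
  rw [add_sub_assoc, add_sub_assoc, h, add_comm a]

theorem signed_sum_cancel {M : Type*} [AddCommGroup M] (q r : ℕ) (A B C D : M) :
    (-1 : ℤ) ^ (q * r + q) • A + (-1 : ℤ) ^ r • (-1 : ℤ) ^ (q * r + r) • B +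
        (-1 : ℤ) ^ r • (-1 : ℤ) ^ q • (-1 : ℤ) ^ (q * r) • C + (-1 : ℤ) ^ (q * r) • D -
      (-1 : ℤ) ^ (q * r) • (B + (-1 : ℤ) ^ q • A + (-1 : ℤ) ^ q • (-1 : ℤ) ^ r • C + D) = 0 := by
  rcases neg_one_pow_eq_or ℤ (q * r) with h | h <;> rcases neg_one_pow_eq_or ℤ q with h1 | h1 <;>
    rcases neg_one_pow_eq_or ℤ r with h2 | h2 <;> simp only [pow_add, h, h1, h2] <;> module

/-- The circle product is a graded right pre-Lie product. -/
theorem assoc_symm (p q r : ℕ) (P : PreCochain K p V V) (Q : PreCochain K q V V)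
    (R : PreCochain K r V V) :
    assoc (single p P) (single q Q) (single r R) =
      (-1 : ℤ) ^ (q * r) • assoc (single p P) (single r R) (single q Q) := by
  obtain ⟨N, hN⟩ : ∃ N, N = p + q + r := ⟨_, rfl⟩
  -- Contraction lowers the total degree by one, so each associator in `contract_assoc` is covered
  -- by the induction hypothesis.
  induction N using Nat.strong_induction_on generalizing p q r with
  | _ N ih =>
  rw [← sub_eq_zero]
  refine preSum_eq_zero (by simp [value_assoc]) fun X => ?_
  -- Here R has degree r - 1 after contraction, and q(r - 1) has the parity of qr + q; likewise for
  -- Q below.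
  have hR : assoc (single p P) (single q Q) (contract X (single r R)) =
      (-1 : ℤ) ^ (q * r + q) • assoc (single p P) (contract X (single r R)) (single q Q) := by
    rcases r with _ | r
    · rw [contract_single_zero, assoc_zero_mid, assoc_zero_right, smul_zero]
    · rw [contract_single_succ, ih (p + q + r) (by omega) _ _ _ _ _ _ rfl,
        show q * (r + 1) + q = q * r + 2 * q by ring, pow_add, pow_mul (-1 : ℤ) 2]
      simp
  have hQ : assoc (single p P) (contract X (single q Q)) (single r R) =
      (-1 : ℤ) ^ (q * r + r) • assoc (single p P) (single r R) (contract X (single q Q)) := by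
    rcases q with _ | q
    · rw [contract_single_zero, assoc_zero_mid, assoc_zero_right, smul_zero]
    · rw [contract_single_succ, ih (p + q + r) (by omega) _ _ _ _ _ _ rfl,
        show (q + 1) * r + r = q * r + 2 * r by ring, pow_add, pow_mul (-1 : ℤ) 2]
      simp
  have hP : assoc (contract X (single p P)) (single q Q) (single r R) =
      (-1 : ℤ) ^ (q * r) • assoc (contract X (single p P)) (single r R) (single q Q) := by
    rcases p with _ | p
    · rw [contract_single_zero, assoc_zero_left, assoc_zero_left, smul_zero]
    · rw [contract_single_succ, ih (p + q + r) (by omega) _ _ _ _ _ _ rfl]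
  have hE : ∀ T : PreSum K V, (circ (contract (wedgeDerivation (value (single q Q)) X) T)
          (signOp (single r R)) +
        circ (contract (wedgeDerivation (value (single r R)) X) T) (signOp (single q Q)) +
        contract (wedgeDerivation (value (single q Q))
          (wedgeDerivation (value (single r R)) X)) T -
        contract (wedgeDerivation (value (single q Q) * value (single r R)) X) T) =
      (-1 : ℤ) ^ (q * r) • (circ (contract (wedgeDerivation (value (single r R)) X) T)
          (signOp (single q Q)) +
        circ (contract (wedgeDerivation (value (single q Q)) X) T) (signOp (single r R)) +
        contract (wedgeDerivation (value (single r R))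
          (wedgeDerivation (value (single q Q)) X)) T -
        contract (wedgeDerivation (value (single r R) * value (single q Q)) X) T) := by
    intro T
    have key : ∀ φ ψ : Module.End K V,
        contract (wedgeDerivation φ (wedgeDerivation ψ X)) T -
          contract (wedgeDerivation (φ * ψ) X) T =
        contract (wedgeDerivation ψ (wedgeDerivation φ X)) T -
          contract (wedgeDerivation (ψ * φ) X) T := by
      intro φ ψ
      rw [sub_eq_sub_iff_add_eq_add, ← contract_add, ← contract_add, wedgeDerivation_mul]
    -- If q and r are both positive, both values vanish and the remainder is 0. Otherwise (-1)^{qr}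
    -- = 1 and the remainder is symmetric.
    by_cases hqr : q = 0 ∨ r = 0
    · have h1 : (-1 : ℤ) ^ (q * r) = 1 := by rcases hqr with rfl | rfl <;> simp
      rw [h1, one_smul]
      exact add_add_sub_swap _ _ (key _ _)
    · push Not at hqr
      obtain ⟨q, rfl⟩ := Nat.exists_eq_succ_of_ne_zero hqr.1
      obtain ⟨r, rfl⟩ := Nat.exists_eq_succ_of_ne_zero hqr.2
      · simp only [value_single_succ, map_zero, LinearMap.zero_apply, contract_zero, mul_zero,
          add_zero, sub_zero, smul_zero]
  rw [map_sub, map_zsmul, contract_assoc, contract_assoc, hE]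
  simp only [signOp_single, assoc_zsmul_mid, assoc_zsmul_right, hR, hQ, hP]
  exact signed_sum_cancel _ _ _ _ _ _

end PreLie

/-! ### The ℤ-grading of the cochain spaces -/

section Grading

variable {K V W : Type*} [Field K] [AddCommGroup V] [Module K V] [AddCommGroup W] [Module K W]

theorem lof_mem_grading (n : ℕ) (P : Cochain K n V W) :
    DirectSum.lof K ℕ (fun n => Cochain K n V W) n P ∈ grading K V W n := by
  intro m hm
  rw [DirectSum.lof_eq_of, DirectSum.of_eq_of_ne _ _ _ (by simpa using hm)]

theorem eq_lof_of_mem_grading {n : ℕ} {x : CochainSum K V W} (h : x ∈ grading K V W n) :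
    x = DirectSum.lof K ℕ (fun n => Cochain K n V W) n (x n) := by
  refine DFinsupp.ext fun m => ?_
  rcases eq_or_ne m n with rfl | hm
  · exact (DirectSum.lof_apply (M := fun n => Cochain K n V W) K m (x m)).symm
  · rw [h m (by simpa using hm), lof_mem_grading n (x n) m (by simpa using hm)]

theorem eq_zero_of_mem_grading {k : ℤ} (hk : k < 0) {x : CochainSum K V W}
    (h : x ∈ grading K V W k) : x = 0 :=
  DFinsupp.ext fun m => h m (by omega)

/-- An element is the finite sum of its components, so it is enough that these stay in S. This
serves F, the kernel of the projection and the whole space. -/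
theorem eq_iSup_inf_grading (S : Submodule K (CochainSum K V W))
    (h : ∀ x ∈ S, ∀ n, DirectSum.lof K ℕ (fun n => Cochain K n V W) n (x n) ∈ S) :
    S = ⨆ k : ℤ, S ⊓ grading K V W k := by
  classical
  refine le_antisymm (fun x hx => ?_) (iSup_le fun k => inf_le_left)
  rw [← DirectSum.sum_support_of x]
  refine Submodule.sum_mem _ fun n _ => ?_
  exact Submodule.mem_iSup_of_mem (n : ℤ) ⟨h x hx n, lof_mem_grading n _⟩

variable (K V W)

theorem grading_internal : DirectSum.IsInternal (grading K V W) := by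
  rw [DirectSum.isInternal_submodule_iff_iSupIndep_and_iSup_eq_top]
  constructor
  · intro k
    rw [Submodule.disjoint_def]
    intro x hx hx'
    refine DFinsupp.ext fun n => ?_
    by_cases hn : (n : ℤ) = k
    · have hle : ⨆ j, ⨆ (_ : j ≠ k), grading K V W j ≤
          LinearMap.ker (DirectSum.component K ℕ (fun n => Cochain K n V W) n) := by
        refine iSup_le fun j => iSup_le fun hj y hy => ?_
        rw [LinearMap.mem_ker]
        exact hy n (by rw [hn]; exact hj.symm)
      exact hle hx'
    · exact hx n hn
  · have := eq_iSup_inf_grading (⊤ : Submodule K (CochainSum K V W)) fun _ _ _ => trivial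
    simpa using this.symm

variable {K V W}

theorem cochainSum_induction {C : CochainSum K V W → Prop} (f : CochainSum K V W) (h0 : C 0)
    (hadd : ∀ f g, C f → C g → C (f + g))
    (h : ∀ n P, C (DirectSum.lof K ℕ (fun n => Cochain K n V W) n P)) : C f :=
  DirectSum.induction_on f h0 h hadd

end Grading

/-! ### From the pre-Lie identity to the graded Jacobi identity -/

section Signs

theorem negOnePow_natCast_smul {M : Type*} [AddCommGroup M] (n : ℕ) (x : M) :
    (n : ℤ).negOnePow • x = (-1 : ℤ) ^ n • x := by
  rw [Int.negOnePow_def, zpow_natCast, Units.smul_def]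
  simp

/-- When the commutators are expanded, the Jacobi identity becomes a signed sum of six associators,
which cancel in pairs: the two with first entry a by `h1`, with b by `h2`, with c by `h3`. Only the
parities of pq, pr and qr matter, which leaves eight cases. -/
theorem jacobi_of_assoc_symm {M : Type*} [AddCommGroup M] (m : M →+ M →+ M) (p q r : ℕ)
    (a b c : M)
    (h1 : m (m a b) c - m a (m b c) = (-1 : ℤ) ^ (q * r) • (m (m a c) b - m a (m c b)))
    (h2 : m (m b a) c - m b (m a c) = (-1 : ℤ) ^ (p * r) • (m (m b c) a - m b (m c a)))
    (h3 : m (m c a) b - m c (m a b) = (-1 : ℤ) ^ (p * q) • (m (m c b) a - m c (m b a))) :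
    m a (m b c - (-1 : ℤ) ^ (q * r) • m c b) -
        (-1 : ℤ) ^ (p * (q + r)) • m (m b c - (-1 : ℤ) ^ (q * r) • m c b) a =
      m (m a b - (-1 : ℤ) ^ (p * q) • m b a) c -
        (-1 : ℤ) ^ ((p + q) * r) • m c (m a b - (-1 : ℤ) ^ (p * q) • m b a) +
      (-1 : ℤ) ^ (p * q) • (m b (m a c - (-1 : ℤ) ^ (p * r) • m c a) -
        (-1 : ℤ) ^ (q * (p + r)) • m (m a c - (-1 : ℤ) ^ (p * r) • m c a) b) := by
  have e1 : p * (q + r) = p * q + p * r := by ring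
  have e2 : (p + q) * r = p * r + q * r := by ring
  have e3 : q * (p + r) = p * q + q * r := by ring
  rw [e1, e2, e3]
  simp only [map_sub, map_zsmul, AddMonoidHom.sub_apply, AddMonoidHom.coe_smul, Pi.smul_apply,
    pow_add]
  rw [sub_eq_iff_eq_add] at h1 h2 h3
  rw [h1, h2, h3]
  rcases neg_one_pow_eq_or ℤ (p * q) with h | h <;>
    rcases neg_one_pow_eq_or ℤ (p * r) with h' | h' <;>
    rcases neg_one_pow_eq_or ℤ (q * r) with h'' | h'' <;>
    simp only [h, h', h''] <;> module

end Signs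

/-! ### The graded Lie algebra of cochains -/

section GradedLie

variable {K V : Type*} [Field K] [AddCommGroup V] [Module K V]

/-- The inclusion of `C^*(V, V)` into the larger direct sum. -/
noncomputable def forget : CochainSum K V V →ₗ[K] PreSum K V :=
  DirectSum.lmap fun n => (cochainSubmodule K n V V).subtype

theorem forget_injective : Function.Injective (forget : CochainSum K V V →ₗ[K] PreSum K V) :=
  (DirectSum.lmap_injective _).2 fun _ => Subtype.val_injective

theorem forget_lof (n : ℕ) (P : Cochain K n V V) :
    forget (DirectSum.lof K ℕ (fun n => Cochain K n V V) n P) = single n P.1 :=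
  DirectSum.lmap_lof _ _ _

theorem forget_lof_circle (p q : ℕ) (P : Cochain K p V V) (Q : Cochain K q V V) :
    forget (DirectSum.lof K ℕ (fun n => Cochain K n V V) (p + q) (circle V p q P Q)) =
      circ (single p P.1) (single q Q.1) := by
  rw [forget_lof, circ_single]
  rfl

theorem bracket_mem_grading {p q : ℕ} {a b : CochainSum K V V} (ha : a ∈ grading K V V p)
    (hb : b ∈ grading K V V q) : bracket V a b ∈ grading K V V (p + q : ℕ) := by
  rw [eq_lof_of_mem_grading ha, eq_lof_of_mem_grading hb, bracket_lof]
  refine Submodule.sub_mem _ (lof_mem_grading _ _) ?_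
  have h : ((p + q : ℕ) : ℤ) = (q + p : ℕ) := by rw [add_comm]
  rw [h]
  exact zsmul_mem (lof_mem_grading (q + p) (circle V q p (b q) (a p))) _

theorem forget_bracket {p q : ℕ} {a b : CochainSum K V V} (ha : a ∈ grading K V V p)
    (hb : b ∈ grading K V V q) :
    forget (bracket V a b) =
      circ (forget a) (forget b) - (-1 : ℤ) ^ (p * q) • circ (forget b) (forget a) := by
  rw [eq_lof_of_mem_grading ha, eq_lof_of_mem_grading hb, bracket_lof, map_sub, map_zsmul,
    forget_lof_circle, forget_lof_circle, forget_lof, forget_lof]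

theorem assoc_symm_of_mem_grading {p q r : ℕ} {a b c : CochainSum K V V}
    (ha : a ∈ grading K V V p) (hb : b ∈ grading K V V q) (hc : c ∈ grading K V V r) :
    assoc (forget a) (forget b) (forget c) =
      (-1 : ℤ) ^ (q * r) • assoc (forget a) (forget c) (forget b) := by
  rw [eq_lof_of_mem_grading ha, eq_lof_of_mem_grading hb, eq_lof_of_mem_grading hc, forget_lof,
    forget_lof, forget_lof]
  exact assoc_symm p q r _ _ _

theorem bracket_skew {p q : ℕ} {a b : CochainSum K V V} (ha : a ∈ grading K V V p)
    (hb : b ∈ grading K V V q) : bracket V a b = -((-1 : ℤ) ^ (p * q) • bracket V b a) := by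
  rw [eq_lof_of_mem_grading ha, eq_lof_of_mem_grading hb, bracket_lof, bracket_lof, mul_comm q p]
  rcases neg_one_pow_eq_or ℤ (p * q) with h | h <;> rw [h] <;> simp [add_comm]

theorem bracket_jacobi {p q r : ℕ} {a b c : CochainSum K V V} (ha : a ∈ grading K V V p)
    (hb : b ∈ grading K V V q) (hc : c ∈ grading K V V r) :
    bracket V a (bracket V b c) =
      bracket V (bracket V a b) c + (-1 : ℤ) ^ (p * q) • bracket V b (bracket V a c) := by
  apply forget_injective
  rw [map_add, map_zsmul, forget_bracket ha (bracket_mem_grading hb hc),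
    forget_bracket (bracket_mem_grading ha hb) hc, forget_bracket hb (bracket_mem_grading ha hc),
    forget_bracket ha hb, forget_bracket ha hc, forget_bracket hb hc]
  let m : PreSum K V →+ PreSum K V →+ PreSum K V :=
    { toFun := fun f => (circ f).toAddMonoidHom
      map_zero' := by ext; simp
      map_add' := fun f g => by ext; simp }
  exact jacobi_of_assoc_symm m p q r _ _ _ (assoc_symm_of_mem_grading ha hb hc)
    (assoc_symm_of_mem_grading hb ha hc) (assoc_symm_of_mem_grading hc ha hb)

variable (K V)

theorem isGradedLieAlgebra_bracket :
    IsGradedLieAlgebra (grading K V V) (bracket (K := K) V) where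
  internal := grading_internal K V V
  degree p q a b ha hb := by
    -- Homogeneous elements of negative degree are 0, so the degrees may be taken in ℕ.
    rcases lt_or_ge p 0 with hp | hp
    · rw [eq_zero_of_mem_grading hp ha, map_zero]; exact zero_mem _
    rcases lt_or_ge q 0 with hq | hq
    · rw [eq_zero_of_mem_grading hq hb, map_zero]; exact zero_mem _
    lift p to ℕ using hp
    lift q to ℕ using hq
    exact_mod_cast bracket_mem_grading ha hb
  skew p q a b ha hb := by
    rcases lt_or_ge p 0 with hp | hp
    · simp [eq_zero_of_mem_grading hp ha]
    rcases lt_or_ge q 0 with hq | hq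
    · simp [eq_zero_of_mem_grading hq hb]
    lift p to ℕ using hp
    lift q to ℕ using hq
    rw [← Nat.cast_mul, negOnePow_natCast_smul]
    exact bracket_skew ha hb
  jacobi p q r a b c ha hb hc := by
    rcases lt_or_ge p 0 with hp | hp
    · simp [eq_zero_of_mem_grading hp ha]
    rcases lt_or_ge q 0 with hq | hq
    · simp [eq_zero_of_mem_grading hq hb]
    rcases lt_or_ge r 0 with hr | hr
    · simp [eq_zero_of_mem_grading hr hc]
    lift p to ℕ using hp
    lift q to ℕ using hq
    lift r to ℕ using hr
    rw [← Nat.cast_mul, negOnePow_natCast_smul]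
    exact bracket_jacobi ha hb hc

end GradedLie

/-! ### Signed sums over the splittings of a list -/

section Lists

variable {A : Type*}

/-- The total degree of a list of elements with degrees. -/
def totalDegree (L : List (ℤ × A)) : ℤ := (L.map Prod.fst).sum

@[simp] theorem totalDegree_nil : totalDegree ([] : List (ℤ × A)) = 0 := rfl

@[simp] theorem totalDegree_cons (a : ℤ × A) (L : List (ℤ × A)) :
    totalDegree (a :: L) = a.1 + totalDegree L := by
  simp [totalDegree]

variable {M N : Type*} [AddCommGroup M] [AddCommGroup N]

/-- The sum over all splittings of a list into two sublists, with Koszul signs. Lists are read from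
the right. -/
def splitSum : List (ℤ × A) → (List (ℤ × A) → List (ℤ × A) → M) → M
  | [], Φ => Φ [] []
  | a :: L, Φ => splitSum L fun f s => (a.1 * totalDegree s).negOnePow • Φ (a :: f) s + Φ f (a :: s)

theorem splitSum_congr (L : List (ℤ × A)) (Φ Ψ : List (ℤ × A) → List (ℤ × A) → M)
    (h : ∀ f s, f ⊆ L → s ⊆ L → Φ f s = Ψ f s) : splitSum L Φ = splitSum L Ψ := by
  induction L generalizing Φ Ψ with
  | nil => exact h [] [] (by simp) (by simp)
  | cons a L ih =>
    refine ih _ _ fun f s hf hs => ?_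
    rw [h _ _ (List.cons_subset_cons a hf) (List.subset_cons_of_subset a hs),
      h _ _ (List.subset_cons_of_subset a hf) (List.cons_subset_cons a hs)]

theorem splitSum_add (L : List (ℤ × A)) (Φ Ψ : List (ℤ × A) → List (ℤ × A) → M) :
    splitSum L (fun f s => Φ f s + Ψ f s) = splitSum L Φ + splitSum L Ψ := by
  induction L generalizing Φ Ψ with
  | nil => rfl
  | cons a L ih =>
    simp only [splitSum]
    rw [← ih]
    congr 1
    funext f s
    rw [smul_add]
    abel

theorem map_splitSum (φ : M →+ N) (L : List (ℤ × A)) (Φ : List (ℤ × A) → List (ℤ × A) → M) :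
    φ (splitSum L Φ) = splitSum L fun f s => φ (Φ f s) := by
  induction L generalizing Φ with
  | nil => rfl
  | cons a L ih =>
    simp only [splitSum]
    rw [ih]
    congr 1
    funext f s
    rw [map_add, Units.smul_def, Units.smul_def, map_zsmul]

/-- Exchanging the two parts of a splitting costs the Koszul sign of moving one whole part past the
other. This is what identifies the two sums in Voronov's argument. -/
theorem splitSum_symm (L : List (ℤ × A)) (Φ : List (ℤ × A) → List (ℤ × A) → M) :
    splitSum L Φ =
      splitSum L fun f s => (totalDegree f * totalDegree s).negOnePow • Φ s f := by
  induction L generalizing Φ with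
  | nil => simp [splitSum]
  | cons a L ih =>
    simp only [splitSum]
    rw [ih]
    congr 1
    funext f s
    rw [smul_add, smul_smul, smul_smul, add_comm, totalDegree_cons, totalDegree_cons,
      ← Int.negOnePow_add, ← Int.negOnePow_add]
    congr 2
    · rw [Int.negOnePow_eq_iff]
      exact ⟨-(a.1 * totalDegree s), by ring⟩
    · congr 1
      ring

end Lists

/-! ### The Leibniz rule for iterated brackets -/

section IteratedBrackets

variable {K A : Type*} [Field K] [AddCommGroup A] [Module K A] {𝒜 : ℤ → Submodule K A}
  {br : A →ₗ[K] A →ₗ[K] A}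

theorem map_negOnePow_smul {M N : Type*} [AddCommGroup M] [AddCommGroup N] [Module K M] [Module K N]
    (φ : M →ₗ[K] N) (k : ℤ) (x : M) : φ (k.negOnePow • x) = k.negOnePow • φ x := by
  rw [Units.smul_def, Units.smul_def, map_zsmul]

theorem bracket_negOnePow_smul (k : ℤ) (x y : A) :
    br (k.negOnePow • x) y = k.negOnePow • br x y :=
  map_negOnePow_smul (br.flip y) k x

theorem neg_negOnePow_smul (k : ℤ) (x : A) : -(k.negOnePow • x) = (k + 1).negOnePow • x := by
  rw [Int.negOnePow_succ, Units.neg_smul]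

/-- The Jacobi identity rearranged by skew-symmetry, so that bracketing with a from the right acts
as a derivation. -/
theorem IsGradedLieAlgebra.leibniz (hL : IsGradedLieAlgebra 𝒜 br) {k l m : ℤ} {u v a : A}
    (hu : u ∈ 𝒜 k) (hv : v ∈ 𝒜 l) (ha : a ∈ 𝒜 m) :
    br (br u v) a = br u (br v a) + (l * m).negOnePow • br (br u a) v := by
  rw [hL.jacobi k l m u v a hu hv ha, hL.skew l (k + m) v (br u a) hv (hL.degree k m u a hu ha),
    smul_neg, smul_smul, ← Int.negOnePow_add,
    show (k * l + l * (k + m)).negOnePow = (l * m).negOnePow from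
      Int.negOnePow_eq_iff _ _ |>.2 ⟨k * l, by ring⟩]
  abel

/-- The iterated bracket `[⋯[x, a₁], ⋯, aₙ]` along a list read from the right. -/
def iterBracket (br : A →ₗ[K] A →ₗ[K] A) (x : A) : List (ℤ × A) → A
  | [] => x
  | a :: L => br (iterBracket br x L) a.2

theorem iterBracket_concat (x : A) (L : List (ℤ × A)) (a : ℤ × A) :
    iterBracket br x (L ++ [a]) = iterBracket br (br x a.2) L := by
  induction L with
  | nil => rfl
  | cons b L ih => simp only [List.cons_append, iterBracket, ih]

theorem iterBracket_zero (L : List (ℤ × A)) : iterBracket br 0 L = 0 := by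
  induction L with
  | nil => rfl
  | cons b L ih => simp [iterBracket, ih]

theorem iterBracket_mem (hL : IsGradedLieAlgebra 𝒜 br) {k : ℤ} {x : A} (hx : x ∈ 𝒜 k)
    (L : List (ℤ × A)) (h : ∀ a ∈ L, a.2 ∈ 𝒜 a.1) :
    iterBracket br x L ∈ 𝒜 (k + totalDegree L) := by
  induction L with
  | nil => simpa [iterBracket] using hx
  | cons b L ih =>
    have := hL.degree _ _ _ _ (ih fun a ha => h a (List.mem_cons_of_mem _ ha))
      (h b List.mem_cons_self)
    rw [totalDegree_cons, add_comm b.1, ← add_assoc]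
    exact this

/-- By the Leibniz rule each element of the list goes to one of the two copies of x. An element a
that goes to the left copy passes a factor of degree 1 + |s|: the part |a||s| is the sign in
`splitSum`, and the 1, the degree of x, builds up the factor (-1)^{|f|}. -/
theorem iterBracket_bracket (hL : IsGradedLieAlgebra 𝒜 br) {x : A} (hx : x ∈ 𝒜 1)
    (L : List (ℤ × A)) (h : ∀ a ∈ L, a.2 ∈ 𝒜 a.1) :
    iterBracket br (br x x) L = splitSum L fun f s =>
      (totalDegree f).negOnePow • br (iterBracket br x f) (iterBracket br x s) := by
  induction L with
  | nil => simp [iterBracket, splitSum]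
  | cons a L ih =>
    have hL' : ∀ a ∈ L, a.2 ∈ 𝒜 a.1 := fun b hb => h b (List.mem_cons_of_mem _ hb)
    rw [iterBracket, ih hL', splitSum]
    refine (map_splitSum (br.flip a.2).toAddMonoidHom L _).trans ?_
    refine splitSum_congr _ _ _ fun f s hf hs => ?_
    have hs' := iterBracket_mem hL hx s fun a ha => hL' a (hs ha)
    have hf' := iterBracket_mem hL hx f fun a ha => hL' a (hf ha)
    change br ((totalDegree f).negOnePow • _) a.2 = _
    rw [bracket_negOnePow_smul, hL.leibniz hf' hs' (h a List.mem_cons_self), smul_add, add_comm,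
      smul_smul, smul_smul, ← Int.negOnePow_add, ← Int.negOnePow_add, totalDegree_cons]
    simp only [iterBracket]
    congr 2
    rw [Int.negOnePow_eq_iff]
    exact ⟨0, by ring⟩

end IteratedBrackets

/-! ### Voronov's higher derived brackets -/

section DerivedBrackets

variable {K A : Type*} [Field K] [AddCommGroup A] [Module K A] {𝒜 : ℤ → Submodule K A}
  {br : A →ₗ[K] A →ₗ[K] A} {F : Submodule K A} {proj : A →ₗ[K] A} {Δ : A}

namespace IsVData

/-- The Leibniz rule together with [a, b] = 0 in the abelian subalgebra F. All symmetry of the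
derived brackets comes from here. -/
theorem swap (hV : IsVData 𝒜 br F proj Δ) {k l m : ℤ} {x a b : A} (hx : x ∈ 𝒜 k) (ha : a ∈ 𝒜 l)
    (hb : b ∈ 𝒜 m) (haF : a ∈ F) (hbF : b ∈ F) :
    br (br x a) b = (l * m).negOnePow • br (br x b) a := by
  rw [hV.lie.leibniz hx ha hb, hV.abelian a haF b hbF, map_zero, zero_add]

/-- Both x - 𝒫x and y - 𝒫y lie in the kernel, a subalgebra, so 𝒫 kills their bracket. Expanding it
gives the formula, since [𝒫x, 𝒫y] = 0 and 𝒫² = 𝒫. -/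
theorem proj_bracket (hV : IsVData 𝒜 br F proj Δ) (x y : A) :
    proj (br x y) = proj (br (proj x) y) + proj (br x (proj y)) := by
  have hid : ∀ z, proj (proj z) = proj z := fun z => LinearMap.congr_fun hV.idempotent z
  have hF : ∀ z, proj z ∈ F := fun z => hV.range_eq ▸ LinearMap.mem_range_self proj z
  have hk : ∀ z, z - proj z ∈ LinearMap.ker proj := fun z => by
    rw [LinearMap.mem_ker, map_sub, hid, sub_self]
  have h := hV.ker_subalgebra.closed _ (hk x) _ (hk y)
  rw [LinearMap.mem_ker] at h
  simp only [map_sub, LinearMap.sub_apply, hV.abelian _ (hF x) _ (hF y), sub_zero] at h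
  rw [sub_eq_zero, sub_eq_iff_eq_add] at h
  rw [h, add_comm]

/-- The head of a list is the outermost argument and its end the innermost. The move to the end
brings the argument next to Δ, that is, into the first slot of a derived bracket. -/
theorem iterBracket_move (hV : IsVData 𝒜 br F proj Δ) (y : ℤ × A) (hy : y.2 ∈ 𝒜 y.1)
    (hyF : y.2 ∈ F) (L : List (ℤ × A)) (h : ∀ a ∈ L, a.2 ∈ 𝒜 a.1) (hF : ∀ a ∈ L, a.2 ∈ F) :
    iterBracket br Δ (y :: L) =
      (y.1 * totalDegree L).negOnePow • iterBracket br Δ (L ++ [y]) := by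
  induction L with
  | nil => simp
  | cons a L ih =>
    have hL' : ∀ a ∈ L, a.2 ∈ 𝒜 a.1 := fun b hb => h b (List.mem_cons_of_mem _ hb)
    have ih' := ih hL' fun b hb => hF b (List.mem_cons_of_mem _ hb)
    simp only [iterBracket, List.cons_append] at ih' ⊢
    rw [hV.swap (iterBracket_mem hV.lie hV.mem_degree_one L hL') (h a List.mem_cons_self) hy
      (hF a List.mem_cons_self) hyF, ih', bracket_negOnePow_smul, smul_smul, ← Int.negOnePow_add,
      totalDegree_cons]
    congr 2
    ring

/-- The Jacobi identity in terms of lists: f holds the arguments of the inner bracket, whose value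
is then the first argument of the outer one. The degree 1 + |f| of this value is recorded for the
signs. -/
theorem splitSum_eq_zero [CharZero K] (hV : IsVData 𝒜 br F proj Δ)
    (hdeg : ∀ k, ∀ x ∈ 𝒜 k, proj x ∈ 𝒜 k)
    (L : List (ℤ × A)) (h : ∀ a ∈ L, a.2 ∈ 𝒜 a.1) (hLF : ∀ a ∈ L, a.2 ∈ F) :
    splitSum L (fun f s =>
      proj (iterBracket br Δ (s ++ [(1 + totalDegree f, proj (iterBracket br Δ f))]))) = 0 := by
  have hF : ∀ z, proj z ∈ F := fun z => hV.range_eq ▸ LinearMap.mem_range_self proj z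
  have h0 := congrArg proj (iterBracket_bracket hV.lie hV.mem_degree_one L h)
  rw [hV.square_zero, iterBracket_zero, map_zero] at h0
  have h1 := h0.trans (map_splitSum proj.toAddMonoidHom L _)
  -- By `proj_bracket` each term splits in two. In the first, skew-symmetry brings the projected
  -- factor to the right; in both, `iterBracket_move` then makes it the innermost argument.
  have h2 : splitSum L (fun f s => proj.toAddMonoidHom ((totalDegree f).negOnePow •
        br (iterBracket br Δ f) (iterBracket br Δ s))) =
      splitSum L (fun f s => proj (iterBracket br Δ
          (s ++ [(1 + totalDegree f, proj (iterBracket br Δ f))])) +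
        (totalDegree f * totalDegree s).negOnePow • proj (iterBracket br Δ
          (f ++ [(1 + totalDegree s, proj (iterBracket br Δ s))]))) := by
    refine splitSum_congr _ _ _ fun f s hf hs => ?_
    have hs' := iterBracket_mem hV.lie hV.mem_degree_one s fun a ha => h a (hs ha)
    have hf' := iterBracket_mem hV.lie hV.mem_degree_one f fun a ha => h a (hf ha)
    have ms := hV.iterBracket_move (1 + totalDegree f, proj (iterBracket br Δ f))
      (hdeg _ _ hf') (hF _) s (fun a ha => h a (hs ha)) fun a ha => hLF a (hs ha)
    have mf := hV.iterBracket_move (1 + totalDegree s, proj (iterBracket br Δ s))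
      (hdeg _ _ hs') (hF _) f (fun a ha => h a (hf ha)) fun a ha => hLF a (hf ha)
    change proj _ = _
    rw [map_negOnePow_smul, hV.proj_bracket,
      hV.lie.skew _ _ _ _ (hdeg _ _ hf') hs']
    change (totalDegree f).negOnePow • (proj (-(_ • iterBracket br Δ
        ((1 + totalDegree f, proj (iterBracket br Δ f)) :: s))) +
      proj (iterBracket br Δ ((1 + totalDegree s, proj (iterBracket br Δ s)) :: f))) = _
    rw [ms, mf, neg_negOnePow_smul]
    simp only [map_negOnePow_smul, smul_add, smul_smul, ← Int.negOnePow_add]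
    congr 1
    · conv_rhs => rw [← one_smul ℤˣ (proj _), ← Int.negOnePow_zero]
      congr 1
      rw [Int.negOnePow_eq_iff]
      exact ⟨totalDegree f * totalDegree s + totalDegree f + totalDegree s + 1, by ring⟩
    · congr 1
      rw [Int.negOnePow_eq_iff]
      exact ⟨totalDegree f, by ring⟩
  rw [h2, splitSum_add, ← splitSum_symm] at h1
  -- The two sums are equal by `splitSum_symm`, so twice the sum vanishes and characteristic 0 is
  -- used.
  rw [← two_smul K] at h1
  exact (smul_eq_zero.1 h1.symm).resolve_left two_ne_zero

end IsVData

end DerivedBrackets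

/-! ### Unshuffles sorted by the place of the largest letter -/

section UnshufflesTop

theorem insertTop_injective {n : ℕ} (a : Fin (n + 1)) :
    Function.Injective (insertTop a : Equiv.Perm (Fin n) → _) := by
  intro τ τ' h
  ext i
  have h2 := insertTop_succAbove a τ i
  rw [h, insertTop_succAbove] at h2
  simpa using (congrArg Fin.val h2).symm

theorem insertTop_of_lt {n : ℕ} (a : Fin (n + 1)) (τ : Equiv.Perm (Fin n)) (i : Fin n)
    (h : (i : ℕ) < a) : insertTop a τ i.castSucc = (τ i).castSucc := by
  rw [← insertTop_succAbove a, Fin.succAbove_of_castSucc_lt _ _ (by simpa [Fin.lt_def] using h)]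

theorem insertTop_of_ge {n : ℕ} (a : Fin (n + 1)) (τ : Equiv.Perm (Fin n)) (i : Fin n)
    (h : (a : ℕ) ≤ i) : insertTop a τ i.succ = (τ i).castSucc := by
  rw [← insertTop_succAbove a, Fin.succAbove_of_le_castSucc _ _ (by simpa [Fin.le_def] using h)]

theorem insertTop_last_mem {n m : ℕ} (hm : m ≤ n) (τ : Equiv.Perm (Fin n)) :
    insertTop (Fin.last n) τ ∈ unshuffles (n + 1) m ↔ τ ∈ unshuffles n m := by
  have hc : ∀ i : Fin n, insertTop (Fin.last n) τ i.castSucc = (τ i).castSucc := fun i =>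
    insertTop_of_lt _ _ _ (by simp)
  simp only [mem_unshuffles, IsUnshuffle]
  constructor
  · rintro ⟨hl, hr⟩
    refine ⟨fun i j hij hj => ?_, fun i j hij hj => ?_⟩
    · have := hl i.castSucc j.castSucc (by simpa using hij) (by simpa using hj)
      simpa [hc] using this
    · have := hr i.castSucc j.castSucc (by simpa using hij) (by simpa using hj)
      simpa [hc] using this
  · rintro ⟨hl, hr⟩
    refine ⟨fun i j hij hj => ?_, fun i j hij hj => ?_⟩
    · have hij' : (i : ℕ) < j := hij
      obtain ⟨j, rfl⟩ : ∃ j', j = Fin.castSucc j' := ⟨⟨j, by omega⟩, rfl⟩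
      obtain ⟨i, rfl⟩ : ∃ i', i = Fin.castSucc i' := ⟨⟨i, by simp at hij'; omega⟩, rfl⟩
      simpa [hc] using hl i j (by simpa using hij) (by simpa using hj)
    · have hij' : (i : ℕ) < j := hij
      obtain ⟨i, rfl⟩ : ∃ i', i = Fin.castSucc i' := ⟨⟨i, by omega⟩, rfl⟩
      rcases Fin.eq_castSucc_or_eq_last j with ⟨j, rfl⟩ | rfl
      · simpa [hc] using hr i j (by simpa using hij) (by simpa using hj)
      · rw [hc, insertTop_self]
        exact Fin.castSucc_lt_last _

theorem insertTop_mem {n : ℕ} (m : Fin (n + 1)) (τ : Equiv.Perm (Fin n)) :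
    insertTop m τ ∈ unshuffles (n + 1) (m + 1) ↔ τ ∈ unshuffles n m := by
  simp only [mem_unshuffles, IsUnshuffle]
  constructor
  · rintro ⟨hl, hr⟩
    refine ⟨fun i j hij hj => ?_, fun i j hij hj => ?_⟩
    · have hij' : (i : ℕ) < j := hij
      have := hl i.castSucc j.castSucc (by simpa using hij) (by simp; omega)
      rw [insertTop_of_lt _ _ _ hj, insertTop_of_lt _ _ _ (by omega)] at this
      simpa using this
    · have hij' : (i : ℕ) < j := hij
      have := hr i.succ j.succ (by simpa using hij) (by simp; omega)
      rw [insertTop_of_ge _ _ _ hj, insertTop_of_ge _ _ _ (by omega)] at this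
      simpa using this
  · rintro ⟨hl, hr⟩
    refine ⟨fun i j hij hj => ?_, fun i j hij hj => ?_⟩
    · have hij' : (i : ℕ) < j := hij
      obtain ⟨i, rfl⟩ : ∃ i', i = Fin.castSucc i' := ⟨⟨i, by omega⟩, rfl⟩
      simp only [Fin.val_castSucc] at hij'
      rw [insertTop_of_lt _ _ _ (by omega)]
      rcases eq_or_ne j m with rfl | hne
      · rw [insertTop_self]; exact Fin.castSucc_lt_last _
      · have hne' : (j : ℕ) ≠ m := fun h => hne (Fin.ext h)
        obtain ⟨j, rfl⟩ : ∃ j', j = Fin.castSucc j' := ⟨⟨j, by omega⟩, rfl⟩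
        simp only [Fin.val_castSucc] at hij' hne' hj
        rw [insertTop_of_lt _ _ _ (by omega)]
        simpa using hl i j (Fin.lt_def.2 (by omega)) (by omega)
    · have hij' : (i : ℕ) < j := hij
      obtain ⟨j, rfl⟩ := Fin.exists_succ_eq.2 (Fin.ne_zero_of_lt hij)
      obtain ⟨i, rfl⟩ : ∃ i', i = Fin.succ i' :=
        ⟨⟨i - 1, by omega⟩, Fin.ext (by rw [Fin.val_succ]; simp only; omega)⟩
      simp only [Fin.val_succ] at hij' hj
      rw [insertTop_of_ge _ _ _ (by omega), insertTop_of_ge _ _ _ (by omega)]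
      simpa using hr i j (Fin.lt_def.2 (by omega)) (by omega)

/-- The largest letter closes one of the two increasing blocks. The largest letter is the useful one
for iterated brackets, because the last argument is the head of the list. -/
theorem unshuffle_last_or {n m : ℕ} (hm : m ≤ n + 1) (σ : Equiv.Perm (Fin (n + 1)))
    (hσ : σ ∈ unshuffles (n + 1) m) :
    (m ≤ n ∧ σ (Fin.last n) = Fin.last n) ∨
      ∃ i : Fin (n + 1), (i : ℕ) + 1 = m ∧ σ i = Fin.last n := by
  rw [mem_unshuffles] at hσ
  obtain ⟨r, hr⟩ := σ.surjective (Fin.last n)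
  have hmax : ∀ s, ¬ σ r < σ s := fun s => by rw [hr]; exact not_lt.2 (Fin.le_last _)
  by_cases hrm : (r : ℕ) < m
  · right
    refine ⟨r, ?_, hr⟩
    by_contra hc
    exact hmax _ (hσ.1 r ⟨r + 1, by omega⟩ (Fin.lt_def.2 (by simp)) (by simp; omega))
  · left
    refine ⟨by omega, ?_⟩
    by_contra hc
    have : r ≠ Fin.last n := by rintro rfl; exact hc hr
    exact hmax _ (hσ.2 r (Fin.last n) (Fin.lt_last_iff_ne_last.2 this) (by omega))

theorem sum_unshuffles_top_zero {M : Type*} [AddCommMonoid M] {n : ℕ}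
    (F : Equiv.Perm (Fin (n + 1)) → M) :
    ∑ σ ∈ unshuffles (n + 1) 0, F σ = ∑ τ ∈ unshuffles n 0, F (insertTop (Fin.last n) τ) := by
  symm
  refine Finset.sum_bij (fun τ _ => insertTop (Fin.last n) τ) ?_ ?_ ?_ ?_
  · exact fun τ hτ => (insertTop_last_mem (Nat.zero_le n) τ).2 hτ
  · exact fun τ _ τ' _ h => insertTop_injective _ h
  · intro σ hσ
    have h0 : σ (Fin.last n) = Fin.last n := by
      rcases unshuffle_last_or (Nat.zero_le _) σ hσ with ⟨_, h⟩ | ⟨_, h, _⟩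
      · exact h
      · omega
    obtain ⟨τ, rfl⟩ := insertTop_surjective _ σ h0
    exact ⟨τ, (insertTop_last_mem (Nat.zero_le n) τ).1 hσ, rfl⟩
  · exact fun _ _ => rfl

theorem sum_unshuffles_top_succ {M : Type*} [AddCommMonoid M] {n : ℕ} (m : Fin (n + 1))
    (F : Equiv.Perm (Fin (n + 1)) → M) :
    ∑ σ ∈ unshuffles (n + 1) (m + 1), F σ = ∑ τ ∈ unshuffles n m, F (insertTop m τ) +
      if (m : ℕ) + 1 ≤ n then ∑ τ ∈ unshuffles n (m + 1), F (insertTop (Fin.last n) τ) else 0 := by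
  classical
  rw [← Finset.sum_filter_add_sum_filter_not _
    (fun σ : Equiv.Perm (Fin (n + 1)) => σ m = Fin.last n)]
  congr 1
  · symm
    refine Finset.sum_bij (fun τ _ => insertTop m τ) ?_ ?_ ?_ ?_
    · exact fun τ hτ => Finset.mem_filter.2 ⟨(insertTop_mem m τ).2 hτ, insertTop_self _ _⟩
    · exact fun τ _ τ' _ h => insertTop_injective _ h
    · intro σ hσ
      rw [Finset.mem_filter] at hσ
      obtain ⟨τ, rfl⟩ := insertTop_surjective _ σ hσ.2
      exact ⟨τ, (insertTop_mem m τ).1 hσ.1, rfl⟩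
    · exact fun _ _ => rfl
  · have hcases : ∀ σ ∈ unshuffles (n + 1) (m + 1), ¬ σ m = Fin.last n →
        (m : ℕ) + 1 ≤ n ∧ σ (Fin.last n) = Fin.last n := by
      intro σ hσ hne
      rcases unshuffle_last_or (by omega) σ hσ with h | ⟨i, hi, h⟩
      · exact h
      · have : i = m := Fin.ext (by omega)
        exact absurd (this ▸ h) hne
    split_ifs with h
    · symm
      refine Finset.sum_bij (fun τ _ => insertTop (Fin.last n) τ) ?_ ?_ ?_ ?_
      · refine fun τ hτ => Finset.mem_filter.2 ⟨(insertTop_last_mem h τ).2 hτ, fun hc => ?_⟩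
        have := (insertTop (Fin.last n) τ).injective (hc.trans (insertTop_self _ τ).symm)
        simp [Fin.ext_iff] at this
        omega
      · exact fun τ _ τ' _ h => insertTop_injective _ h
      · intro σ hσ
        rw [Finset.mem_filter] at hσ
        obtain ⟨τ, rfl⟩ := insertTop_surjective _ σ (hcases σ hσ.1 hσ.2).2
        exact ⟨τ, (insertTop_last_mem h τ).1 hσ.1, rfl⟩
      · exact fun _ _ => rfl
    · refine Finset.sum_eq_zero fun σ hσ => ?_
      rw [Finset.mem_filter] at hσ
      exact absurd (hcases σ hσ.1 hσ.2).1 h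

/-- With all block sizes summed at once, every τ in S(m, n - m) has exactly two extensions, by a
largest letter that closes the first or the second block. These are the two summands in the
recursion of `splitSum`. -/
theorem sum_range_unshuffles_succ {M : Type*} [AddCommMonoid M] (n : ℕ)
    (F : ℕ → Equiv.Perm (Fin (n + 1)) → M) :
    ∑ m ∈ Finset.range (n + 2), ∑ σ ∈ unshuffles (n + 1) m, F m σ =
      ∑ m : Fin (n + 1), ∑ τ ∈ unshuffles n m,
        (F (m + 1) (insertTop m τ) + F m (insertTop (Fin.last n) τ)) := by
  rw [Finset.sum_range_succ', sum_unshuffles_top_zero, Finset.sum_range]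
  simp only [sum_unshuffles_top_succ, Finset.sum_add_distrib]
  rw [add_assoc]
  congr 1
  rw [Fin.sum_univ_castSucc, Fin.sum_univ_succ]
  simp only [Fin.val_last, Fin.val_castSucc, Fin.val_succ, Fin.val_zero]
  rw [if_neg (by omega), add_zero, add_comm]
  congr 1
  refine Finset.sum_congr rfl fun m _ => ?_
  rw [if_pos (by omega)]

end UnshufflesTop

/-! ### Koszul signs under insertion of the largest letter -/

section Koszul

/-- The largest letter at position a forms inversions exactly with the letters placed after it. -/
theorem koszulSign_insertTop {n : ℕ} (d : Fin (n + 1) → ℤ) (a : Fin (n + 1))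
    (τ : Equiv.Perm (Fin n)) :
    koszulSign d (insertTop a τ) = koszulSign (fun i => d i.castSucc) τ *
      ∏ j : Fin n, if (a : ℕ) ≤ j then (d (Fin.last n) * d (τ j).castSucc).negOnePow else 1 := by
  unfold koszulSign
  rw [Fin.prod_univ_succAbove _ a, mul_comm]
  congr 1
  · refine Finset.prod_congr rfl fun i _ => ?_
    rw [Fin.prod_univ_succAbove _ a, insertTop_self, insertTop_succAbove,
      if_neg (fun h => absurd h.2 (not_lt.2 (Fin.le_last _))), one_mul]
    refine Finset.prod_congr rfl fun j _ => ?_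
    rw [insertTop_succAbove]
    simp only [Fin.succAbove_lt_succAbove_iff, Fin.castSucc_lt_castSucc_iff]
  · rw [Fin.prod_univ_succAbove _ a, if_neg (fun h => lt_irrefl _ h.1), one_mul]
    refine Finset.prod_congr rfl fun j _ => ?_
    rw [insertTop_self, insertTop_succAbove]
    have h1 : (τ j).castSucc < Fin.last n := Fin.castSucc_lt_last _
    have h2 : a < a.succAbove j ↔ (a : ℕ) ≤ j := by
      rw [Fin.lt_succAbove_iff_le_castSucc, Fin.le_def, Fin.val_castSucc]
    simp only [h1, h2, and_true]

theorem prod_ite_negOnePow (D : ℤ) (e : ℕ → ℤ) (m t : ℕ) :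
    ∏ j ∈ Finset.range (m + t), (if m ≤ j then (D * e j).negOnePow else 1) =
      (D * ∑ j ∈ Finset.range t, e (m + j)).negOnePow := by
  induction t with
  | zero =>
    rw [add_zero, Finset.prod_eq_one, Finset.sum_range_zero, mul_zero, Int.negOnePow_zero]
    intro j hj
    rw [if_neg (by simpa using hj)]
  | succ t ih =>
    rw [← add_assoc, Finset.prod_range_succ, ih, if_pos (by omega), Finset.sum_range_succ, mul_add,
      Int.negOnePow_add]

/-- The map on positions obtained from `f` by putting `y` at position `a`. -/
def insertSeq {X : Type*} (a : ℕ) (y : X) (f : ℕ → X) (i : ℕ) : X :=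
  if i < a then f i else if i = a then y else f (i - 1)

theorem extendNat_insertTop {n : ℕ} (a : Fin (n + 1)) (τ : Equiv.Perm (Fin n)) (i : ℕ)
    (hi : i < n + 1) : extendNat (insertTop a τ) i = insertSeq a n (extendNat τ) i := by
  unfold insertSeq extendNat
  rw [dif_pos hi]
  rcases lt_trichotomy i (a : ℕ) with h | h | h
  · rw [if_pos h, dif_pos (by omega)]
    exact congrArg Fin.val (insertTop_of_lt a τ ⟨i, by omega⟩ h)
  · subst h
    rw [if_neg (lt_irrefl _), if_pos rfl]
    exact congrArg Fin.val (insertTop_self a τ)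
  · rw [if_neg (by omega), if_neg (by omega), dif_pos (by omega)]
    have := congrArg Fin.val (insertTop_of_ge a τ ⟨i - 1, by omega⟩ (by simp; omega))
    rw [Fin.val_castSucc] at this
    rw [← this]
    congr 2
    ext
    simp
    omega

/-- The Koszul sign for a sequence of degrees. -/
def koszulNat (d : ℕ → ℤ) {n : ℕ} (σ : Equiv.Perm (Fin n)) : ℤˣ :=
  koszulSign (fun i : Fin n => d i) σ

theorem koszulNat_insertTop (d : ℕ → ℤ) {n : ℕ} (a : Fin (n + 1)) (τ : Equiv.Perm (Fin n)) :
    koszulNat d (insertTop a τ) = koszulNat d τ *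
      (d n * ∑ j ∈ Finset.range (n - a), d (extendNat τ (a + j))).negOnePow := by
  unfold koszulNat
  rw [koszulSign_insertTop, ← prod_ite_negOnePow (d n) (fun j => d (extendNat τ j)),
    show (a : ℕ) + (n - a) = n by omega, Finset.prod_range]
  congr 1
  refine Finset.prod_congr rfl fun j _ => ?_
  simp [extendNat]

end Koszul

/-! ### Unshuffles as splittings of a list -/

section SequenceLists

variable {X : Type*}

/-- The list `f(n - 1), …, f(0)`. -/
def seqList (f : ℕ → X) : ℕ → List X
  | 0 => []
  | n + 1 => f n :: seqList f n

theorem seqList_congr {f f' : ℕ → X} {n : ℕ} (h : ∀ i < n, f i = f' i) :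
    seqList f n = seqList f' n := by
  induction n with
  | zero => rfl
  | succ n ih => rw [seqList, seqList, h n (by omega), ih fun i hi => h i (by omega)]

theorem seqList_insert_zero (y : X) (f : ℕ → X) (n : ℕ) :
    seqList (insertSeq 0 y f) (n + 1) = seqList f n ++ [y] := by
  induction n with
  | zero => rfl
  | succ n ih =>
    rw [seqList, ih, seqList]
    simp [insertSeq]

theorem mem_seqList {f : ℕ → X} {n : ℕ} {x : X} (h : x ∈ seqList f n) : ∃ i < n, f i = x := by
  induction n with
  | zero => simp [seqList] at h
  | succ n ih =>
    rw [seqList, List.mem_cons] at h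
    rcases h with rfl | h
    · exact ⟨n, by omega, rfl⟩
    · obtain ⟨i, hi, e⟩ := ih h
      exact ⟨i, by omega, e⟩

variable {A M : Type*} [AddCommGroup M]

theorem totalDegree_seqList (z : ℕ → ℤ × A) (n : ℕ) :
    totalDegree (seqList z n) = ∑ i ∈ Finset.range n, (z i).1 := by
  induction n with
  | zero => rfl
  | succ n ih => rw [seqList, totalDegree_cons, ih, Finset.sum_range_succ, add_comm]

/-- Both sides obey the same recursion in the largest letter: at the end of the first block it is
inverted with the whole second block, which gives the sign in `splitSum`; at the end of the second
block it has no inversions. -/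
theorem sum_unshuffles_eq_splitSum (z : ℕ → ℤ × A) (n : ℕ)
    (Φ : List (ℤ × A) → List (ℤ × A) → M) :
    ∑ m ∈ Finset.range (n + 1), ∑ σ ∈ unshuffles n m, koszulNat (fun i => (z i).1) σ •
      Φ (seqList (fun i => z (extendNat σ i)) m)
        (seqList (fun j => z (extendNat σ (m + j))) (n - m)) =
      splitSum (seqList z n) Φ := by
  induction n generalizing Φ with
  | zero =>
    rw [zero_add, Finset.sum_range_one, unshuffles_zero_zero, Finset.sum_singleton]
    simp [seqList, splitSum, koszulNat, koszulSign]
  | succ n ih =>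
    rw [sum_range_unshuffles_succ, seqList, splitSum, ← ih, Finset.sum_range]
    refine Finset.sum_congr rfl fun m _ => Finset.sum_congr rfl fun τ _ => ?_
    rw [koszulNat_insertTop, koszulNat_insertTop, smul_add, smul_smul, totalDegree_seqList]
    have e1 : seqList (fun i => z (extendNat (insertTop m τ) i)) (m + 1) =
        z n :: seqList (fun i => z (extendNat τ i)) m := by
      rw [seqList]
      congr 1
      · rw [extendNat_insertTop _ _ _ (by omega)]
        simp [insertSeq]
      · refine seqList_congr fun i hi => ?_
        rw [extendNat_insertTop _ _ _ (by omega), insertSeq, if_pos hi]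
    have e2 : seqList (fun j => z (extendNat (insertTop m τ) (m + 1 + j))) (n + 1 - (m + 1)) =
        seqList (fun j => z (extendNat τ (m + j))) (n - m) := by
      rw [show n + 1 - (m + 1) = n - m by omega]
      refine seqList_congr fun i hi => ?_
      rw [extendNat_insertTop _ _ _ (by omega), insertSeq, if_neg (by omega), if_neg (by omega),
        show (m : ℕ) + 1 + i - 1 = m + i by omega]
    have e3 : seqList (fun i => z (extendNat (insertTop (Fin.last n) τ) i)) m =
        seqList (fun i => z (extendNat τ i)) m := by
      refine seqList_congr fun i hi => ?_
      rw [extendNat_insertTop _ _ _ (by omega), insertSeq, if_pos (by simp; omega)]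
    have e4 : seqList (fun j => z (extendNat (insertTop (Fin.last n) τ) (m + j))) (n + 1 - m) =
        z n :: seqList (fun j => z (extendNat τ (m + j))) (n - m) := by
      rw [show n + 1 - m = n - m + 1 by omega, seqList]
      congr 1
      · rw [extendNat_insertTop _ _ _ (by omega), show (m : ℕ) + (n - m) = n by omega]
        simp [insertSeq]
      · refine seqList_congr fun i hi => ?_
        rw [extendNat_insertTop _ _ _ (by omega), insertSeq, if_pos (by simp; omega)]
    rw [e1, e2, e3, e4]
    simp

end SequenceLists

/-! ### Graded symmetry of the derived brackets -/

section Symmetry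

variable {K A : Type*} [Field K] [AddCommGroup A] [Module K A] {𝒜 : ℤ → Submodule K A}
  {br : A →ₗ[K] A →ₗ[K] A} {F : Submodule K A} {proj : A →ₗ[K] A} {Δ : A}

/-- The entry y is moved to the outermost position past the t entries that follow it, one
application of `IsVData.swap` for each. -/
theorem IsVData.iterBracket_insertSeq (hV : IsVData 𝒜 br F proj Δ) (a t : ℕ) (y : ℤ × A)
    (hy : y.2 ∈ 𝒜 y.1) (hyF : y.2 ∈ F) (f : ℕ → ℤ × A)
    (h : ∀ i < a + t, (f i).2 ∈ 𝒜 (f i).1) (hF : ∀ i < a + t, (f i).2 ∈ F) :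
    iterBracket br Δ (seqList (insertSeq a y f) (a + t + 1)) =
      (y.1 * ∑ j ∈ Finset.range t, (f (a + j)).1).negOnePow •
        iterBracket br Δ (y :: seqList f (a + t)) := by
  induction t with
  | zero =>
    have e : seqList (insertSeq a y f) (a + 0 + 1) = y :: seqList f (a + 0) := by
      rw [seqList]
      congr 1
      · simp [insertSeq]
      · exact seqList_congr fun i hi => by rw [insertSeq, if_pos (by omega)]
    rw [e]
    simp
  | succ t ih =>
    have e : insertSeq a y f (a + (t + 1)) = f (a + t) := by
      rw [insertSeq, if_neg (by omega), if_neg (by omega)]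
      congr 1
    rw [seqList, iterBracket, e]
    have ih' := ih (fun i hi => h i (by omega)) (fun i hi => hF i (by omega))
    rw [← add_assoc, ih', bracket_negOnePow_smul]
    simp only [seqList, iterBracket]
    have hm := iterBracket_mem hV.lie hV.mem_degree_one (seqList f (a + t)) (fun b hb => by
      obtain ⟨i, hi, rfl⟩ := mem_seqList hb
      exact h i (by omega))
    rw [hV.swap hm hy (h (a + t) (by omega)) hyF (hF (a + t) (by omega)), smul_smul,
      ← Int.negOnePow_add, Finset.sum_range_succ, mul_add]

theorem IsVData.iterBracket_perm (hV : IsVData 𝒜 br F proj Δ) (n : ℕ) (z : ℕ → ℤ × A)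
    (h : ∀ i < n, (z i).2 ∈ 𝒜 (z i).1) (hF : ∀ i < n, (z i).2 ∈ F) (σ : Equiv.Perm (Fin n)) :
    iterBracket br Δ (seqList (fun i => z (extendNat σ i)) n) =
      koszulNat (fun i => (z i).1) σ • iterBracket br Δ (seqList z n) := by
  induction n with
  | zero => simp [seqList, iterBracket, koszulNat, koszulSign]
  | succ n ih =>
    -- The largest letter is moved from its position a to the outermost slot. What remains is the
    -- permutation τ of the other n letters, and the signs combine by `koszulNat_insertTop`.
    obtain ⟨a, ha⟩ := σ.surjective (Fin.last n)
    obtain ⟨τ, rfl⟩ := insertTop_surjective a σ ha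
    have hlt : ∀ i < n, extendNat τ i < n := fun i hi => by
      rw [extendNat, dif_pos hi]; exact Fin.isLt _
    have e : seqList (fun i => z (extendNat (insertTop a τ) i)) (n + 1) =
        seqList (insertSeq a (z n) fun i => z (extendNat τ i)) (a + (n - a) + 1) := by
      rw [show (a : ℕ) + (n - a) + 1 = n + 1 by omega]
      refine seqList_congr fun i hi => ?_
      rw [extendNat_insertTop _ _ _ hi]
      unfold insertSeq
      split_ifs <;> rfl
    rw [e, hV.iterBracket_insertSeq a (n - a) (z n) (h n (by omega)) (hF n (by omega)) _
      (fun i hi => h _ (by have := hlt i (by omega); omega))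
      (fun i hi => hF _ (by have := hlt i (by omega); omega)),
      show (a : ℕ) + (n - a) = n by omega, iterBracket,
      ih (fun i hi => h i (by omega)) (fun i hi => hF i (by omega)), koszulNat_insertTop, seqList,
      iterBracket]
    rw [Units.smul_def (koszulNat _ τ), ← LinearMap.flip_apply br, map_zsmul, ← Units.smul_def,
      LinearMap.flip_apply, smul_smul, mul_comm]

end Symmetry

/-! ### The semidirect product 3-Lie algebra -/

section SemidirectProduct

variable {K g h : Type*} [Field K] [AddCommGroup g] [Module K g] [AddCommGroup h] [Module K h]

theorem alt₃_add_first {V W : Type*} [AddCommGroup V] [Module K V] [AddCommGroup W] [Module K W]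
    (f : V [⋀^Fin 3]→ₗ[K] W) (a b y z : V) :
    f ![a + b, y, z] = f ![a, y, z] + f ![b, y, z] :=
  f.map_vecCons_add ![y, z] a b

theorem alt₃_rotate {V W : Type*} [AddCommGroup V] [Module K V] [AddCommGroup W] [Module K W]
    (f : V [⋀^Fin 3]→ₗ[K] W) (x y z : V) : f ![x, y, z] = f ![z, x, y] := by
  have h2 := f.map_perm ![x, y, z] (finRotate 3).symm
  rw [show Equiv.Perm.sign (finRotate 3).symm = 1 by decide, one_smul] at h2
  rw [← h2]
  congr 1
  ext i
  fin_cases i <;> rfl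

theorem alt₃_add_last {V W : Type*} [AddCommGroup V] [Module K V] [AddCommGroup W] [Module K W]
    (f : V [⋀^Fin 3]→ₗ[K] W) (x y a b : V) :
    f ![x, y, a + b] = f ![x, y, a] + f ![x, y, b] := by
  rw [alt₃_rotate f x y, alt₃_add_first, ← alt₃_rotate f x y a, ← alt₃_rotate f x y b]

theorem alt₃_add_mid {V W : Type*} [AddCommGroup V] [Module K V] [AddCommGroup W] [Module K W]
    (f : V [⋀^Fin 3]→ₗ[K] W) (x a b z : V) :
    f ![x, a + b, z] = f ![x, a, z] + f ![x, b, z] := by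
  rw [alt₃_rotate f x, alt₃_add_last, ← alt₃_rotate f x a, ← alt₃_rotate f x b]

/-- In the component h, the terms mixing ρ and μ vanish, since the image of ρ is central and ρ kills
brackets. The terms in μ alone are the Fundamental Identity of μ. The terms in ρ are linear in the
uᵢ: those in u₃, u₄, u₅ are instances of `rep₁`, those in u₁, u₂ of `rep₂`. -/
theorem isThreeLieBracket_semidirect {π : g [⋀^Fin 3]→ₗ[K] g} {μ : h [⋀^Fin 3]→ₗ[K] h}
    {ρ : g [⋀^Fin 2]→ₗ[K] Module.End K h} (hπ : IsThreeLieBracket π) (hμ : IsThreeLieBracket μ)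
    (hρ : IsAction π μ ρ) : IsThreeLieBracket (semidirect π ρ μ) := by
  rintro ⟨a₁, u₁⟩ ⟨a₂, u₂⟩ ⟨a₃, u₃⟩ ⟨a₄, u₄⟩ ⟨a₅, u₅⟩
  simp only [semidirect_apply, Prod.mk_add_mk]
  refine Prod.ext (hπ _ _ _ _ _) ?_
  have c1 : ∀ x y u v w, μ ![ρ ![x, y] u, v, w] = 0 := fun x y u v w => hρ.mem_center x y u v w
  have c3 : ∀ x y u v w, μ ![v, w, ρ ![x, y] u] = 0 := fun x y u v w => by
    rw [alt₃_rotate, c1]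
  have c2 : ∀ x y u v w, μ ![v, ρ ![x, y] u, w] = 0 := fun x y u v w => by
    rw [alt₃_rotate, c3]
  have r1 : ∀ x₁ x₂ x₃ x₄ u, ρ ![x₁, x₂] (ρ ![x₃, x₄] u) = ρ ![π ![x₁, x₂, x₃], x₄] u +
      ρ ![x₃, π ![x₁, x₂, x₄]] u + ρ ![x₃, x₄] (ρ ![x₁, x₂] u) := fun x₁ x₂ x₃ x₄ u =>
    LinearMap.congr_fun (hρ.rep₁ x₁ x₂ x₃ x₄) u
  have r2 : ∀ x₁ x₂ x₃ x₄ u, ρ ![x₁, π ![x₂, x₃, x₄]] u = ρ ![x₃, x₄] (ρ ![x₁, x₂] u) -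
      ρ ![x₂, x₄] (ρ ![x₁, x₃] u) + ρ ![x₂, x₃] (ρ ![x₁, x₄] u) := fun x₁ x₂ x₃ x₄ u =>
    LinearMap.congr_fun (hρ.rep₂ x₁ x₂ x₃ x₄) u
  have sw : ∀ x y u, ρ ![x, y] u = -ρ ![y, x] u := fun x y u => by
    rw [alt₂_swap ρ x y, LinearMap.neg_apply]
  simp only [map_add, alt₃_add_first, alt₃_add_mid, alt₃_add_last, c1, c2, c3, hρ.map_bracket,
    add_zero, zero_add]
  rw [r1 a₁ a₂ a₃ a₄ u₅, r1 a₁ a₂ a₄ a₅ u₃, r1 a₁ a₂ a₅ a₃ u₄, r2 a₂ a₃ a₄ a₅ u₁,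
    sw (π ![a₃, a₄, a₅]) a₁, r2 a₁ a₃ a₄ a₅ u₂, hμ u₁ u₂ u₃ u₄ u₅,
    sw a₅ a₃ (ρ ![a₂, a₄] u₁), sw a₃ a₁, sw a₄ a₁, sw a₅ a₁, sw a₅ a₃ (ρ ![a₁, a₂] u₄),
    sw a₅ a₃ (-ρ ![a₁, a₄] u₂)]
  simp only [map_neg]
  abel

end SemidirectProduct

/-! ### The Maurer–Cartan equation [Δ, Δ] = 0 -/

section SquareZero

variable {K V : Type*} [Field K] [AddCommGroup V] [Module K V]

theorem onSeq_ofAlternating_curryLeft (f : V [⋀^Fin 3]→ₗ[K] V) (X : ⋀[K]^2 V)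
    (s : ℕ → ⋀[K]^2 V) : onSeq ((ofAlternating f).1.curryLeft X) s = wedgeCurry f X := rfl

theorem onSeq_preCircle_ofAlternating (f : V [⋀^Fin 3]→ₗ[K] V) (s : ℕ → ⋀[K]^2 V) :
    onSeq (preCircle (ofAlternating f).1 (ofAlternating f).1) s =
      wedgeCurry f (s 1) ∘ₗ wedgeCurry f (s 0) +
        wedgeCurry f (wedgeDerivation (wedgeCurry f (s 0)) (s 1)) -
        wedgeCurry f (s 0) ∘ₗ wedgeCurry f (s 1) := by
  rw [onSeq_preCircle_succ_succ, onSeq_preCircle_succ_zero, onSeq_preCircle_zero_succ,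
    onSeq_preCircle_zero_zero, onSeq_preCircle_zero_zero]
  simp only [onSeq_ofAlternating_curryLeft, zero_add, pow_one, neg_smul, one_smul]
  rw [← sub_eq_add_neg]

/-- By linearity it suffices to take X = x ∧ y and Y = z ∧ w; evaluation at t is then the
Fundamental Identity for x, y, z, w, t. -/
theorem preCircle_ofAlternating_self {f : V [⋀^Fin 3]→ₗ[K] V} (hf : IsThreeLieBracket f) :
    preCircle (ofAlternating f).1 (ofAlternating f).1 = 0 := by
  refine onSeq_ext fun s => ?_
  rw [onSeq_preCircle_ofAlternating]
  change _ = 0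
  generalize s 0 = X
  generalize s 1 = Y
  rw [sub_eq_zero]
  induction X using wedge_induction with
  | h0 => simp
  | hadd a b ha hb =>
    simp only [map_add, LinearMap.comp_add, LinearMap.add_comp, LinearMap.add_apply, ← ha, ← hb]
    abel
  | hsmul c a ha =>
    simp only [map_smul, LinearMap.comp_smul, LinearMap.smul_comp, LinearMap.smul_apply, ← ha,
      smul_add]
  | h x y =>
    induction Y using wedge_induction with
    | h0 => simp
    | hadd a b ha hb =>
      simp only [map_add, LinearMap.comp_add, LinearMap.add_comp, ← ha, ← hb]
      abel
    | hsmul c a ha =>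
      simp only [map_smul, LinearMap.comp_smul, LinearMap.smul_comp, ← ha, smul_add]
    | h z w =>
      ext t
      simp only [LinearMap.add_apply, LinearMap.comp_apply, wedgeDerivation_apply, map_add,
        wedgeCurry_apply]
      rw [hf x y z w t]
      abel

theorem bracket_ofAlternating_self {f : V [⋀^Fin 3]→ₗ[K] V} (hf : IsThreeLieBracket f) :
    bracket V (DirectSum.lof K ℕ (fun n => Cochain K n V V) 1 (ofAlternating f))
      (DirectSum.lof K ℕ (fun n => Cochain K n V V) 1 (ofAlternating f)) = 0 := by
  have h : circle V 1 1 (ofAlternating f) (ofAlternating f) = 0 :=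
    Subtype.ext (preCircle_ofAlternating_self hf)
  rw [bracket_lof, h, map_zero, smul_zero, sub_zero]

end SquareZero

/-! ### The V-data on the cochains of g ⊕ h -/

section Projection

variable {K g h : Type*} [Field K] [AddCommGroup g] [Module K g] [AddCommGroup h] [Module K h]

theorem embed_lof (n : ℕ) (P : Cochain K n g h) :
    embed K g h (DirectSum.lof K ℕ (fun n => Cochain K n g h) n P) =
      DirectSum.lof K ℕ (fun n => Cochain K n (g × h) (g × h)) n
        (Cochain.map (LinearMap.fst K g h) (LinearMap.inr K g h) n P) :=
  DirectSum.lmap_lof _ _ _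

theorem restrict_lof (n : ℕ) (P : Cochain K n (g × h) (g × h)) :
    restrict K g h (DirectSum.lof K ℕ (fun n => Cochain K n (g × h) (g × h)) n P) =
      DirectSum.lof K ℕ (fun n => Cochain K n g h) n
        (Cochain.map (LinearMap.inl K g h) (LinearMap.snd K g h) n P) :=
  DirectSum.lmap_lof _ _ _

theorem embed_injective : Function.Injective (embed K g h) :=
  Function.LeftInverse.injective (restrict_embed K g h)

theorem projection_apply (x : CochainSum K (g × h) (g × h)) :
    projection K g h x = embed K g h (restrict K g h x) := rfl

theorem projection_embed (P : CochainSum K g h) :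
    projection K g h (embed K g h P) = embed K g h P := by
  rw [projection_apply, restrict_embed]

theorem mem_ker_projection {x : CochainSum K (g × h) (g × h)} :
    x ∈ LinearMap.ker (projection K g h) ↔ restrict K g h x = 0 := by
  rw [LinearMap.mem_ker, projection_apply, ← map_zero (embed K g h), embed_injective.eq_iff]

theorem embed_mem_grading {k : ℤ} {P : CochainSum K g h} (hP : P ∈ grading K g h k) :
    embed K g h P ∈ grading K (g × h) (g × h) k := by
  intro n hn
  change Cochain.map (LinearMap.fst K g h) (LinearMap.inr K g h) n (P n) = 0
  rw [hP n hn, map_zero]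

theorem restrict_mem_grading {k : ℤ} {x : CochainSum K (g × h) (g × h)}
    (hx : x ∈ grading K (g × h) (g × h) k) : restrict K g h x ∈ grading K g h k := by
  intro n hn
  change Cochain.map (LinearMap.inl K g h) (LinearMap.snd K g h) n (x n) = 0
  rw [hx n hn, map_zero]

theorem range_projection : LinearMap.range (projection K g h) = LinearMap.range (embed K g h) := by
  refine le_antisymm ?_ ?_
  · rintro _ ⟨x, rfl⟩
    exact ⟨_, rfl⟩
  · rintro _ ⟨P, rfl⟩
    exact ⟨_, projection_embed P⟩

theorem map_wedgeDerivation_eq_zero {V W : Type*} [AddCommGroup V] [Module K V] [AddCommGroup W]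
    [Module K W] (α : V →ₗ[K] W) (φ : Module.End K V) (hφ : ∀ x, α (φ x) = 0) (w : ⋀[K]^2 V) :
    exteriorPower.map 2 α (wedgeDerivation φ w) = 0 := by
  induction w using wedge_induction with
  | h0 => simp
  | hadd a b ha hb => rw [map_add, map_add, ha, hb, add_zero]
  | hsmul c a ha => rw [map_smul, map_smul, ha, smul_zero]
  | h x y =>
    rw [wedgeDerivation_apply, map_add, exteriorPower.map_apply_ιMulti,
      exteriorPower.map_apply_ιMulti]
    rw [AlternatingMap.map_coord_zero _ (0 : Fin 2) (by simp [hφ]),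
      AlternatingMap.map_coord_zero _ (1 : Fin 2) (by simp [hφ]), add_zero]

theorem wedgeDerivation_map {V W : Type*} [AddCommGroup V] [Module K V] [AddCommGroup W]
    [Module K W] (α : V →ₗ[K] W) (φ : Module.End K V) (ψ : Module.End K W)
    (hφ : ∀ x, α (φ x) = ψ (α x)) (w : ⋀[K]^2 V) :
    wedgeDerivation ψ (exteriorPower.map 2 α w) = exteriorPower.map 2 α (wedgeDerivation φ w) := by
  have e : ∀ x y : V, (α ∘ ![x, y]) = ![α x, α y] := fun x y => by
    ext i; fin_cases i <;> rfl
  induction w using wedge_induction with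
  | h0 => simp
  | hadd a b ha hb => simp only [map_add, ha, hb]
  | hsmul c a ha => simp only [map_smul, ha]
  | h x y =>
    rw [wedgeDerivation_apply, map_add, exteriorPower.map_apply_ιMulti,
      exteriorPower.map_apply_ιMulti, exteriorPower.map_apply_ιMulti, e, e, e,
      wedgeDerivation_apply, hφ, hφ]

/-- The inserted cochain has values in h, and P first projects its arguments to g, so each summand
is 0. -/
theorem circle_embed {p q : ℕ} (P : Cochain K p g h) (Q : Cochain K q g h) :
    circle (g × h) p q (Cochain.map (LinearMap.fst K g h) (LinearMap.inr K g h) p P)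
      (Cochain.map (LinearMap.fst K g h) (LinearMap.inr K g h) q Q) = 0 := by
  refine Subtype.ext (MultilinearMap.ext fun X => LinearMap.ext fun x => ?_)
  refine (preCircle_apply _ _ X x).trans ?_
  simp only [Cochain.map_apply]
  rw [Finset.sum_eq_zero, zero_add, Finset.sum_eq_zero, smul_zero]
  · rfl
  · intro σ _
    simp
  · intro k _
    rw [Finset.sum_eq_zero, smul_zero]
    intro σ _
    rw [P.1.map_coord_zero k, LinearMap.zero_apply, map_zero, smul_zero]
    rw [Function.update_self]
    exact map_wedgeDerivation_eq_zero _ _ (fun y => by simp [Cochain.map_apply]) _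

theorem bracket_embed_embed (P Q : CochainSum K g h) :
    bracket (g × h) (embed K g h P) (embed K g h Q) = 0 := by
  induction P using cochainSum_induction with
  | h0 => simp
  | hadd f f' hf hf' => rw [map_add, map_add, LinearMap.add_apply, hf, hf', add_zero]
  | h p P =>
    induction Q using cochainSum_induction with
    | h0 => simp
    | hadd f f' hf hf' => rw [map_add, map_add, hf, hf', add_zero]
    | h q Q =>
      rw [embed_lof, embed_lof, bracket_lof, circle_embed, circle_embed, map_zero, map_zero,
        smul_zero, sub_zero]

/-- A cochain on `g ⊕ h` preserves `g` if its values on arguments in `g` lie in `g`. -/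
def PreservesFst {n : ℕ} (P : PreCochain K n (g × h) (g × h)) : Prop :=
  ∀ (X : Fin n → ⋀[K]^2 g) (x : g),
    (P (fun i => exteriorPower.map 2 (LinearMap.inl K g h) (X i)) (x, 0)).2 = 0

theorem map_restrict_eq_zero_iff {n : ℕ} (P : Cochain K n (g × h) (g × h)) :
    Cochain.map (LinearMap.inl K g h) (LinearMap.snd K g h) n P = 0 ↔ PreservesFst P.1 := by
  constructor
  · intro h0 X x
    have := congrArg (fun f : Cochain K n g h => f.1 X x) h0
    exact this
  · intro hP
    exact Subtype.ext (MultilinearMap.ext fun X => LinearMap.ext fun x => hP X x)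

/-- On arguments in g, Q induces an endomorphism of g, so the arguments passed on to P come again
from g and from ∧²g. -/
theorem PreservesFst.preCircle {p q : ℕ} {P : PreCochain K p (g × h) (g × h)}
    {Q : PreCochain K q (g × h) (g × h)} (hP : PreservesFst P) (hQ : PreservesFst Q) :
    PreservesFst (preCircle P Q) := by
  intro X x
  have hQ' : ∀ (Y : Fin q → ⋀[K]^2 g) (y : g),
      Q (fun i => exteriorPower.map 2 (LinearMap.inl K g h) (Y i)) (y, 0) =
        ((Q (fun i => exteriorPower.map 2 (LinearMap.inl K g h) (Y i)) (y, 0)).1, 0) :=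
    fun Y y => Prod.ext rfl (hQ Y y)
  rw [preCircle_apply, ← LinearMap.snd_apply (R := K), map_add, map_sum, map_zsmul, map_sum,
    Finset.sum_eq_zero, zero_add, Finset.sum_eq_zero, smul_zero]
  · intro σ _
    rw [Units.smul_def, map_zsmul, hQ', LinearMap.snd_apply, hP, smul_zero]
  · intro k _
    rw [map_zsmul, map_sum, Finset.sum_eq_zero, smul_zero]
    intro σ _
    rw [Units.smul_def, map_zsmul, LinearMap.snd_apply]
    set Y : Fin q → ⋀[K]^2 g := fun j => X (slotEquiv k.isLt.le σ (Sum.inl j)) with hY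
    set φ := Q (fun j => exteriorPower.map 2 (LinearMap.inl K g h) (Y j)) with hφ
    -- The middle map is the endomorphism of g induced by φ, which the inclusion of g intertwines
    -- with φ.
    have hw := wedgeDerivation_map (LinearMap.inl K g h)
      (LinearMap.fst K g h ∘ₗ φ ∘ₗ LinearMap.inl K g h) φ
      (fun y => (hQ' Y y).symm) (X (slotEquiv k.isLt.le σ (Sum.inr k)))
    rw [hw]
    have e : Function.update (fun i : Fin p => exteriorPower.map 2 (LinearMap.inl K g h)
          (X (slotEquiv k.isLt.le σ (Sum.inr i)))) k
        (exteriorPower.map 2 (LinearMap.inl K g h) (wedgeDerivation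
          (LinearMap.fst K g h ∘ₗ φ ∘ₗ LinearMap.inl K g h)
          (X (slotEquiv k.isLt.le σ (Sum.inr k))))) =
        fun i => exteriorPower.map 2 (LinearMap.inl K g h)
          (Function.update (fun i : Fin p => X (slotEquiv k.isLt.le σ (Sum.inr i))) k
            (wedgeDerivation (LinearMap.fst K g h ∘ₗ φ ∘ₗ LinearMap.inl K g h)
              (X (slotEquiv k.isLt.le σ (Sum.inr k)))) i) := by
      funext i
      by_cases hi : i = k
      · subst hi
        simp
      · simp [hi]
    rw [e, hP, smul_zero]

theorem restrict_bracket_eq_zero {a b : CochainSum K (g × h) (g × h)}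
    (ha : restrict K g h a = 0) (hb : restrict K g h b = 0) :
    restrict K g h (bracket (g × h) a b) = 0 := by
  classical
  have key : ∀ {x : CochainSum K (g × h) (g × h)}, restrict K g h x = 0 →
      ∀ n, PreservesFst (x n).1 := fun {x} hx n =>
    (map_restrict_eq_zero_iff _).1 (congrArg (fun f : CochainSum K g h => f n) hx)
  have hlof : ∀ p q, restrict K g h
      (bracket (g × h) (DirectSum.lof K ℕ (fun n => Cochain K n (g × h) (g × h)) p (a p))
        (DirectSum.lof K ℕ (fun n => Cochain K n (g × h) (g × h)) q (b q))) = 0 := by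
    intro p q
    rw [bracket_lof, map_sub, map_zsmul, restrict_lof, restrict_lof,
      (map_restrict_eq_zero_iff _).2 ((key ha p).preCircle (key hb q)),
      (map_restrict_eq_zero_iff _).2 ((key hb q).preCircle (key ha p)), map_zero, map_zero,
      smul_zero, sub_zero]
  rw [← DirectSum.sum_support_of a, ← DirectSum.sum_support_of b]
  simp only [map_sum, LinearMap.sum_apply]
  exact Finset.sum_eq_zero fun p _ => Finset.sum_eq_zero fun q _ => hlof q p

theorem isGradedLieSubalgebra_range_embed :
    IsGradedLieSubalgebra (grading K (g × h) (g × h)) (bracket (g × h))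
      (LinearMap.range (embed K g h)) where
  graded := by
    refine eq_iSup_inf_grading _ ?_
    rintro _ ⟨P, rfl⟩ n
    exact ⟨DirectSum.lof K ℕ (fun n => Cochain K n g h) n (P n), embed_lof n (P n)⟩
  closed := by
    rintro _ ⟨P, rfl⟩ _ ⟨Q, rfl⟩
    rw [bracket_embed_embed]
    exact zero_mem _

theorem isGradedLieSubalgebra_ker_projection :
    IsGradedLieSubalgebra (grading K (g × h) (g × h)) (bracket (g × h))
      (LinearMap.ker (projection K g h)) where
  graded := by
    refine eq_iSup_inf_grading _ fun x hx n => ?_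
    rw [mem_ker_projection] at hx ⊢
    rw [restrict_lof]
    exact (congrArg _ (congrArg (fun f : CochainSum K g h => f n) hx)).trans (map_zero _)
  closed a ha b hb := by
    rw [mem_ker_projection] at ha hb ⊢
    exact restrict_bracket_eq_zero ha hb

theorem preservesFst_semidirect (π : g [⋀^Fin 3]→ₗ[K] g) (ρ : g [⋀^Fin 2]→ₗ[K] Module.End K h)
    (μ : h [⋀^Fin 3]→ₗ[K] h) : PreservesFst (ofAlternating (semidirect π ρ μ)).1 := by
  intro X x
  change (wedgeCurry (semidirect π ρ μ)
    (exteriorPower.map 2 (LinearMap.inl K g h) (X 0)) (x, 0)).2 = 0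
  generalize X 0 = w
  induction w using wedge_induction with
  | h0 => simp
  | hadd a b ha hb => rw [map_add, map_add, LinearMap.add_apply, Prod.snd_add, ha, hb, add_zero]
  | hsmul c a ha => rw [map_smul, map_smul, LinearMap.smul_apply, Prod.smul_snd, ha, smul_zero]
  | h y z =>
    have e : (LinearMap.inl K g h ∘ ![y, z]) = ![((y, 0) : g × h), (z, 0)] := by
      ext i <;> fin_cases i <;> rfl
    rw [exteriorPower.map_apply_ιMulti, e, wedgeCurry_apply, semidirect_apply]
    have : μ ![0, 0, 0] = 0 := μ.map_coord_zero 0 rfl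
    simp [this]

theorem isVData_delta {π : g [⋀^Fin 3]→ₗ[K] g} {μ : h [⋀^Fin 3]→ₗ[K] h}
    {ρ : g [⋀^Fin 2]→ₗ[K] Module.End K h} (hπ : IsThreeLieBracket π) (hμ : IsThreeLieBracket μ)
    (hρ : IsAction π μ ρ) :
    IsVData (grading K (g × h) (g × h)) (bracket (g × h)) (LinearMap.range (embed K g h))
      (projection K g h) (delta π ρ μ) where
  lie := isGradedLieAlgebra_bracket K (g × h)
  subalgebra := isGradedLieSubalgebra_range_embed
  abelian := by
    rintro _ ⟨P, rfl⟩ _ ⟨Q, rfl⟩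
    exact bracket_embed_embed P Q
  idempotent := LinearMap.ext fun x => projection_embed _
  range_eq := range_projection
  ker_subalgebra := isGradedLieSubalgebra_ker_projection
  mem_ker := by
    rw [mem_ker_projection, delta, restrict_lof,
      (map_restrict_eq_zero_iff _).2 (preservesFst_semidirect π ρ μ), map_zero]
  mem_degree_one := lof_mem_grading 1 _
  square_zero := bracket_ofAlternating_self (isThreeLieBracket_semidirect hπ hμ hρ)

end Projection

/-! ### The L_∞-algebra of the derived brackets -/

section LInfty

variable {K g h : Type*} [Field K] [AddCommGroup g] [Module K g] [AddCommGroup h] [Module K h]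

theorem iteratedBracket_eq_iterBracket {A : Type*} [AddCommGroup A] [Module K A]
    (br : A →ₗ[K] A →ₗ[K] A) (Δ : A) (n : ℕ) (a : Fin n → A) (z : ℕ → ℤ × A)
    (hz : ∀ i : Fin n, (z i).2 = a i) :
    iteratedBracket br Δ n a = iterBracket br Δ (seqList z n) := by
  induction n with
  | zero => rfl
  | succ n ih =>
    rw [iteratedBracket_succ, seqList, iterBracket, ih _ fun i => hz i.castSucc,
      ← hz (Fin.last n), Fin.val_last]

/-- The sequence of degrees and extended cochains of a finite family. -/
noncomputable def embedSeq {n : ℕ} (d : Fin n → ℤ) (x : Fin n → CochainSum K g h) (i : ℕ) :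
    ℤ × CochainSum K (g × h) (g × h) :=
  if hi : i < n then (d ⟨i, hi⟩, embed K g h (x ⟨i, hi⟩)) else (0, 0)

theorem embedSeq_fin {n : ℕ} (d : Fin n → ℤ) (x : Fin n → CochainSum K g h) (i : Fin n) :
    embedSeq d x i = (d i, embed K g h (x i)) := by
  simp [embedSeq]

theorem derivedBracket_eq (π : g [⋀^Fin 3]→ₗ[K] g) (ρ : g [⋀^Fin 2]→ₗ[K] Module.End K h)
    (μ : h [⋀^Fin 3]→ₗ[K] h) (n : ℕ) (x : Fin n → CochainSum K g h)
    (z : ℕ → ℤ × CochainSum K (g × h) (g × h)) (hz : ∀ i : Fin n, (z i).2 = embed K g h (x i)) :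
    derivedBracket π ρ μ n x =
      restrict K g h (iterBracket (bracket (g × h)) (delta π ρ μ) (seqList z n)) :=
  congrArg (restrict K g h) (iteratedBracket_eq_iterBracket _ _ n _ z hz)

variable [CharZero K] {π : g [⋀^Fin 3]→ₗ[K] g} {μ : h [⋀^Fin 3]→ₗ[K] h}
  {ρ : g [⋀^Fin 2]→ₗ[K] Module.End K h}

theorem isLInftyAlgebra_derivedBracket
    (hV : IsVData (grading K (g × h) (g × h)) (bracket (g × h)) (LinearMap.range (embed K g h))
      (projection K g h) (delta π ρ μ)) :
    IsLInftyAlgebra (grading K g h) (derivedBracket π ρ μ) := by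
  have hmem : ∀ {n : ℕ} (d : Fin n → ℤ) (x : Fin n → CochainSum K g h),
      (∀ i, x i ∈ grading K g h (d i)) → ∀ i < n,
      (embedSeq d x i).2 ∈ grading K (g × h) (g × h) (embedSeq d x i).1 := by
    intro n d x hx i hi
    rw [embedSeq, dif_pos hi]
    exact embed_mem_grading (hx _)
  have hmemF : ∀ {n : ℕ} (d : Fin n → ℤ) (x : Fin n → CochainSum K g h), ∀ i < n,
      (embedSeq d x i).2 ∈ LinearMap.range (embed K g h) := by
    intro n d x i hi
    rw [embedSeq, dif_pos hi]
    exact ⟨_, rfl⟩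
  refine ⟨grading_internal K g h, ?_, ?_, ?_⟩
  · intro n _ d x hx
    rw [derivedBracket_eq π ρ μ n x (embedSeq d x) fun i => by rw [embedSeq_fin]]
    have := iterBracket_mem hV.lie hV.mem_degree_one (seqList (embedSeq d x) n) fun a ha => by
      obtain ⟨i, hi, rfl⟩ := mem_seqList ha
      exact hmem d x hx i hi
    rw [totalDegree_seqList, Finset.sum_range, add_comm] at this
    simp only [embedSeq_fin] at this
    exact restrict_mem_grading this
  · intro n _ d x hx σ
    rw [derivedBracket_eq π ρ μ n x (embedSeq d x) fun i => by rw [embedSeq_fin],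
      derivedBracket_eq π ρ μ n _ (fun i => embedSeq d x (extendNat σ i)) fun i => by
        simp only [extendNat, Fin.is_lt, dif_pos, embedSeq_fin],
      hV.iterBracket_perm n _ (hmem d x hx) (hmemF d x), Units.smul_def, map_zsmul,
      ← Units.smul_def]
    congr 1
    unfold koszulNat
    simp only [embedSeq_fin]
  · intro n _ d x hx
    set z := embedSeq d x with hz
    have h0 := hV.splitSum_eq_zero (fun k y hy => embed_mem_grading (restrict_mem_grading hy))
      (seqList z n)
      (fun a ha => by
        obtain ⟨i, hi, rfl⟩ := mem_seqList ha
        exact hmem d x hx i hi)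
      (fun a ha => by
        obtain ⟨i, hi, rfl⟩ := mem_seqList ha
        exact hmemF d x i hi)
    have hΔ : projection K g h (delta π ρ μ) = 0 := hV.mem_ker
    rw [← sum_unshuffles_eq_splitSum, Finset.sum_range_succ', Finset.sum_range] at h0
    -- The sum over splittings also contains an empty inner part, absent from the Jacobi identity.
    -- Its inner bracket is 𝒫Δ = 0, so the block sizes may start at 1, whence the shift to i + 1.
    have hzero : ∀ L k, projection K g h (iterBracket (bracket (g × h)) (delta π ρ μ)
        (L ++ [(k, projection K g h (iterBracket (bracket (g × h)) (delta π ρ μ) []))])) = 0 := by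
      intro L k
      rw [iterBracket_concat]
      change projection K g h (iterBracket _ (bracket (g × h) _ (projection K g h _)) L) = 0
      rw [show iterBracket (bracket (g × h)) (delta π ρ μ) [] = delta π ρ μ from rfl, hΔ, map_zero,
        iterBracket_zero, map_zero]
    simp only [seqList, hzero, smul_zero, Finset.sum_const_zero, add_zero] at h0
    apply embed_injective
    rw [map_zero, ← h0, map_sum]
    refine Finset.sum_congr rfl fun i _ => ?_
    rw [map_sum]
    refine Finset.sum_congr rfl fun σ _ => ?_
    rw [Units.smul_def, map_zsmul, ← Units.smul_def]
    congr 1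
    · unfold koszulNat
      simp only [hz, embedSeq_fin]
    · set f := seqList (fun j => z (extendNat σ j)) (i + 1) with hf
      have hl : derivedBracket π ρ μ (i + 1) (fun s : Fin (i + 1) => x (σ ⟨s, by omega⟩)) =
          restrict K g h (iterBracket (bracket (g × h)) (delta π ρ μ) f) := by
        refine derivedBracket_eq π ρ μ _ _ _ fun s => ?_
        simp only [hz, extendNat]
        rw [dif_pos (by omega), embedSeq_fin]
      -- The outer arguments as a sequence: the inner bracket in slot 0, then the second block of
      -- the unshuffle. As a list this puts the inner bracket at the end, as in
      -- `IsVData.splitSum_eq_zero`.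
      rw [derivedBracket_eq π ρ μ (n - i) _ (insertSeq 0
        (1 + totalDegree f, projection K g h (iterBracket (bracket (g × h)) (delta π ρ μ) f))
        (fun j => z (extendNat σ (i + 1 + j))))]
      · rw [show n - (i : ℕ) = n - (i + 1) + 1 by omega, seqList_insert_zero]
        rfl
      · intro r
        by_cases hr : (r : ℕ) = 0
        · rw [if_pos hr, hr, hl]
          rfl
        · rw [if_neg hr, insertSeq, if_neg (by omega), if_neg hr, extendNat, dif_pos (by omega), hz,
            embedSeq_fin]
          have e : (i : ℕ) + 1 + (r - 1) = i + r := by omega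
          simp only [e]

end LInfty

/-! ### The bracket with an endomorphism -/

section EndomorphismBracket

variable {K V : Type*} [Field K] [AddCommGroup V] [Module K V]

/-- An endomorphism as a cochain of degree `0`. -/
noncomputable def endCochain (φ : Module.End K V) : Cochain K 0 V V :=
  ⟨MultilinearMap.constOfIsEmpty K _ φ, fun i => i.elim0⟩

/-- An endomorphism as an element of degree `0` of `C^*(V, V)`. -/
noncomputable def ofEnd (φ : Module.End K V) : CochainSum K V V :=
  DirectSum.lof K ℕ (fun n => Cochain K n V V) 0 (endCochain φ)

theorem ofEnd_mem_grading (φ : Module.End K V) : ofEnd φ ∈ grading K V V 0 :=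
  lof_mem_grading 0 _

theorem onSeq_lof {m : ℕ} (P : Cochain K m V V) (n : ℕ) (s : ℕ → ⋀[K]^2 V) :
    onSeq (DirectSum.lof K ℕ (fun n => Cochain K n V V) m P n).1 s =
      if m = n then onSeq P.1 s else 0 := by
  split_ifs with h
  · subst h
    rw [DirectSum.lof_apply]
  · rw [DirectSum.lof_eq_of, DirectSum.of_eq_of_ne _ _ _ (Ne.symm h)]
    rfl

theorem onSeq_end_preCircle (φ : Module.End K V) {n : ℕ} (P : PreCochain K n V V)
    (s : ℕ → ⋀[K]^2 V) :
    onSeq (preCircle (endCochain φ).1 P) s = φ ∘ₗ onSeq P s := by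
  induction n generalizing s with
  | zero => exact onSeq_preCircle_zero_zero _ P s
  | succ n ih =>
    rw [onSeq_preCircle_zero_succ, ih, onSeq_curryLeft]
    congr 2
    funext i
    cases i <;> rfl

/-- P∘φ is the sum over all arguments of P with φ applied to one of them, so on eigenvectors the
eigenvalues add up. -/
theorem onSeq_preCircle_end (φ : Module.End K V) {n : ℕ} (P : PreCochain K n V V)
    (s : ℕ → ⋀[K]^2 V) (m : ℕ → K) (hs : ∀ i < n, wedgeDerivation φ (s i) = m i • s i) (x : V)
    (c : K) (hx : φ x = c • x) :
    onSeq (preCircle P (endCochain φ).1) s x =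
      (∑ i ∈ Finset.range n, m i + c) • onSeq P s x := by
  induction n generalizing s m with
  | zero =>
    rw [onSeq_preCircle_zero_zero, LinearMap.comp_apply]
    change onSeq P s (φ x) = _
    rw [hx, map_smul, Finset.sum_range_zero, zero_add]
  | succ n ih =>
    have e : (fun i => Nat.casesOn i (s 0) fun i => s (i + 1) : ℕ → ⋀[K]^2 V) = s := by
      funext i
      cases i <;> rfl
    rw [onSeq_preCircle_succ_zero, LinearMap.add_apply,
      ih _ (fun i => s (i + 1)) (fun i => m (i + 1)) fun i hi => hs (i + 1) (by omega)]
    change _ + onSeq (P.curryLeft (wedgeDerivation φ (s 0))) _ x = _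
    have e2 : onSeq (m 0 • P.curryLeft (s 0)) (fun i => s (i + 1)) =
      m 0 • onSeq (P.curryLeft (s 0)) (fun i => s (i + 1)) := rfl
    rw [hs 0 (by omega), map_smul, e2, LinearMap.smul_apply, ← add_smul, onSeq_curryLeft, e,
      Finset.sum_range_succ']
    congr 1
    ring

theorem onSeq_bracket_ofEnd (φ : Module.End K V) (a : CochainSum K V V) (n : ℕ)
    (s : ℕ → ⋀[K]^2 V) (m : ℕ → K) (hs : ∀ i < n, wedgeDerivation φ (s i) = m i • s i) (x : V)
    (c : K) (hx : φ x = c • x) :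
    onSeq (bracket V (ofEnd φ) a n).1 s x =
      φ (onSeq (a n).1 s x) - (∑ i ∈ Finset.range n, m i + c) • onSeq (a n).1 s x := by
  induction a using cochainSum_induction with
  | h0 =>
    rw [map_zero]
    change (0 : V) = φ 0 - _ • (0 : V)
    rw [map_zero, smul_zero, sub_zero]
  | hadd f f' hf hf' =>
    rw [map_add]
    change onSeq (bracket V (ofEnd φ) f n).1 s x + onSeq (bracket V (ofEnd φ) f' n).1 s x =
      φ (onSeq (f n).1 s x + onSeq (f' n).1 s x) -
        _ • (onSeq (f n).1 s x + onSeq (f' n).1 s x)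
    rw [hf, hf', map_add, smul_add]
    abel
  | h k P =>
    rw [ofEnd, bracket_lof, zero_mul, pow_zero, one_smul]
    change onSeq (DirectSum.lof K ℕ (fun n => Cochain K n V V) (0 + k) _ n).1 s x -
      onSeq (DirectSum.lof K ℕ (fun n => Cochain K n V V) (k + 0) _ n).1 s x = _
    rw [onSeq_lof, onSeq_lof, onSeq_lof]
    by_cases hk : k = n
    · subst hk
      rw [if_pos (by omega), if_pos (by omega), if_pos rfl]
      change onSeq (preCircle _ P.1) s x - onSeq (preCircle P.1 _) s x = _
      rw [onSeq_end_preCircle, onSeq_preCircle_end φ P.1 s m hs x c hx]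
      rfl
    · rw [if_neg (by omega), if_neg (by omega), if_neg hk]
      simp

theorem bracket_ofEnd_bracket (φ : Module.End K V) (a b : CochainSum K V V) :
    bracket V (ofEnd φ) (bracket V a b) =
      bracket V (bracket V (ofEnd φ) a) b + bracket V a (bracket V (ofEnd φ) b) := by
  induction a using cochainSum_induction with
  | h0 => simp
  | hadd f f' hf hf' => simp only [map_add, LinearMap.add_apply, hf, hf']; abel
  | h p P =>
    induction b using cochainSum_induction with
    | h0 => simp
    | hadd f f' hf hf' => simp only [map_add, hf, hf']; abel
    | h q Q =>
      have := bracket_jacobi (p := 0) (ofEnd_mem_grading φ) (lof_mem_grading p P)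
        (lof_mem_grading q Q)
      rw [this, zero_mul, pow_zero, one_smul]

end EndomorphismBracket

/-! ### Weights: eigenvalues of the bracket with the projection onto h -/

section Weights

variable (K g h : Type*) [Field K] [AddCommGroup g] [Module K g] [AddCommGroup h] [Module K h]

/-- The projection of `g ⊕ h` onto `h`. -/
def sndEnd : Module.End K (g × h) := LinearMap.inr K g h ∘ₗ LinearMap.snd K g h

variable {K g h}

/-- An element has weight `k` if it is an eigenvector of the bracket with the projection onto `h`
for the eigenvalue `k`. -/
def HasWeight (k : ℤ) (a : CochainSum K (g × h) (g × h)) : Prop :=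
  bracket (g × h) (ofEnd (sndEnd K g h)) a = (k : K) • a

/-- The endomorphism has degree 0, so its bracket is a derivation without signs and eigenvalues add.
-/
theorem HasWeight.lie {k l : ℤ} {a b : CochainSum K (g × h) (g × h)} (ha : HasWeight k a)
    (hb : HasWeight l b) : HasWeight (k + l) (bracket (g × h) a b) := by
  unfold HasWeight at *
  rw [bracket_ofEnd_bracket, ha, hb, map_smul, map_smul, LinearMap.smul_apply, ← add_smul]
  push_cast
  rfl

/-- A vector of `g ⊕ h` is pure of weight `0` if it lies in `g`, and of weight `1` if it lies in
`h`. -/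
def IsPure (m : ℕ) (v : g × h) : Prop := (m = 0 ∧ v.2 = 0) ∨ (m = 1 ∧ v.1 = 0)

/-- The wedge product of two pure vectors. -/
def IsPureWedge (m : ℕ) (w : ⋀[K]^2 (g × h)) : Prop :=
  ∃ m₁ m₂ v₁ v₂, IsPure m₁ v₁ ∧ IsPure m₂ v₂ ∧ m = m₁ + m₂ ∧
    w = exteriorPower.ιMulti K 2 ![v₁, v₂]

theorem IsPure.sndEnd_apply {m : ℕ} {v : g × h} (hv : IsPure m v) :
    sndEnd K g h v = (m : K) • v := by
  rcases hv with ⟨rfl, hv⟩ | ⟨rfl, hv⟩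
  · simp [sndEnd, hv]
  · obtain ⟨a, b⟩ := v
    simp only at hv
    simp [sndEnd, hv]

theorem IsPureWedge.wedgeDerivation_apply {m : ℕ} {w : ⋀[K]^2 (g × h)} (hw : IsPureWedge m w) :
    wedgeDerivation (sndEnd K g h) w = (m : K) • w := by
  obtain ⟨m₁, m₂, v₁, v₂, h₁, h₂, rfl, rfl⟩ := hw
  rw [ThreeLie.wedgeDerivation_apply, h₁.sndEnd_apply, h₂.sndEnd_apply, alt₂_smul_left,
    alt₂_smul_right, ← add_smul, Nat.cast_add]

theorem IsPure.inl_fst {v : g × h} (hv : IsPure 0 v) : (v.1, (0 : h)) = v := by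
  rcases hv with ⟨_, hv⟩ | ⟨h1, _⟩
  · exact Prod.ext rfl hv.symm
  · omega

theorem IsPure.fst_eq_zero {m : ℕ} {v : g × h} (hv : IsPure m v) (hm : m ≠ 0) : v.1 = 0 := by
  rcases hv with ⟨h0, _⟩ | ⟨_, hv⟩
  · exact absurd h0 hm
  · exact hv

theorem IsPureWedge.map_inl_fst {w : ⋀[K]^2 (g × h)} (hw : IsPureWedge 0 w) :
    exteriorPower.map 2 (LinearMap.inl K g h) (exteriorPower.map 2 (LinearMap.fst K g h) w) =
      w := by
  obtain ⟨m₁, m₂, v₁, v₂, h₁, h₂, hm, rfl⟩ := hw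
  obtain rfl : m₁ = 0 := by omega
  obtain rfl : m₂ = 0 := by omega
  rw [exteriorPower.map_apply_ιMulti, exteriorPower.map_apply_ιMulti]
  congr 1
  funext i
  fin_cases i
  · exact h₁.inl_fst
  · exact h₂.inl_fst

theorem IsPureWedge.map_fst_eq_zero {m : ℕ} {w : ⋀[K]^2 (g × h)} (hw : IsPureWedge m w)
    (hm : m ≠ 0) : exteriorPower.map 2 (LinearMap.fst K g h) w = 0 := by
  obtain ⟨m₁, m₂, v₁, v₂, h₁, h₂, rfl, rfl⟩ := hw
  rw [exteriorPower.map_apply_ιMulti]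
  by_cases h1 : m₁ = 0
  · exact AlternatingMap.map_coord_zero _ (1 : Fin 2) (h₂.fst_eq_zero (by omega))
  · exact AlternatingMap.map_coord_zero _ (0 : Fin 2) (h₁.fst_eq_zero h1)

/-- Each vector is the sum of a vector in g and a vector in h, and wedges of pure vectors span ∧²(g
⊕ h). Weights can therefore be tested on pure arguments. -/
theorem preCochain_ext_pure {n : ℕ} (f : PreCochain K n (g × h) (g × h))
    (hf : ∀ (s : ℕ → ⋀[K]^2 (g × h)) (m : ℕ → ℕ) (x : g × h) (c : ℕ),
      (∀ i < n, IsPureWedge (m i) (s i)) → IsPure c x → onSeq f s x = 0) : f = 0 := by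
  induction n with
  | zero =>
    refine onSeq_ext fun s => LinearMap.ext fun x => ?_
    have e : x = (x.1, 0) + (0, x.2) := by simp
    rw [e, map_add, hf s (fun _ => 0) _ 0 (by omega) (Or.inl ⟨rfl, rfl⟩),
      hf s (fun _ => 0) _ 1 (by omega) (Or.inr ⟨rfl, rfl⟩), add_zero]
    rfl
  | succ n ih =>
    have hp : ∀ (k : ℕ) (w : ⋀[K]^2 (g × h)), IsPureWedge k w → f.curryLeft w = 0 := by
      intro k w hw
      refine ih _ fun s m x c hs hx => ?_
      rw [onSeq_curryLeft]
      refine hf _ (fun i => Nat.casesOn i k m) x c (fun i hi => ?_) hx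
      rcases i with _ | i
      · exact hw
      · exact hs i (by omega)
    have hall : ∀ w, f.curryLeft w = 0 := by
      intro w
      induction w using wedge_induction with
      | h0 => simp
      | hadd a b ha hb => rw [map_add, ha, hb, add_zero]
      | hsmul c a ha => rw [map_smul, ha, smul_zero]
      | h x y =>
        have ex : x = (x.1, 0) + (0, x.2) := by simp
        have ey : y = (y.1, 0) + (0, y.2) := by simp
        have p0 : ∀ a : g, IsPure 0 ((a, 0) : g × h) := fun a => Or.inl ⟨rfl, rfl⟩
        have p1 : ∀ b : h, IsPure 1 ((0, b) : g × h) := fun b => Or.inr ⟨rfl, rfl⟩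
        rw [ex, ey, alt₂_add_left, alt₂_add_right, alt₂_add_right, map_add, map_add, map_add,
          hp 0 _ ⟨0, 0, _, _, p0 _, p0 _, rfl, rfl⟩, hp 1 _ ⟨0, 1, _, _, p0 _, p1 _, rfl, rfl⟩,
          hp 1 _ ⟨1, 0, _, _, p1 _, p0 _, rfl, rfl⟩, hp 2 _ ⟨1, 1, _, _, p1 _, p1 _, rfl, rfl⟩]
        simp
    ext1 X
    rw [← Fin.cons_self_tail X, ← MultilinearMap.curryLeft_apply, hall]
    rfl

theorem cochainSum_ext_pure {a b : CochainSum K (g × h) (g × h)}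
    (hab : ∀ (n : ℕ) (s : ℕ → ⋀[K]^2 (g × h)) (m : ℕ → ℕ) (x : g × h) (c : ℕ),
      (∀ i < n, IsPureWedge (m i) (s i)) → IsPure c x → onSeq (a n).1 s x = onSeq (b n).1 s x) :
    a = b := by
  refine DFinsupp.ext fun n => Subtype.ext ?_
  rw [← sub_eq_zero]
  refine preCochain_ext_pure _ fun s m x c hs hx => ?_
  change onSeq (a n).1 s x - onSeq (b n).1 s x = 0
  rw [hab n s m x c hs hx, sub_self]

/-- With T arguments in h, the component of the value in h is multiplied by 1 - T and that in g by
-T. -/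
theorem onSeq_bracket_sndEnd (a : CochainSum K (g × h) (g × h)) (n : ℕ)
    (s : ℕ → ⋀[K]^2 (g × h)) (m : ℕ → ℕ) (x : g × h) (c : ℕ)
    (hs : ∀ i < n, IsPureWedge (m i) (s i)) (hx : IsPure c x) :
    onSeq (bracket (g × h) (ofEnd (sndEnd K g h)) a n).1 s x =
      sndEnd K g h (onSeq (a n).1 s x) -
        ((∑ i ∈ Finset.range n, m i + c : ℕ) : K) • onSeq (a n).1 s x := by
  rw [onSeq_bracket_ofEnd _ a n s (fun i => (m i : K)) (fun i hi => (hs i hi).wedgeDerivation_apply)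
    x c hx.sndEnd_apply]
  push_cast
  rfl

theorem onSeq_projection (a : CochainSum K (g × h) (g × h)) (n : ℕ) (s : ℕ → ⋀[K]^2 (g × h))
    (x : g × h) :
    onSeq (projection K g h a n).1 s x =
      (0, (onSeq (a n).1 (fun i => exteriorPower.map 2 (LinearMap.inl K g h)
        (exteriorPower.map 2 (LinearMap.fst K g h) (s i))) (x.1, 0)).2) := rfl

theorem onSeq_embed (P : CochainSum K g h) (n : ℕ) (s : ℕ → ⋀[K]^2 (g × h)) (x : g × h) :
    onSeq (embed K g h P n).1 s x =
      (0, (P n).1 (fun i : Fin n => exteriorPower.map 2 (LinearMap.fst K g h) (s i)) x.1) := rfl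

theorem onSeq_embed_eq_zero (P : CochainSum K g h) (n : ℕ) (s : ℕ → ⋀[K]^2 (g × h)) (m : ℕ → ℕ)
    (x : g × h) (c : ℕ) (hs : ∀ i < n, IsPureWedge (m i) (s i)) (hx : IsPure c x)
    (hT : ∑ i ∈ Finset.range n, m i + c ≠ 0) : onSeq (embed K g h P n).1 s x = 0 := by
  rw [onSeq_embed]
  by_cases hc : c = 0
  · have : ∑ i ∈ Finset.range n, m i ≠ 0 := by omega
    obtain ⟨i, hi, hmi⟩ := Finset.exists_ne_zero_of_sum_ne_zero this
    rw [Finset.mem_range] at hi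
    rw [(P n).1.map_coord_zero ⟨i, hi⟩ ((hs i hi).map_fst_eq_zero hmi)]
    rfl
  · rw [hx.fst_eq_zero hc, map_zero]
    rfl

theorem hasWeight_embed (P : CochainSum K g h) : HasWeight 1 (embed K g h P) := by
  refine cochainSum_ext_pure fun n s m x c hs hx => ?_
  rw [onSeq_bracket_sndEnd _ n s m x c hs hx, Int.cast_one, one_smul]
  by_cases hT : ∑ i ∈ Finset.range n, m i + c = 0
  · rw [hT, Nat.cast_zero, zero_smul, sub_zero]
    rfl
  · rw [onSeq_embed_eq_zero P n s m x c hs hx hT, map_zero, smul_zero, sub_zero]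

/-- A nonzero value in g would need -T = k, impossible for k ≥ 1. A nonzero value in h needs 1 - T =
k, hence T = 0: only arguments in g and values in h remain, and there the projection is the
identity. For k ≥ 2 this says that a = 0. -/
theorem HasWeight.projection_eq_self [CharZero K] {k : ℤ} (hk : 1 ≤ k)
    {a : CochainSum K (g × h) (g × h)} (ha : HasWeight k a) : projection K g h a = a := by
  refine cochainSum_ext_pure fun n s m x c hs hx => ?_
  have hE := congrArg (fun f : CochainSum K (g × h) (g × h) => onSeq (f n).1 s x) ha
  simp only [onSeq_bracket_sndEnd a n s m x c hs hx] at hE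
  change _ = (k : K) • onSeq (a n).1 s x at hE
  have h1 : (onSeq (a n).1 s x).1 = 0 := by
    have := congrArg Prod.fst hE
    change (0 : g) - _ • (onSeq (a n).1 s x).1 = (k : K) • (onSeq (a n).1 s x).1 at this
    rw [sub_eq_iff_eq_add, ← add_smul, eq_comm, smul_eq_zero] at this
    refine this.resolve_left ?_
    rw [← Int.cast_natCast, ← Int.cast_add]
    exact Int.cast_ne_zero.2 (by omega)
  by_cases hT : ∑ i ∈ Finset.range n, m i + c = 0
  · rw [onSeq_projection]
    have hm : ∀ i < n, m i = 0 := fun i hi =>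
      (Finset.sum_eq_zero_iff.1 (by omega : ∑ i ∈ Finset.range n, m i = 0)) i
        (Finset.mem_range.2 hi)
    have hc : c = 0 := by omega
    subst hc
    have e : onSeq (a n).1 (fun i => exteriorPower.map 2 (LinearMap.inl K g h)
        (exteriorPower.map 2 (LinearMap.fst K g h) (s i))) = onSeq (a n).1 s := by
      refine congrArg (a n).1 (funext fun i => ?_)
      have := hs i i.isLt
      rw [hm i i.isLt] at this
      exact this.map_inl_fst
    rw [e, hx.inl_fst]
    exact Prod.ext h1.symm rfl
  · rw [projection_apply, onSeq_embed_eq_zero _ n s m x c hs hx hT]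
    refine Prod.ext h1.symm ?_
    have := congrArg Prod.snd hE
    change (onSeq (a n).1 s x).2 - _ • (onSeq (a n).1 s x).2 = (k : K) • (onSeq (a n).1 s x).2
      at this
    rw [sub_eq_iff_eq_add, ← add_smul] at this
    nth_rewrite 1 [← one_smul K (onSeq (a n).1 s x).2] at this
    rw [← sub_eq_zero, ← sub_smul, smul_eq_zero] at this
    refine (this.resolve_left ?_).symm
    rw [← Int.cast_natCast, ← Int.cast_add, ← Int.cast_one, ← Int.cast_sub]
    exact Int.cast_ne_zero.2 (by omega)

theorem bracket_sndEnd_inl (a : CochainSum K (g × h) (g × h)) (n : ℕ) (X : Fin n → ⋀[K]^2 g)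
    (x : g) :
    (bracket (g × h) (ofEnd (sndEnd K g h)) a n).1
        (fun i => exteriorPower.map 2 (LinearMap.inl K g h) (X i)) (x, 0) =
      (0, ((a n).1 (fun i => exteriorPower.map 2 (LinearMap.inl K g h) (X i)) (x, 0)).2) := by
  set s : ℕ → ⋀[K]^2 (g × h) := fun i =>
    if hi : i < n then exteriorPower.map 2 (LinearMap.inl K g h) (X ⟨i, hi⟩) else 0 with hs
  have e : ∀ f : PreCochain K n (g × h) (g × h),
      f (fun i => exteriorPower.map 2 (LinearMap.inl K g h) (X i)) = onSeq f s := by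
    intro f
    simp [onSeq, hs]
  rw [e, e, onSeq_bracket_ofEnd _ a n s (fun _ => 0) _ (x, 0) 0 (by simp [sndEnd])]
  · simp [sndEnd]
  · intro i hi
    rw [hs]
    simp only [hi, dif_pos]
    -- The projection onto h vanishes on g, so it restricts to the endomorphism 0 and all arguments
    -- have eigenvalue 0.
    rw [wedgeDerivation_map (LinearMap.inl K g h) 0 _ (by simp [sndEnd])]
    simp

/-- On arguments in g, where T = 0, values in h have weight 1; a different weight forces them to
vanish. -/
theorem HasWeight.restrict_eq_zero [CharZero K] {k : ℤ} (hk : k ≠ 1)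
    {a : CochainSum K (g × h) (g × h)} (ha : HasWeight k a) : restrict K g h a = 0 := by
  refine DFinsupp.ext fun n => (map_restrict_eq_zero_iff _).2 fun X x => ?_
  have hE := bracket_sndEnd_inl a n X x
  rw [ha] at hE
  have := congrArg Prod.snd hE
  change (k : K) • _ = _ at this
  rw [← sub_eq_zero] at this
  nth_rewrite 2 [← one_smul K (Prod.snd _)] at this
  rw [← sub_smul, smul_eq_zero] at this
  refine this.resolve_left ?_
  rw [← Int.cast_one, ← Int.cast_sub]
  exact Int.cast_ne_zero.2 (by omega)

/-- On arguments in g, values in g have weight 0. -/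
theorem HasWeight.fst_eq_zero [CharZero K] {k : ℤ} (hk : k ≠ 0)
    {a : CochainSum K (g × h) (g × h)} (ha : HasWeight k a) (n : ℕ) (X : Fin n → ⋀[K]^2 g)
    (x : g) : ((a n).1 (fun i => exteriorPower.map 2 (LinearMap.inl K g h) (X i)) (x, 0)).1 = 0 := by
  have hE := bracket_sndEnd_inl a n X x
  rw [ha] at hE
  have := congrArg Prod.fst hE
  change (k : K) • _ = 0 at this
  exact (smul_eq_zero.1 this).resolve_left (Int.cast_ne_zero.2 hk)

theorem HasWeight.iterate {k : ℤ} {a : CochainSum K (g × h) (g × h)} (ha : HasWeight k a)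
    (n : ℕ) (P : Fin n → CochainSum K g h) :
    HasWeight (k + n) (iteratedBracket (bracket (g × h)) a n fun i => embed K g h (P i)) := by
  induction n with
  | zero =>
    rw [Nat.cast_zero, add_zero]
    exact ha
  | succ n ih =>
    rw [iteratedBracket_succ]
    have := (ih fun i => P i.castSucc).lie (hasWeight_embed (P (Fin.last n)))
    rwa [add_assoc, ← Nat.cast_succ] at this

end Weights

/-! ### The weights of Δ and the vanishing brackets -/

section DeltaWeights

variable {K g h : Type*} [Field K] [AddCommGroup g] [Module K g] [AddCommGroup h] [Module K h]

/-- Δ itself is not homogeneous for the weight; π + ρ and μ are, of weights 0 and -2. -/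
theorem delta_eq_add (π : g [⋀^Fin 3]→ₗ[K] g) (ρ : g [⋀^Fin 2]→ₗ[K] Module.End K h)
    (μ : h [⋀^Fin 3]→ₗ[K] h) : delta π ρ μ = delta π ρ 0 + delta 0 0 μ := by
  have e : ofAlternating (semidirect π ρ μ) =
      ofAlternating (semidirect π ρ 0) + ofAlternating (semidirect 0 0 μ) := by
    refine Subtype.ext (MultilinearMap.ext fun X => ?_)
    change wedgeCurry _ (X 0) = wedgeCurry _ (X 0) + wedgeCurry _ (X 0)
    generalize X 0 = w
    induction w using wedge_induction with
    | h0 => simp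
    | hadd a b ha hb => simp only [map_add, ha, hb]; abel
    | hsmul c a ha => simp only [map_smul, ha, smul_add]
    | h x y =>
      refine LinearMap.ext fun z => ?_
      obtain ⟨x, u⟩ := x
      obtain ⟨y, v⟩ := y
      obtain ⟨z, w⟩ := z
      simp only [LinearMap.add_apply, wedgeCurry_apply, semidirect_apply]
      simp
  rw [delta, delta, delta, e, map_add]

theorem hasWeight_delta_of_pure (π : g [⋀^Fin 3]→ₗ[K] g) (ρ : g [⋀^Fin 2]→ₗ[K] Module.End K h)
    (μ : h [⋀^Fin 3]→ₗ[K] h) (k : ℤ)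
    (H : ∀ m₁ m₂ m₃ (v₁ v₂ v₃ : g × h), IsPure m₁ v₁ → IsPure m₂ v₂ → IsPure m₃ v₃ →
      sndEnd K g h (semidirect π ρ μ ![v₁, v₂, v₃]) -
        ((m₁ + m₂ + m₃ : ℕ) : K) • semidirect π ρ μ ![v₁, v₂, v₃] =
        (k : K) • semidirect π ρ μ ![v₁, v₂, v₃]) : HasWeight k (delta π ρ μ) := by
  refine cochainSum_ext_pure fun n s m x c hs hx => ?_
  rw [onSeq_bracket_sndEnd _ n s m x c hs hx]
  change _ = (k : K) • onSeq (delta π ρ μ n).1 s x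
  rw [delta, onSeq_lof]
  split_ifs with hn
  · subst hn
    obtain ⟨m₁, m₂, v₁, v₂, h₁, h₂, hm, hw⟩ := hs 0 (by omega)
    have e : onSeq (ofAlternating (semidirect π ρ μ)).1 s x = semidirect π ρ μ ![v₁, v₂, x] := by
      change wedgeCurry _ (s 0) x = _
      rw [hw, wedgeCurry_apply]
    rw [e, Finset.sum_range_one, hm]
    exact H m₁ m₂ c v₁ v₂ x h₁ h₂ hx
  · simp

/-- π has T = 0 and values in g; ρ has T = 1 and values in h. Both give weight 0. -/
theorem hasWeight_delta_zero (π : g [⋀^Fin 3]→ₗ[K] g) (ρ : g [⋀^Fin 2]→ₗ[K] Module.End K h) :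
    HasWeight 0 (delta π ρ (0 : h [⋀^Fin 3]→ₗ[K] h)) := by
  refine hasWeight_delta_of_pure _ _ _ _ ?_
  rintro m₁ m₂ m₃ ⟨x, u⟩ ⟨y, v⟩ ⟨z, w⟩ h₁ h₂ h₃
  rw [semidirect_apply]
  have z3 : ∀ a b c : g, (a = 0 ∨ b = 0 ∨ c = 0) → π ![a, b, c] = 0 := by
    rintro a b c (rfl | rfl | rfl)
    · exact π.map_coord_zero 0 rfl
    · exact π.map_coord_zero 1 rfl
    · exact π.map_coord_zero 2 rfl
  have z2 : ∀ a b : g, (a = 0 ∨ b = 0) → ρ ![a, b] = 0 := by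
    rintro a b (rfl | rfl)
    · exact ρ.map_coord_zero 0 rfl
    · exact ρ.map_coord_zero 1 rfl
  rcases h₁ with ⟨rfl, h₁⟩ | ⟨rfl, h₁⟩ <;> rcases h₂ with ⟨rfl, h₂⟩ | ⟨rfl, h₂⟩ <;>
    rcases h₃ with ⟨rfl, h₃⟩ | ⟨rfl, h₃⟩ <;> simp only at h₁ h₂ h₃ <;> subst h₁ h₂ h₃ <;>
    simp [sndEnd, z2, z3]

/-- μ has T = 3 and values in h, which gives 1 - 3 = -2. -/
theorem hasWeight_delta_neg_two (μ : h [⋀^Fin 3]→ₗ[K] h) :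
    HasWeight (-2) (delta (0 : g [⋀^Fin 3]→ₗ[K] g) 0 μ) := by
  refine hasWeight_delta_of_pure _ _ _ _ ?_
  rintro m₁ m₂ m₃ ⟨x, u⟩ ⟨y, v⟩ ⟨z, w⟩ h₁ h₂ h₃
  rw [semidirect_apply]
  have z3 : ∀ a b c : h, (a = 0 ∨ b = 0 ∨ c = 0) → μ ![a, b, c] = 0 := by
    rintro a b c (rfl | rfl | rfl)
    · exact μ.map_coord_zero 0 rfl
    · exact μ.map_coord_zero 1 rfl
    · exact μ.map_coord_zero 2 rfl
  rcases h₁ with ⟨rfl, h₁⟩ | ⟨rfl, h₁⟩ <;> rcases h₂ with ⟨rfl, h₂⟩ | ⟨rfl, h₂⟩ <;>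
    rcases h₃ with ⟨rfl, h₃⟩ | ⟨rfl, h₃⟩ <;> simp only at h₁ h₂ h₃ <;> subst h₁ h₂ h₃ <;>
    simp [sndEnd, z3]
  all_goals first | rfl | module

theorem iteratedBracket_add {A : Type*} [AddCommGroup A] [Module K A] (br : A →ₗ[K] A →ₗ[K] A)
    (x y : A) (n : ℕ) (a : Fin n → A) :
    iteratedBracket br (x + y) n a = iteratedBracket br x n a + iteratedBracket br y n a := by
  induction n with
  | zero => rfl
  | succ n ih => rw [iteratedBracket_succ, iteratedBracket_succ, iteratedBracket_succ, ih, map_add,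
      LinearMap.add_apply]

variable [CharZero K]

/-- The two parts have weights k and k - 2, and neither is 1. -/
theorem derivedBracket_eq_zero (π : g [⋀^Fin 3]→ₗ[K] g) (ρ : g [⋀^Fin 2]→ₗ[K] Module.End K h)
    (μ : h [⋀^Fin 3]→ₗ[K] h) {k : ℕ} (h1 : k ≠ 1) (h3 : k ≠ 3) : derivedBracket π ρ μ k = 0 := by
  refine MultilinearMap.ext fun P => ?_
  change restrict K g h (iteratedBracket (bracket (g × h)) (delta π ρ μ) k
    fun i => embed K g h (P i)) = 0
  rw [delta_eq_add, iteratedBracket_add, map_add,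
    ((hasWeight_delta_zero π ρ).iterate k P).restrict_eq_zero (by omega),
    ((hasWeight_delta_neg_two μ).iterate k P).restrict_eq_zero (by omega), add_zero]

/-- The two parts have weights 3 and 1, both at least 1, so the projection fixes them. -/
theorem embed_derivedBracket_three (π : g [⋀^Fin 3]→ₗ[K] g)
    (ρ : g [⋀^Fin 2]→ₗ[K] Module.End K h) (μ : h [⋀^Fin 3]→ₗ[K] h)
    (P : Fin 3 → CochainSum K g h) :
    embed K g h (derivedBracket π ρ μ 3 P) =
      iteratedBracket (bracket (g × h)) (delta π ρ μ) 3 fun i => embed K g h (P i) := by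
  change projection K g h (iteratedBracket (bracket (g × h)) (delta π ρ μ) 3
    fun i => embed K g h (P i)) = _
  rw [delta_eq_add, iteratedBracket_add, map_add,
    ((hasWeight_delta_zero π ρ).iterate 3 P).projection_eq_self (by norm_num),
    ((hasWeight_delta_neg_two μ).iterate 3 P).projection_eq_self (by norm_num)]

/-- The two parts of [Δ, P] have weights 1 and -1, both nonzero, so on arguments in g there is no
value in g. -/
theorem bracket_delta_embed_fst (π : g [⋀^Fin 3]→ₗ[K] g) (ρ : g [⋀^Fin 2]→ₗ[K] Module.End K h)
    (μ : h [⋀^Fin 3]→ₗ[K] h) (P : CochainSum K g h) (n : ℕ) (X : Fin n → ⋀[K]^2 g) (x : g) :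
    ((bracket (g × h) (delta π ρ μ) (embed K g h P) n).1
      (fun i => exteriorPower.map 2 (LinearMap.inl K g h) (X i)) (x, 0)).1 = 0 := by
  rw [delta_eq_add, map_add, LinearMap.add_apply]
  have h0 := ((hasWeight_delta_zero π ρ).lie (hasWeight_embed P)).fst_eq_zero (by norm_num) n X x
  have h2 := ((hasWeight_delta_neg_two μ).lie (hasWeight_embed P)).fst_eq_zero
    (by norm_num) n X x
  change (_ : g × h).1 + (_ : g × h).1 = 0
  rw [h0, h2, add_zero]

end DeltaWeights

end ThreeLie

/-! ### The main theorem -/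

theorem mainTheorem2 {K g h : Type*} [Field K] [CharZero K]
    [AddCommGroup g] [Module K g] [AddCommGroup h] [Module K h]
    (π : g [⋀^Fin 3]→ₗ[K] g) (μ : h [⋀^Fin 3]→ₗ[K] h) (ρ : g [⋀^Fin 2]→ₗ[K] Module.End K h)
    (hπ : ThreeLie.IsThreeLieBracket π) (hμ : ThreeLie.IsThreeLieBracket μ)
    (hρ : ThreeLie.IsAction π μ ρ) :
    -- the V-data
    ThreeLie.IsVData (ThreeLie.grading K (g × h) (g × h)) (ThreeLie.bracket (g × h))
      (LinearMap.range (ThreeLie.embed K g h)) (ThreeLie.projection K g h)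
      (ThreeLie.delta π ρ μ) ∧
    -- its higher derived brackets make `C^*(g, h)` an `L_∞`-algebra
    ThreeLie.IsLInftyAlgebra (ThreeLie.grading K g h) (ThreeLie.derivedBracket π ρ μ) ∧
    -- `l₁(P) = 𝒫[Δ, P]`
    (∀ P : ThreeLie.CochainSum K g h,
      ThreeLie.embed K g h (ThreeLie.derivedBracket π ρ μ 1 ![P]) =
        ThreeLie.projection K g h
          (ThreeLie.bracket (g × h) (ThreeLie.delta π ρ μ) (ThreeLie.embed K g h P))) ∧
    -- `l₁(P)` and `[Δ, P]` are equal on arguments in `g`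
    (∀ (P : ThreeLie.CochainSum K g h) (n : ℕ) (X : Fin n → ⋀[K]^2 g) (x : g),
      (ThreeLie.bracket (g × h) (ThreeLie.delta π ρ μ) (ThreeLie.embed K g h P) n).1
          (fun i => exteriorPower.map 2 (LinearMap.inl K g h) (X i)) (x, 0) =
        (0, (ThreeLie.derivedBracket π ρ μ 1 ![P] n).1 X x)) ∧
    -- `l₃(P, Q, R) = [[[Δ, P], Q], R]`
    (∀ P Q R : ThreeLie.CochainSum K g h,
      ThreeLie.embed K g h (ThreeLie.derivedBracket π ρ μ 3 ![P, Q, R]) =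
        ThreeLie.bracket (g × h)
          (ThreeLie.bracket (g × h)
            (ThreeLie.bracket (g × h) (ThreeLie.delta π ρ μ) (ThreeLie.embed K g h P))
            (ThreeLie.embed K g h Q))
          (ThreeLie.embed K g h R)) ∧
    -- all other brackets vanish
    (∀ k : ℕ, k ≠ 1 → k ≠ 3 → ThreeLie.derivedBracket π ρ μ k = 0) := by
  have hV := ThreeLie.isVData_delta hπ hμ hρ
  refine ⟨hV, ThreeLie.isLInftyAlgebra_derivedBracket hV, fun P => rfl, fun P n X x => ?_,
    fun P Q R => ThreeLie.embed_derivedBracket_three π ρ μ ![P, Q, R],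
    fun k h1 h3 => ThreeLie.derivedBracket_eq_zero π ρ μ h1 h3⟩
  -- The second components agree by definition, since `restrict` evaluates on g and takes the
  -- component in h.
  exact Prod.ext (ThreeLie.bracket_delta_embed_fst π ρ μ P n X x) rfl
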